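/- **Setting.** Work on $\mathbb R^{1+3}$ with rectangular coordinates $(x^0,x^1,x^2,x^3)$ and Minkowski metric $\eta=\mathrm{diag}(-1,1,1,1)$. Indices run over $0,\dots,3$, repeated indices are summed, and indices are lowered and raised with $\eta$. The symbol $\epsilon_{\alpha\beta\gamma\delta}$ is fully antisymmetric with $\epsilon_{0123}=1$, so $\epsilon^{0123}=-1$. *Thermodynamics.* Let a smooth equation of state be given: the pressure $p=p(\rho,s)$ and the energy density $\rho=\rho(n,s)$ (with $n>0$ the number density and $s$ the entropy) satisfy $H:=(\rho+p)/n=\partial\rho/\partial n|_s$. Put $h:=\ln(H/\overline H)$ with a constant $\overline H>0$; all quantities are regarded as functions of $(h,s)$ on an open set of values, on which $n=n(h,s)$ is smooth. Let $\theta:=\frac1n\,\partial\rho/\partial s|_n$, $q:=\theta/H$, and $c:=\sqrt{\partial p/\partial\rho|_s}$, with $c>0$. Write $Q_{;h}$, $Q_{;s}$ for the partial derivatives of $Q(h,s)$. *Equations.* Let $(h,s,u^\alpha)$ be a $C^3$ solution, on an open set of spacetime, of the relativistic Euler equations $$u^\kappa\partial_\kappa h+c^2\partial_\kappa u^\kappa=0,\qquad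 u^\kappa\partial_\kappa u^\alpha+(\eta^{\alpha\kappa}+u^\alpha u^\kappa)\partial_\kappa h-q\,\eta^{\alpha\kappa}\partial_\kappa s=0,\qquad u^\kappa\partial_\kappa s=0,\qquad u_\kappa u^\kappa=-1,$$ with $u^0>0$ and $0<c\le1$ along the solution. *Derived quantities.* $S_\alpha:=\partial_\alpha s$; $\mathrm{vort}^\alpha(V):=-\epsilon^{\alpha\beta\gamma\delta}u_\beta\partial_\gamma V_\delta$ for a one-form $V$; $\varpi^\alpha:=\mathrm{vort}^\alpha(Hu)$; the acoustical metric $g_{\alpha\beta}:=c^{-2}\eta_{\alpha\beta}+(c^{-2}-1)u_\alpha u_\beta$, with inverse $(g^{-1})^{\alpha\beta}=c^2\eta^{\alpha\beta}+(c^2-1)u^\alpha u^\beta$; $\square_g f:=|\det g|^{-1/2}\partial_\alpha\big(|\det g|^{1/2}(g^{-1})^{\alpha\beta}\partial_\beta f\big)$ for scalar functions $f$ (the components $u^\alpha$ are treated as scalars); and $$\mathcal C^\alpha:=\mathrm{vort}^\alpha(\varpi)+c^{-2}\epsilon^{\alpha\beta\gamma\delta}u_\beta(\partial_\gamma h)\varpi_\delta+(\theta-\theta_{;h})S^\alpha\partial_\kappa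 u^\kappa+(\theta-\theta_{;h})u^\alpha S^\kappa\partial_\kappa h+(\theta_{;h}-\theta)S^\kappa\eta^{\alpha\lambda}\partial_\lambda u_\kappa,$$ $$\mathcal D:=\tfrac1n\partial_\kappa S^\kappa+\tfrac1n S^\kappa\partial_\kappa h-\tfrac1n c^{-2}S^\kappa\partial_\kappa h.$$ The standard $g$-null forms are $(g^{-1})^{\alpha\beta}\partial_\alpha\phi\,\partial_\beta\psi$ and $\partial_\mu\phi\,\partial_\nu\psi-\partial_\nu\phi\,\partial_\mu\psi$ $(\mu<\nu)$, with $\phi,\psi$ among the scalars $h,s,u^\alpha,S^\alpha,\varpi^\alpha$. A *$g$-null form* is a linear combination of these with coefficients that are functions of $(h,s,u^\alpha,S^\alpha,\varpi^\alpha)$, not of their derivatives, and that depend only on the equation of state. "Linear", "at most linear" and "at most quadratic" in the derivatives refer to the first derivatives of these scalars, with coefficients of the same kind. **Theorem.** $S^\alpha,\varpi^\alpha$ are $C^2$, $\mathcal C^\alpha,\mathcal D$ are $C^1$, and the following equations hold. *Wave equations.* $$\square_g h=nc^2q\,\mathcal D+\mathfrak Q_{(h)}+\mathfrak L_{(h)},\qquad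 \square_g u^\alpha=-\tfrac{c^2}{H}\mathcal C^\alpha+\mathfrak Q_{(u^\alpha)}+\mathfrak L_{(u^\alpha)},\qquad \square_g s=c^2n\,\mathcal D+\mathfrak L_{(s)}.$$ *Transport equations.* $$u^\kappa\partial_\kappa S^\alpha=-S_\kappa\eta^{\alpha\lambda}\partial_\lambda u^\kappa,$$ $$u^\kappa\partial_\kappa\varpi^\alpha=-u^\alpha\varpi^\kappa\partial_\kappa h+\varpi^\kappa\partial_\kappa u^\alpha-\varpi^\alpha\partial_\kappa u^\kappa+(\theta-\theta_{;h})\epsilon^{\alpha\beta\gamma\delta}u_\beta(\partial_\gamma h)S_\delta+q\,u^\alpha\varpi^\kappa S_\kappa.$$ *Transport-div-curl system for $S$.* $\mathrm{vort}^\alpha(S)=0$ and $$u^\kappa\partial_\kappa\mathcal D=\mathfrak Q'_{(\mathcal D)}+\frac{S_\kappa\mathcal C^\kappa}{nH}+\mathfrak Q_{(\mathcal D)}+\mathfrak L_{(\mathcal D)}.$$ *Transport-div-curl system for $\varpi$.* $\partial_\alpha\varpi^\alpha=-\varpi^\kappa\partial_\kappa h+2q\,\varpi^\kappa S_\kappa$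 and $$\begin{aligned}u^\kappa\partial_\kappa\mathcal C^\alpha=&\ \mathcal C^\kappa\partial_\kappa u^\alpha-2\mathcal C^\alpha\partial_\kappa u^\kappa+u^\alpha\mathcal C^\kappa u^\lambda\partial_\lambda u_\kappa+\mathfrak Q'_{(\mathcal C^\alpha)}+(\theta-\theta_{;h})n\,u^\alpha(u^\kappa\partial_\kappa h)\mathcal D\\&+(\theta-\theta_{;h})q\,S^\alpha\partial_\kappa S^\kappa+(\theta_{;h}-\theta)q\,S_\kappa\eta^{\alpha\lambda}\partial_\lambda S^\kappa+\mathfrak Q_{(\mathcal C^\alpha)}+\mathfrak L_{(\mathcal C^\alpha)}.\end{aligned}$$ Here all $\mathfrak Q$ are the $g$-null forms $$\begin{aligned} \mathfrak Q_{(h)}=&-c^{-1}c_{;h}(g^{-1})^{\kappa\lambda}\partial_\kappa h\,\partial_\lambda h+c^2\{\partial_\kappa u^\kappa\partial_\lambda u^\lambda-\partial_\lambda u^\kappa\partial_\kappa u^\lambda\},\\ \mathfrak Q_{(u^\alpha)}=&\ \eta^{\alpha\lambda}\{\partial_\kappa u^\kappa\partial_\lambda h-\partial_\lambda u^\kappa\partial_\kappa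 h\}+c^2u^\alpha\{\partial_\kappa u^\lambda\partial_\lambda u^\kappa-\partial_\lambda u^\lambda\partial_\kappa u^\kappa\}\\&-\{1+c^{-1}c_{;h}\}(g^{-1})^{\kappa\lambda}\partial_\kappa h\,\partial_\lambda u^\alpha,\\ \mathfrak Q_{(\mathcal D)}=&\ \tfrac1nc^{-2}S^\kappa\{\partial_\kappa u^\lambda\partial_\lambda h-\partial_\lambda u^\lambda\partial_\kappa h\},\\ \mathfrak Q'_{(\mathcal D)}=&\ \tfrac2n\{\partial_\kappa S^\kappa\partial_\lambda u^\lambda-\partial_\lambda S^\kappa\partial_\kappa u^\lambda\}+\tfrac1nc^{-2}u^\kappa\{\partial_\kappa h\,\partial_\lambda S^\lambda-\partial_\lambda h\,\partial_\kappa S^\lambda\},\\ \mathfrak Q'_{(\mathcal C^\alpha)}=&-2\epsilon^{\alpha\beta\gamma\delta}u_\beta\,\partial_\gamma\varpi^\kappa\,\partial_\delta u_\kappa+(\theta_{;h}-\theta)\{\eta^{\alpha\kappa}+2u^\alpha u^\kappa\}\{\partial_\kappa h\,\partial_\lambda S^\lambda-\partial_\lambda h\,\partial_\kappa S^\lambda\},\\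 \mathfrak Q_{(\mathcal C^\alpha)}=&-c^{-2}\epsilon^{\kappa\beta\gamma\delta}(\partial_\kappa u^\alpha)u_\beta(\partial_\gamma h)\varpi_\delta+(c^{-2}+2)\epsilon^{\alpha\beta\gamma\delta}u_\beta(\partial_\gamma h)\varpi^\kappa\partial_\delta u_\kappa\\ &+c^{-2}\epsilon^{\alpha\beta\gamma\delta}u_\beta\varpi_\delta\{\partial_\kappa u^\kappa\partial_\gamma h-\partial_\gamma u^\kappa\partial_\kappa h\}\\ &+\{(\theta_{;h;h}-\theta_{;h})+c^{-2}(\theta-\theta_{;h})\}u^\kappa\eta^{\alpha\lambda}S^\beta\{\partial_\kappa h\,\partial_\lambda u_\beta-\partial_\lambda h\,\partial_\kappa u_\beta\}\\ &+(\theta_{;h}-\theta)S^\kappa u^\lambda\{\partial_\kappa u^\alpha\partial_\lambda h-\partial_\lambda u^\alpha\partial_\kappa h\}\\ &+(\theta_{;h}-\theta)\{2\eta^{\alpha\kappa}+u^\alpha u^\kappa\}S^\beta\{\partial_\kappa u_\beta\,\partial_\lambda u^\lambda-\partial_\lambda u_\beta\,\partial_\kappa u^\lambda\}\\ &+(\theta_{;h}-\theta)S^\alpha\{\partial_\kappa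 u^\lambda\partial_\lambda u^\kappa-\partial_\lambda u^\lambda\partial_\kappa u^\kappa\}+(\theta_{;h}-\theta)S^\kappa\{\partial_\kappa u^\alpha\partial_\lambda u^\lambda-\partial_\lambda u^\alpha\partial_\kappa u^\lambda\}\\ &+S^\alpha\{c^{-2}(\theta_{;h}-\theta_{;h;h})+c^{-4}(\theta_{;h}-\theta)\}(g^{-1})^{\kappa\lambda}\partial_\kappa h\,\partial_\lambda h, \end{aligned}$$ and the $\mathfrak L$ are at most linear in the derivatives ($\mathfrak L_{(\mathcal D)}$ is linear): $$\begin{aligned} \mathfrak L_{(h)}=&\ \{(1-c^2)q+c^2q_{;h}-cc_{;s}\}S^\kappa\partial_\kappa h+c^2q_{;s}S_\kappa S^\kappa,\\ \mathfrak L_{(s)}=&\ \{1-c^2-cc_{;h}\}S^\kappa\partial_\kappa h-cc_{;s}S_\kappa S^\kappa,\\ \mathfrak L_{(u^\alpha)}=&-\tfrac{c^2}{H}\epsilon^{\alpha\beta\gamma\delta}(\partial_\beta u_\gamma)\varpi_\delta+\tfrac{1-c^2}{H}\epsilon^{\alpha\beta\gamma\delta}u_\beta(\partial_\gamma h)\varpi_\delta+\tfrac{(1-c^2)q}{H}\epsilon^{\alpha\beta\gamma\delta}S_\beta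 u_\gamma\varpi_\delta\\ &+\{q-cc_{;s}\}S^\kappa\partial_\kappa u^\alpha+q(c^2-1)u^\alpha S^\kappa u^\lambda\partial_\lambda u_\kappa+\{c^2q+\tfrac{(\theta_{;h}-\theta)c^2}{H}\}S^\kappa\eta^{\alpha\lambda}\partial_\lambda u_\kappa\\ &+\{2c^{-1}c_{;h}q+2c^{-1}c_{;s}-q_{;h}\}S^\alpha u^\kappa\partial_\kappa h+\{\tfrac{(\theta-\theta_{;h})c^2}{H}-q\}S^\alpha\partial_\kappa u^\kappa+\tfrac{(\theta-\theta_{;h})c^2}{H}u^\alpha S^\kappa\partial_\kappa h,\\ \mathfrak L_{(\mathcal D)}=&\ \tfrac{1-c^{-2}}{nH}\epsilon^{\alpha\beta\gamma\delta}S_\alpha u_\beta(\partial_\gamma h)\varpi_\delta+\tfrac1{nH}\epsilon^{\alpha\beta\gamma\delta}S_\alpha(\partial_\beta u_\gamma)\varpi_\delta+\tfrac{S^\kappa S^\lambda}{n}\{\tfrac{\theta-\theta_{;h}}{H}-2q\}\partial_\kappa u_\lambda\\ &+\tfrac{S_\kappa S^\kappa}{n}\{\tfrac{\theta_{;h}-\theta}{H}+2c^{-1}c_{;s}-c^2q_{;h}+q\}\partial_\lambda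 u^\lambda,\\ \mathfrak L_{(\mathcal C^\alpha)}=&\ \tfrac{2q}{H}\varpi^\kappa S_\kappa\varpi^\alpha-\tfrac2H\varpi^\alpha\varpi^\kappa\partial_\kappa h+2c^{-3}c_{;s}\epsilon^{\alpha\beta\gamma\delta}u_\beta S_\gamma\varpi_\delta\,u^\kappa\partial_\kappa h\\ &-2q\,\epsilon^{\alpha\beta\gamma\delta}u_\beta S_\gamma\varpi^\kappa\partial_\delta u_\kappa-q\,\epsilon^{\alpha\beta\gamma\delta}S_\beta u_\gamma\varpi_\delta\,\partial_\kappa u^\kappa+\tfrac{\theta-\theta_{;h}}{H}\epsilon^{\kappa\beta\gamma\delta}(\partial_\kappa u^\alpha)S_\beta u_\gamma\varpi_\delta\\ &+c^{-2}q\,\epsilon^{\alpha\beta\gamma\delta}S_\beta(\partial_\gamma h)\varpi_\delta-c^{-2}q\,u^\alpha\epsilon^{\kappa\beta\gamma\delta}S_\kappa u_\beta(\partial_\gamma h)\varpi_\delta+(\theta_{;h}-\theta)q\,S_\kappa S^\kappa u^\lambda\partial_\lambda u^\alpha\\ &+u^\alpha S_\kappa S^\kappa\{(\theta_{;h}-\theta)q+\theta_{;h;s}-\theta_{;s}\}u^\lambda\partial_\lambda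 h+S^\alpha\{\theta_{;s}-\theta_{;h;s}+(\theta-\theta_{;h})q_{;h}\}S^\kappa\partial_\kappa h\\ &+S_\kappa S^\kappa\{(\theta_{;h;h}-\theta_{;h})q+\theta_{;h;s}-\theta_{;s}+(\theta-\theta_{;h})qc^{-2}+(\theta_{;h}-\theta)q_{;h}\}\eta^{\alpha\lambda}\partial_\lambda h. \end{aligned}$$ Moreover, every right-hand side above is at most quadratic in the derivatives of $(h,s,u^\alpha,S^\alpha,\varpi^\alpha)$ (after inserting the definitions of $\mathcal C^\alpha$ and $\mathcal D$), and, apart from the terms that carry $\mathcal C^\kappa$ or $\mathcal D$ as an explicit factor (whose coefficients are at most linear in the derivatives), it is the sum of a $g$-null form and an expression at most linear in the derivatives. -/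

import Mathlib

open scoped ContDiff

noncomputable section

namespace RelEuler

/-! ### Minkowski spacetime in rectangular coordinates -/

/-- The coordinate space `ℝ^{1+3}`; the coordinate `x 0` is time. -/
abbrev Spacetime := Fin 4 → ℝ

/-- The coordinate partial derivative `∂_μ f` at `x`. -/
def pd (μ : Fin 4) (f : Spacetime → ℝ) (x : Spacetime) : ℝ :=
  fderiv ℝ f x (Pi.single μ 1)

/-- The Minkowski metric `diag(-1,1,1,1)`. Its inverse has the same components, so `eta` is also
used for `η⁻¹`. -/
def eta : Matrix (Fin 4) (Fin 4) ℝ := Matrix.diagonal ![-1, 1, 1, 1]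

theorem eta_mul_eta : eta * eta = 1 := by
  unfold eta
  rw [Matrix.diagonal_mul_diagonal, ← Matrix.diagonal_one]
  congr 1
  funext i
  fin_cases i <;> simp

/-- Lowering an index: `V_α = η_{αβ} V^β`. -/
def lower (V : Fin 4 → ℝ) (α : Fin 4) : ℝ := ∑ β, eta α β * V β

/-- Raising an index: `V^α = (η⁻¹)^{αβ} V_β`. -/
def raise (V : Fin 4 → ℝ) (α : Fin 4) : ℝ := ∑ β, eta α β * V β

/-- The sign of `b - a`, an integer. -/
def signDiff (a b : Fin 4) : ℤ := if a < b then 1 else if b < a then -1 else 0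

/-- The fully antisymmetric symbol `ε_{αβγδ}`, as the product over all pairs of slots of the sign
of the difference of the entries. -/
def epsInt (α β γ δ : Fin 4) : ℤ :=
  signDiff α β * signDiff α γ * signDiff α δ * signDiff β γ * signDiff β δ * signDiff γ δ

theorem epsInt_zero_one_two_three : epsInt 0 1 2 3 = 1 := by decide

theorem epsInt_swap : ∀ α β γ δ : Fin 4, epsInt β α γ δ = -epsInt α β γ δ ∧
    epsInt α γ β δ = -epsInt α β γ δ ∧ epsInt α β δ γ = -epsInt α β γ δ := by decide

/-- `ε^{αβγδ}`: all four indices of `ε_{αβγδ}` raised with the (diagonal) Minkowski metric. In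
particular `ε^{0123} = -1`. -/
def epsUp (α β γ δ : Fin 4) : ℝ :=
  eta α α * eta β β * eta γ γ * eta δ δ * (epsInt α β γ δ : ℝ)

/-- `vort^α(V) = - ε^{αβγδ} u_β ∂_γ V_δ` in terms of the value of the vector `u` and of the first
derivatives `dV γ δ = ∂_γ V_δ` of the one-form `V`. -/
def vortAt (u : Fin 4 → ℝ) (dV : Fin 4 → Fin 4 → ℝ) (α : Fin 4) : ℝ :=
  -∑ β, ∑ γ, ∑ δ, epsUp α β γ δ * lower u β * dV γ δ

/-- The `u`-orthogonal vorticity of the one-form field `V`. -/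
def vort (u V : Spacetime → Fin 4 → ℝ) (x : Spacetime) (α : Fin 4) : ℝ :=
  vortAt (u x) (fun γ δ => pd γ (fun y => V y δ) x) α

/-! ### Thermodynamics -/

/-- `Q_{;h}`, the partial derivative in `h` at fixed `s`. -/
def ddh (Q : ℝ → ℝ → ℝ) (h s : ℝ) : ℝ := deriv (fun h' => Q h' s) h

/-- `Q_{;s}`, the partial derivative in `s` at fixed `h`. -/
def dds (Q : ℝ → ℝ → ℝ) (h s : ℝ) : ℝ := deriv (fun s' => Q h s') s

/-- An equation of state. The primitive data are the pressure `p = p(ρ, s)`, the energy density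
`ρ = ρ(n, s)` and the reference enthalpy. The variables `(h, s)` range over the open set `dom`, on
which the number density is expressed as the function `number` of `(h, s)`: this says that `number`
solves `H = ∂ρ/∂n|_s`, where `H = Hbar * exp h`. Beyond that, the definition of the enthalpy
`H = (ρ + p) / n` is required, smoothness, and a positive (squared) speed of sound. The temperature
and the speed of sound are defined from these data below; `dH = dp / n + θ ds` is a
consequence. -/
structure EquationOfState where
  /-- the pressure `p(ρ, s)` -/
  pressure : ℝ → ℝ → ℝ
  /-- the proper energy density `ρ(n, s)` -/
  energy : ℝ → ℝ → ℝ
  /-- the proper number density `n(h, s)` -/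
  number : ℝ → ℝ → ℝ
  /-- the reference value of the enthalpy -/
  Hbar : ℝ
  /-- the admissible values of `(h, s)` -/
  dom : Set (ℝ × ℝ)
  isOpen_dom : IsOpen dom
  Hbar_pos : 0 < Hbar
  number_pos : ∀ h s, (h, s) ∈ dom → 0 < number h s
  contDiffOn_number : ContDiffOn ℝ ∞ (fun z : ℝ × ℝ => number z.1 z.2) dom
  contDiffAt_energy : ∀ h s, (h, s) ∈ dom →
    ContDiffAt ℝ ∞ (fun z : ℝ × ℝ => energy z.1 z.2) (number h s, s)
  deriv_energy : ∀ h s, (h, s) ∈ dom →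
    deriv (fun n => energy n s) (number h s) = Hbar * Real.exp h
  enthalpy_eq : ∀ h s, (h, s) ∈ dom →
    Hbar * Real.exp h =
      (energy (number h s) s + pressure (energy (number h s) s) s) / number h s
  deriv_pressure_pos : ∀ h s, (h, s) ∈ dom →
    0 < deriv (fun ρ => pressure ρ s) (energy (number h s) s)

namespace EquationOfState

variable (e : EquationOfState)

/-- The number density `n`. -/
def n (h s : ℝ) : ℝ := e.number h s

/-- The enthalpy per particle `H`, so that `h = log (H / Hbar)`. -/
def H (h : ℝ) : ℝ := e.Hbar * Real.exp h

/-- The temperature `θ = (1/n) ∂ρ/∂s|_n`. -/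
def θ (h s : ℝ) : ℝ := deriv (fun s' => e.energy (e.number h s) s') s / e.number h s

/-- The ratio `q = θ / H`. -/
def q (h s : ℝ) : ℝ := e.θ h s / e.H h

/-- The speed of sound `c = √(∂p/∂ρ|_s)`. -/
def c (h s : ℝ) : ℝ :=
  Real.sqrt (deriv (fun ρ => e.pressure ρ s) (e.energy (e.number h s) s))

end EquationOfState

/-! ### The acoustical metric and its wave operator -/

/-- The acoustical metric `g_{αβ} = c⁻² η_{αβ} + (c⁻² - 1) u_α u_β`. -/
def acousticalMetric (c : ℝ) (u : Fin 4 → ℝ) : Matrix (Fin 4) (Fin 4) ℝ :=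
  Matrix.of fun α β => (c ^ 2)⁻¹ * eta α β + ((c ^ 2)⁻¹ - 1) * lower u α * lower u β

/-- The inverse acoustical metric `(g⁻¹)^{αβ} = c² (η⁻¹)^{αβ} + (c² - 1) u^α u^β`. -/
def acousticalMetricInv (c : ℝ) (u : Fin 4 → ℝ) : Matrix (Fin 4) (Fin 4) ℝ :=
  Matrix.of fun α β => c ^ 2 * eta α β + (c ^ 2 - 1) * u α * u β

/-- The covariant wave operator of the metric `g` with inverse `gInv`, on scalar functions:
`|det g|^{-1/2} ∂_α (|det g|^{1/2} (g⁻¹)^{αβ} ∂_β f)`. -/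
def box (g gInv : Spacetime → Matrix (Fin 4) (Fin 4) ℝ) (f : Spacetime → ℝ) (x : Spacetime) : ℝ :=
  (Real.sqrt |(g x).det|)⁻¹ *
    ∑ α, pd α (fun y => Real.sqrt |(g y).det| * ∑ β, gInv y α β * pd β f y) x

/-! ### Solution variables, their values and their first derivatives -/

/-- The scalar solution variables `h, s, u^α, S^α, ϖ^α`. -/
inductive FluidVar where
  | h : FluidVar
  | s : FluidVar
  | u : Fin 4 → FluidVar
  | S : Fin 4 → FluidVar
  | w : Fin 4 → FluidVar

/-- The values of `h, s, u^α, S^α, ϖ^α` at a point. -/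
structure State where
  h : ℝ
  s : ℝ
  u : Fin 4 → ℝ
  S : Fin 4 → ℝ
  w : Fin 4 → ℝ

/-- The values of the first derivatives of `h, s, u^α, S^α, ϖ^α` at a point; the derivative
index comes first, so `u κ α` is `∂_κ u^α`. -/
structure Grad where
  h : Fin 4 → ℝ
  s : Fin 4 → ℝ
  u : Fin 4 → Fin 4 → ℝ
  S : Fin 4 → Fin 4 → ℝ
  w : Fin 4 → Fin 4 → ℝ

/-- The differential of the scalar variable `φ`, a covector. -/
def Grad.d (p : Grad) : FluidVar → Fin 4 → ℝ
  | .h => p.h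
  | .s => p.s
  | .u α => fun κ => p.u κ α
  | .S α => fun κ => p.S κ α
  | .w α => fun κ => p.w κ α

/-- Expressions in the solution variables and their first derivatives. They form a module over the
functions of the solution variables (not their derivatives). -/
abbrev Expr := State → Grad → ℝ

/-- `∂_μ φ` as an expression. -/
def dExpr (φ : FluidVar) (μ : Fin 4) : Expr := fun _ p => p.d φ μ

/-- Expressions that are (homogeneous) linear in the derivatives. -/
def linearForms : Submodule (State → ℝ) Expr :=
  Submodule.span (State → ℝ) {F | ∃ φ μ, F = dExpr φ μ}

/-- Expressions that are at most linear in the derivatives. -/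
def atMostLinear : Submodule (State → ℝ) Expr :=
  Submodule.span (State → ℝ) ({1} ∪ {F | ∃ φ μ, F = dExpr φ μ})

/-- Expressions that are at most quadratic in the derivatives. -/
def atMostQuadratic : Submodule (State → ℝ) Expr :=
  Submodule.span (State → ℝ) ({1} ∪ {F | ∃ φ μ, F = dExpr φ μ} ∪
    {F | ∃ φ ψ μ ν, F = dExpr φ μ * dExpr ψ ν})

/-- The contraction `(g⁻¹)^{αβ} ξ_α ζ_β` with the inverse acoustical metric. -/
def gDot (e : EquationOfState) (v : State) (ξ ζ : Fin 4 → ℝ) : ℝ :=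
  ∑ α, ∑ β, acousticalMetricInv (e.c v.h v.s) v.u α β * ξ α * ζ β

/-- The standard null form `(g⁻¹)^{αβ} ∂_α φ ∂_β ψ`. -/
def nullG (e : EquationOfState) (φ ψ : FluidVar) : Expr :=
  fun v p => gDot e v (p.d φ) (p.d ψ)

/-- The standard null form `∂_μ φ ∂_ν ψ - ∂_ν φ ∂_μ ψ`. -/
def nullAnti (μ ν : Fin 4) (φ ψ : FluidVar) : Expr :=
  fun _ p => p.d φ μ * p.d ψ ν - p.d φ ν * p.d ψ μ

/-- The `g`-null forms: linear combinations of the standard null forms, with coefficients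
that are functions of the solution variables but not of their derivatives. -/
def nullForms (e : EquationOfState) : Submodule (State → ℝ) Expr :=
  Submodule.span (State → ℝ) ({F | ∃ φ ψ, F = nullG e φ ψ} ∪
    {F | ∃ φ ψ μ ν, μ < ν ∧ F = nullAnti μ ν φ ψ})

/-! ### The modified fluid variables -/

/-- The modified vorticity of the vorticity `𝒞^α`. -/
def modC (e : EquationOfState) (α : Fin 4) : Expr := fun v p =>
  let c := e.c v.h v.s
  let θ := e.θ v.h v.s
  let θ_h := ddh e.θ v.h v.s;
  vortAt v.u (fun γ δ => lower (p.w γ) δ) α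
  + (c ^ 2)⁻¹ * ∑ β, ∑ γ, ∑ δ, epsUp α β γ δ * lower v.u β * p.h γ * lower v.w δ
  + (θ - θ_h) * v.S α * ∑ κ, p.u κ κ
  + (θ - θ_h) * v.u α * ∑ κ, v.S κ * p.h κ
  + (θ_h - θ) * ∑ κ, v.S κ * ∑ l, eta α l * lower (p.u l) κ

/-- The modified divergence of the entropy gradient `𝒟`. -/
def modD (e : EquationOfState) : Expr := fun v p =>
  let n := e.n v.h v.s
  let c := e.c v.h v.s;
  1 / n * (∑ κ, p.S κ κ) + 1 / n * (∑ κ, v.S κ * p.h κ)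
  - 1 / n * (c ^ 2)⁻¹ * ∑ κ, v.S κ * p.h κ

/-! ### Null forms and linear terms -/

/-- `𝔔_{(h)}` -/
def Qh (e : EquationOfState) : Expr := fun v p =>
  let c := e.c v.h v.s
  let c_h := ddh e.c v.h v.s;
  -(c⁻¹ * c_h * gDot e v p.h p.h)
  + c ^ 2 * ∑ κ, ∑ l, (p.u κ κ * p.u l l - p.u l κ * p.u κ l)

/-- `𝔏_{(h)}` -/
def Lh (e : EquationOfState) : Expr := fun v p =>
  let c := e.c v.h v.s
  let c_s := dds e.c v.h v.s
  let q := e.q v.h v.s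
  let q_h := ddh e.q v.h v.s
  let q_s := dds e.q v.h v.s;
  ((1 - c ^ 2) * q + c ^ 2 * q_h - c * c_s) * (∑ κ, v.S κ * p.h κ)
  + c ^ 2 * q_s * ∑ κ, lower v.S κ * v.S κ

/-- `𝔔_{(u^α)}` -/
def Qu (e : EquationOfState) (α : Fin 4) : Expr := fun v p =>
  let c := e.c v.h v.s
  let c_h := ddh e.c v.h v.s;
  (∑ l, eta α l * ∑ κ, (p.u κ κ * p.h l - p.u l κ * p.h κ))
  + c ^ 2 * v.u α * (∑ κ, ∑ l, (p.u κ l * p.u l κ - p.u l l * p.u κ κ))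
  - (1 + c⁻¹ * c_h) * gDot e v p.h (fun l => p.u l α)

/-- `𝔏_{(u^α)}` -/
def Lu (e : EquationOfState) (α : Fin 4) : Expr := fun v p =>
  let c := e.c v.h v.s
  let c_h := ddh e.c v.h v.s
  let c_s := dds e.c v.h v.s
  let H := e.H v.h
  let q := e.q v.h v.s
  let q_h := ddh e.q v.h v.s
  let θ := e.θ v.h v.s
  let θ_h := ddh e.θ v.h v.s;
  -(c ^ 2 / H * ∑ β, ∑ γ, ∑ δ, epsUp α β γ δ * lower (p.u β) γ * lower v.w δ)
  + (1 - c ^ 2) / H * (∑ β, ∑ γ, ∑ δ, epsUp α β γ δ * lower v.u β * p.h γ * lower v.w δ)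
  + (1 - c ^ 2) * q / H *
      (∑ β, ∑ γ, ∑ δ, epsUp α β γ δ * lower v.S β * lower v.u γ * lower v.w δ)
  + (q - c * c_s) * (∑ κ, v.S κ * p.u κ α)
  + q * (c ^ 2 - 1) * v.u α * (∑ κ, v.S κ * ∑ l, v.u l * lower (p.u l) κ)
  + (c ^ 2 * q + (θ_h - θ) * c ^ 2 / H) * (∑ κ, v.S κ * ∑ l, eta α l * lower (p.u l) κ)
  + (2 * c⁻¹ * c_h * q * v.S α + 2 * c⁻¹ * c_s * v.S α - q_h * v.S α) * (∑ κ, v.u κ * p.h κ)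
  + v.S α * ((θ - θ_h) * c ^ 2 / H - q) * (∑ κ, p.u κ κ)
  + (θ - θ_h) * c ^ 2 / H * v.u α * ∑ κ, v.S κ * p.h κ

/-- `𝔏_{(s)}` -/
def Ls (e : EquationOfState) : Expr := fun v p =>
  let c := e.c v.h v.s
  let c_h := ddh e.c v.h v.s
  let c_s := dds e.c v.h v.s;
  (1 - c ^ 2 - c * c_h) * (∑ κ, v.S κ * p.h κ) - c * c_s * ∑ κ, lower v.S κ * v.S κ

/-- `𝔔_{(𝒟)}` -/
def QD (e : EquationOfState) : Expr := fun v p =>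
  let n := e.n v.h v.s
  let c := e.c v.h v.s;
  1 / n * (c ^ 2)⁻¹ * ∑ κ, v.S κ * ∑ l, (p.u κ l * p.h l - p.u l l * p.h κ)

/-- The derivative-quadratic terms in the transport equation for `𝒟` that involve `∂S`. -/
def QDS (e : EquationOfState) : Expr := fun v p =>
  let n := e.n v.h v.s
  let c := e.c v.h v.s;
  2 / n * (∑ κ, ∑ l, (p.S κ κ * p.u l l - p.S l κ * p.u κ l))
  + 1 / n * (c ^ 2)⁻¹ * ∑ κ, v.u κ * ∑ l, (p.h κ * p.S l l - p.h l * p.S κ l)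

/-- `𝔏_{(𝒟)}` -/
def LD (e : EquationOfState) : Expr := fun v p =>
  let n := e.n v.h v.s
  let c := e.c v.h v.s
  let c_s := dds e.c v.h v.s
  let H := e.H v.h
  let q := e.q v.h v.s
  let q_h := ddh e.q v.h v.s
  let θ := e.θ v.h v.s
  let θ_h := ddh e.θ v.h v.s;
  (1 - (c ^ 2)⁻¹) / (n * H) *
      (∑ α, ∑ β, ∑ γ, ∑ δ,
        epsUp α β γ δ * lower v.S α * lower v.u β * p.h γ * lower v.w δ)
  + 1 / (n * H) *
      (∑ α, ∑ β, ∑ γ, ∑ δ, epsUp α β γ δ * lower v.S α * lower (p.u β) γ * lower v.w δ)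
  + 1 / n * ((θ - θ_h) / H - 2 * q) * (∑ κ, ∑ l, v.S κ * v.S l * lower (p.u κ) l)
  + (∑ κ, lower v.S κ * v.S κ) / n *
      ((θ_h - θ) / H + 2 * c⁻¹ * c_s - c ^ 2 * q_h + q) * ∑ l, p.u l l

/-- `𝔔_{(𝒞^α)}` -/
def QC (e : EquationOfState) (α : Fin 4) : Expr := fun v p =>
  let c := e.c v.h v.s
  let θ := e.θ v.h v.s
  let θ_h := ddh e.θ v.h v.s
  let θ_hh := ddh (ddh e.θ) v.h v.s;
  -((c ^ 2)⁻¹ * ∑ κ, ∑ β, ∑ γ, ∑ δ,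
      epsUp κ β γ δ * p.u κ α * lower v.u β * p.h γ * lower v.w δ)
  + ((c ^ 2)⁻¹ + 2) * (∑ β, ∑ γ, ∑ δ,
      epsUp α β γ δ * lower v.u β * p.h γ * ∑ κ, v.w κ * lower (p.u δ) κ)
  + (c ^ 2)⁻¹ * (∑ β, ∑ γ, ∑ δ, epsUp α β γ δ * lower v.u β * lower v.w δ *
      ∑ κ, (p.u κ κ * p.h γ - p.u γ κ * p.h κ))
  + ((θ_hh - θ_h) + (c ^ 2)⁻¹ * (θ - θ_h)) * (∑ κ, ∑ l, ∑ β, v.u κ * eta α l * v.S β *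
      (p.h κ * lower (p.u l) β - p.h l * lower (p.u κ) β))
  + (θ_h - θ) * (∑ κ, ∑ l, v.S κ * v.u l * (p.u κ α * p.h l - p.u l α * p.h κ))
  + (θ_h - θ) * (∑ κ, (2 * eta α κ + v.u α * v.u κ) * ∑ β, v.S β *
      ∑ l, (lower (p.u κ) β * p.u l l - lower (p.u l) β * p.u κ l))
  + (θ_h - θ) * v.S α * (∑ κ, ∑ l, (p.u κ l * p.u l κ - p.u l l * p.u κ κ))
  + (θ_h - θ) * (∑ κ, v.S κ * ∑ l, (p.u κ α * p.u l l - p.u l α * p.u κ l))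
  + v.S α * ((c ^ 2)⁻¹ * (θ_h - θ_hh) + (c ^ 4)⁻¹ * (θ_h - θ)) * gDot e v p.h p.h

/-- The derivative-quadratic terms in the transport equation for `𝒞^α` that involve `∂ϖ`
or `∂S`. -/
def QCS (e : EquationOfState) (α : Fin 4) : Expr := fun v p =>
  let θ := e.θ v.h v.s
  let θ_h := ddh e.θ v.h v.s;
  -(2 * ∑ β, ∑ γ, ∑ δ, epsUp α β γ δ * lower v.u β * ∑ κ, p.w γ κ * lower (p.u δ) κ)
  + (θ_h - θ) * ∑ κ, (eta α κ + 2 * v.u α * v.u κ) *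
      ∑ l, (p.h κ * p.S l l - p.h l * p.S κ l)

/-- `𝔏_{(𝒞^α)}` -/
def LC (e : EquationOfState) (α : Fin 4) : Expr := fun v p =>
  let c := e.c v.h v.s
  let c_s := dds e.c v.h v.s
  let H := e.H v.h
  let q := e.q v.h v.s
  let q_h := ddh e.q v.h v.s
  let θ := e.θ v.h v.s
  let θ_h := ddh e.θ v.h v.s
  let θ_s := dds e.θ v.h v.s
  let θ_hh := ddh (ddh e.θ) v.h v.s
  let θ_hs := dds (ddh e.θ) v.h v.s;
  2 * q / H * (∑ κ, v.w κ * lower v.S κ) * v.w α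
  - 2 / H * v.w α * (∑ κ, v.w κ * p.h κ)
  + 2 * (c ^ 3)⁻¹ * c_s *
      (∑ β, ∑ γ, ∑ δ, epsUp α β γ δ * lower v.u β * lower v.S γ * lower v.w δ) *
      (∑ κ, v.u κ * p.h κ)
  - 2 * q * (∑ β, ∑ γ, ∑ δ, epsUp α β γ δ * lower v.u β * lower v.S γ *
      ∑ κ, v.w κ * lower (p.u δ) κ)
  - q * (∑ β, ∑ γ, ∑ δ, epsUp α β γ δ * lower v.S β * lower v.u γ * lower v.w δ) *
      (∑ κ, p.u κ κ)
  + 1 / H * (θ - θ_h) * (∑ κ, ∑ β, ∑ γ, ∑ δ,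
      epsUp κ β γ δ * p.u κ α * lower v.S β * lower v.u γ * lower v.w δ)
  + (c ^ 2)⁻¹ * q * (∑ β, ∑ γ, ∑ δ, epsUp α β γ δ * lower v.S β * p.h γ * lower v.w δ)
  - (c ^ 2)⁻¹ * q * v.u α * (∑ κ, ∑ β, ∑ γ, ∑ δ,
      epsUp κ β γ δ * lower v.S κ * lower v.u β * p.h γ * lower v.w δ)
  + (θ_h - θ) * q * (∑ κ, lower v.S κ * v.S κ) * (∑ l, v.u l * p.u l α)
  + v.u α * (∑ κ, lower v.S κ * v.S κ) * ((θ_h - θ) * q + (θ_hs - θ_s)) * (∑ l, v.u l * p.h l)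
  + v.S α * ((θ_s - θ_hs) + (θ - θ_h) * q_h) * (∑ κ, v.S κ * p.h κ)
  + (∑ κ, lower v.S κ * v.S κ) *
      ((θ_hh - θ_h) * q + (θ_hs - θ_s) + (θ - θ_h) * q * (c ^ 2)⁻¹ + (θ_h - θ) * q_h) *
      ∑ l, eta α l * p.h l

/-! ### The right-hand sides

A right-hand side is an expression in the solution variables, their first derivatives, the values
`C κ` of `𝒞^κ`, and the value `D` of `𝒟`. -/

/-- Expressions in the solution variables, their first derivatives, `𝒞^κ` and `𝒟`. -/
abbrev RHS := State → Grad → (Fin 4 → ℝ) → ℝ → ℝ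

/-- Right-hand side of the wave equation for `h`. -/
def rhsWaveH (e : EquationOfState) : RHS := fun v p _ D =>
  e.n v.h v.s * e.c v.h v.s ^ 2 * e.q v.h v.s * D + Qh e v p + Lh e v p

/-- Right-hand side of the wave equation for `u^α`. -/
def rhsWaveU (e : EquationOfState) (α : Fin 4) : RHS := fun v p C _ =>
  -(e.c v.h v.s ^ 2 / e.H v.h * C α) + Qu e α v p + Lu e α v p

/-- Right-hand side of the wave equation for `s`. -/
def rhsWaveS (e : EquationOfState) : RHS := fun v p _ D =>
  e.c v.h v.s ^ 2 * e.n v.h v.s * D + Ls e v p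

/-- Right-hand side of the transport equation for `S^α`. -/
def rhsTransportS (α : Fin 4) : RHS := fun v p _ _ =>
  -∑ κ, lower v.S κ * ∑ l, eta α l * p.u l κ

/-- Right-hand side of the transport equation for `ϖ^α`. -/
def rhsTransportW (e : EquationOfState) (α : Fin 4) : RHS := fun v p _ _ =>
  let q := e.q v.h v.s
  let θ := e.θ v.h v.s
  let θ_h := ddh e.θ v.h v.s;
  -(v.u α * ∑ κ, v.w κ * p.h κ)
  + (∑ κ, v.w κ * p.u κ α)
  - v.w α * (∑ κ, p.u κ κ)
  + (θ - θ_h) * (∑ β, ∑ γ, ∑ δ, epsUp α β γ δ * lower v.u β * p.h γ * lower v.S δ)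
  + q * v.u α * ∑ κ, v.w κ * lower v.S κ

/-- Right-hand side of the transport equation for `𝒟`. -/
def rhsTransportD (e : EquationOfState) : RHS := fun v p C _ =>
  QDS e v p + (∑ κ, lower v.S κ * C κ) / (e.n v.h v.s * e.H v.h) + QD e v p + LD e v p

/-- Right-hand side of the divergence equation for `ϖ`. -/
def rhsDivW (e : EquationOfState) : RHS := fun v p _ _ =>
  -(∑ κ, v.w κ * p.h κ) + 2 * e.q v.h v.s * ∑ κ, v.w κ * lower v.S κ

/-- Right-hand side of the transport equation for `𝒞^α`. -/
def rhsTransportC (e : EquationOfState) (α : Fin 4) : RHS := fun v p C D =>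
  let n := e.n v.h v.s
  let q := e.q v.h v.s
  let θ := e.θ v.h v.s
  let θ_h := ddh e.θ v.h v.s;
  (∑ κ, C κ * p.u κ α)
  - 2 * C α * (∑ κ, p.u κ κ)
  + v.u α * (∑ κ, C κ * ∑ l, v.u l * lower (p.u l) κ)
  + QCS e α v p
  + (θ - θ_h) * n * v.u α * (∑ κ, v.u κ * p.h κ) * D
  + (θ - θ_h) * q * v.S α * (∑ κ, p.S κ κ)
  + (θ_h - θ) * q * (∑ κ, lower v.S κ * ∑ l, eta α l * p.S l κ)
  + QC e α v p + LC e α v p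

/-- The right-hand side is at most quadratic in the derivatives, and its
derivative-quadratic terms are null forms: apart from the terms that carry one of the modified
variables `𝒞^κ`, `𝒟` as a factor (with a coefficient at most linear in the derivatives), it is a
`g`-null form plus an expression at most linear in the derivatives; and after insertion of the
definitions of `𝒞` and `𝒟` it is at most quadratic in the derivatives. -/
def HasNullStructure (e : EquationOfState) (F : RHS) : Prop :=
  (fun v p => F v p (fun κ => modC e κ v p) (modD e v p) : Expr) ∈ atMostQuadratic ∧
  ∃ (A : Fin 4 → Expr) (B Q L : Expr),
    (∀ κ, A κ ∈ atMostLinear) ∧ B ∈ atMostLinear ∧ Q ∈ nullForms e ∧ L ∈ atMostLinear ∧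
    ∀ v p C D, F v p C D = (∑ κ, A κ v p * C κ) + B v p * D + Q v p + L v p

/-! ### Solutions of the relativistic Euler equations -/

/-- The fundamental unknowns: the logarithmic enthalpy `h`, the entropy `s` and the components
`u^α` of the four-velocity. -/
structure Fluid where
  h : Spacetime → ℝ
  s : Spacetime → ℝ
  u : Spacetime → Fin 4 → ℝ

namespace Fluid

variable (f : Fluid) (e : EquationOfState)

/-- The entropy gradient one-form `S_α = ∂_α s`. -/
def SForm (x : Spacetime) (α : Fin 4) : ℝ := pd α f.s x

/-- The entropy gradient vectorfield `S^α`. -/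
def S (x : Spacetime) : Fin 4 → ℝ := raise (f.SForm x)

/-- The vorticity vectorfield `ϖ^α = vort^α(H u)`. -/
def w (x : Spacetime) : Fin 4 → ℝ :=
  vort f.u (fun y δ => e.H (f.h y) * lower (f.u y) δ) x

/-- The values of the solution variables at `x`. -/
def state (x : Spacetime) : State where
  h := f.h x
  s := f.s x
  u := f.u x
  S := f.S x
  w := f.w e x

/-- The first derivatives of the solution variables at `x`. -/
def grad (x : Spacetime) : Grad where
  h := fun κ => pd κ f.h x
  s := fun κ => pd κ f.s x
  u := fun κ α => pd κ (fun y => f.u y α) x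
  S := fun κ α => pd κ (fun y => f.S y α) x
  w := fun κ α => pd κ (fun y => f.w e y α) x

/-- `𝒞^α` along the flow. -/
def C (x : Spacetime) (α : Fin 4) : ℝ := modC e α (f.state e x) (f.grad e x)

/-- `𝒟` along the flow. -/
def D (x : Spacetime) : ℝ := modD e (f.state e x) (f.grad e x)

/-- The acoustical metric of the flow. -/
def g (x : Spacetime) : Matrix (Fin 4) (Fin 4) ℝ :=
  acousticalMetric (e.c (f.h x) (f.s x)) (f.u x)

/-- The inverse acoustical metric of the flow. -/
def gInv (x : Spacetime) : Matrix (Fin 4) (Fin 4) ℝ :=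
  acousticalMetricInv (e.c (f.h x) (f.s x)) (f.u x)

/-- The covariant wave operator of the acoustical metric. -/
def boxg (φ : Spacetime → ℝ) (x : Spacetime) : ℝ := box (f.g e) (f.gInv e) φ x

/-- The derivative `u^κ ∂_κ φ` along the four-velocity. -/
def transport (φ : Spacetime → ℝ) (x : Spacetime) : ℝ := ∑ κ, f.u x κ * pd κ φ x

/-- The value at `x` of a right-hand side. -/
def eval (F : RHS) (x : Spacetime) : ℝ := F (f.state e x) (f.grad e x) (f.C e x) (f.D e x)

/-- `f` is a `C^3` solution, on the open set `Ω`, of the relativistic Euler equations with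
equation of state `e`: the enthalpy, velocity and entropy equations hold, and `u` is a
future-directed unit timelike vectorfield. The speed of sound is at most the speed of light. -/
structure IsSolution (Ω : Set Spacetime) : Prop where
  isOpen : IsOpen Ω
  contDiffOn_h : ContDiffOn ℝ 3 f.h Ω
  contDiffOn_s : ContDiffOn ℝ 3 f.s Ω
  contDiffOn_u : ContDiffOn ℝ 3 f.u Ω
  mem_dom : ∀ x ∈ Ω, (f.h x, f.s x) ∈ e.dom
  c_le_one : ∀ x ∈ Ω, e.c (f.h x) (f.s x) ≤ 1
  future : ∀ x ∈ Ω, 0 < f.u x 0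
  unit : ∀ x ∈ Ω, ∑ κ, lower (f.u x) κ * f.u x κ = -1
  enthalpy : ∀ x ∈ Ω, (∑ κ, f.u x κ * pd κ f.h x)
    + e.c (f.h x) (f.s x) ^ 2 * (∑ κ, pd κ (fun y => f.u y κ) x) = 0
  velocity : ∀ x ∈ Ω, ∀ α, (∑ κ, f.u x κ * pd κ (fun y => f.u y α) x)
    + (∑ κ, (eta α κ + f.u x α * f.u x κ) * pd κ f.h x)
    - e.q (f.h x) (f.s x) * (∑ κ, eta α κ * pd κ f.s x) = 0
  entropy : ∀ x ∈ Ω, ∑ κ, f.u x κ * pd κ f.s x = 0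

end Fluid

end RelEuler

end

open RelEuler

/-!
Both sides of every equation are Lorentz covariant: they are scalars or vectors built from `η`,
`ε`, the solution variables and their derivatives, and the relativistic Euler equations keep their
form under a change of inertial coordinates `x = x₀ + M y`. Given a point of the flow, the boost
that maps the time axis to the four-velocity leads to a flow which is at rest at that point, so
that every identity has to be verified only where `u = (1, 0, 0, 0)`
(`Fluid.IsSolution.exists_restFrame`, `eq_of_restFrame`, `eq_of_restFrame_scalar`). Covariance of
the right-hand sides is `IsRelated.rhsWaveH` and its companions; covariance of the wave operator is
`Fluid.IsSolution.boxg_transform`, which uses that the volume density of the acoustical metric is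
`c⁻³`.

At a point of rest the Euler equations and their first derivatives express all first and second
derivatives with a time component through spatial derivatives (the lemmas `rest_pd_zero_*` and
`rest_pd_pd_zero_*`), and the normalization of `u` determines the derivatives of `u⁰`. The
derivatives of the equation of state satisfy `n_{;h} = n / c²`, a consequence of `∂p/∂h|_s = n H`,
and the Maxwell relation `EquationOfState.dds_n`, which is the symmetry of the second derivatives of
the pressure; together with `θ = q H` they leave only independent quantities. After these
substitutions each equation is an identity between rational functions, which `field_simp` and `ring`
confirm.

The transport equations for `𝒟` and `𝒞` contain one derivative more. For `𝒟` the additional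
information is the entropy equation differentiated twice (`Fluid.IsSolution.pd_pd_entropy`). For
`𝒞` it is the differentiated transport equation of `ϖ` (`Fluid.IsSolution.pd_transport_w`); that
equation may be differentiated because covariance gives it at every point of the domain, whatever
the four-velocity there. The regularity suffices in both cases: only third derivatives of `s` and
second derivatives of `ϖ` occur.

The null structure is independent of the equations. Each derivative-quadratic term is either a
contraction with the inverse acoustical metric or a contraction of `∂φ ⊗ ∂ψ` with antisymmetric
coefficients, and the latter are null forms (`nullAnti_mem`, `antisymm_mem`).
-/

noncomputable section

namespace RelEuler

/-! ### Null forms and expressions of bounded degree in the derivatives -/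

theorem eta_of_ne {α β : Fin 4} (h : α ≠ β) : eta α β = 0 := Matrix.diagonal_apply_ne _ h

theorem lower_eq (V : Fin 4 → ℝ) (α : Fin 4) : lower V α = eta α α * V α := by
  unfold lower
  rw [Finset.sum_eq_single α (fun β _ hβ => by rw [eta_of_ne hβ.symm, zero_mul]) (by simp)]

theorem epsUp_swap_first_third (α β γ δ : Fin 4) : epsUp γ β α δ = -epsUp α β γ δ := by
  have h : epsInt γ β α δ = -epsInt α β γ δ := by
    rw [(epsInt_swap β γ α δ).1, (epsInt_swap β α γ δ).2.1, (epsInt_swap α β γ δ).1, neg_neg]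
  simp only [epsUp, h]
  push_cast
  ring

theorem epsUp_swap_last (α β γ δ : Fin 4) : epsUp α β δ γ = -epsUp α β γ δ := by
  simp only [epsUp, (epsInt_swap α β γ δ).2.2]
  push_cast
  ring

theorem sum_rotate {ι κ τ : Type*} [Fintype ι] [Fintype κ] [Fintype τ] (F : ι → κ → τ → ℝ) :
    ∑ i, ∑ j, ∑ k, F i j k = ∑ k, ∑ i, ∑ j, F i j k := by
  rw [Finset.sum_comm]
  simp only [Finset.sum_comm (s := (Finset.univ : Finset τ))]
  rw [Finset.sum_comm]

section Membership

variable {N : Submodule (State → ℝ) Expr}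

theorem expr_add {F G : Expr} (hF : F ∈ N) (hG : G ∈ N) : (fun v p => F v p + G v p) ∈ N :=
  N.add_mem hF hG

theorem expr_sub {F G : Expr} (hF : F ∈ N) (hG : G ∈ N) : (fun v p => F v p - G v p) ∈ N :=
  N.sub_mem hF hG

theorem expr_neg {F : Expr} (hF : F ∈ N) : (fun v p => -F v p) ∈ N := N.neg_mem hF

theorem expr_coeff_mul {a : State → ℝ} {F : Expr} (hF : F ∈ N) : (fun v p => a v * F v p) ∈ N :=
  N.smul_mem a hF

theorem expr_mul_coeff {a : State → ℝ} {F : Expr} (hF : F ∈ N) : (fun v p => F v p * a v) ∈ N := by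
  simpa only [mul_comm] using expr_coeff_mul (a := a) hF

theorem expr_sum {ι : Type*} [Fintype ι] {F : ι → Expr} (hF : ∀ i, F i ∈ N) :
    (fun v p => ∑ i, F i v p) ∈ N := by
  have h : (fun v p => ∑ i, F i v p) = ∑ i, F i := by
    funext v p
    simp only [Finset.sum_apply]
  rw [h]
  exact N.sum_mem fun i _ => hF i

theorem expr_zero : (fun _ _ => 0 : Expr) ∈ N := N.zero_mem

end Membership

theorem d_mem_linearForms (φ : FluidVar) (μ : Fin 4) :
    (fun _ p => p.d φ μ : Expr) ∈ linearForms := Submodule.subset_span ⟨φ, μ, rfl⟩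

theorem linearForms_le : linearForms ≤ atMostLinear := Submodule.span_mono Set.subset_union_right

theorem coeff_mem_atMostLinear (a : State → ℝ) : (fun v _ => a v : Expr) ∈ atMostLinear := by
  have h : (1 : Expr) ∈ atMostLinear := Submodule.subset_span (Or.inl rfl)
  simpa only [Pi.one_apply, mul_one] using expr_coeff_mul (a := a) h

theorem d_mem_atMostLinear (φ : FluidVar) (μ : Fin 4) :
    (fun _ p => p.d φ μ : Expr) ∈ atMostLinear := linearForms_le (d_mem_linearForms φ μ)

theorem atMostLinear_le : atMostLinear ≤ atMostQuadratic :=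
  Submodule.span_mono Set.subset_union_left

theorem d_mul_d_mem_atMostQuadratic (φ ψ : FluidVar) (μ ν : Fin 4) :
    (fun _ p => p.d φ μ * p.d ψ ν : Expr) ∈ atMostQuadratic :=
  Submodule.subset_span (Or.inr ⟨φ, ψ, μ, ν, rfl⟩)

theorem mul_mem_atMostQuadratic {F G : Expr} (hF : F ∈ atMostLinear) (hG : G ∈ atMostLinear) :
    (fun v p => F v p * G v p) ∈ atMostQuadratic := by
  unfold atMostLinear at hF
  induction hF using Submodule.span_induction with
  | mem F h =>
    rcases h with rfl | ⟨φ, μ, rfl⟩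
    · simpa only [Pi.one_apply, one_mul] using atMostLinear_le hG
    · unfold atMostLinear at hG
      induction hG using Submodule.span_induction with
      | mem G h =>
        rcases h with rfl | ⟨ψ, ν, rfl⟩
        · simpa only [Pi.one_apply, mul_one, dExpr] using atMostLinear_le (d_mem_atMostLinear φ μ)
        · exact d_mul_d_mem_atMostQuadratic φ ψ μ ν
      | zero => simpa only [Pi.zero_apply, mul_zero] using expr_zero
      | add G G' _ _ h h' => simpa only [Pi.add_apply, mul_add] using expr_add h h'
      | smul a G _ h =>
        have h' := expr_coeff_mul (a := a) h
        simpa only [Pi.smul_apply', Pi.smul_apply, smul_eq_mul, mul_left_comm] using h'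
  | zero => simpa only [Pi.zero_apply, zero_mul] using expr_zero
  | add F F' _ _ h h' => simpa only [Pi.add_apply, add_mul] using expr_add h h'
  | smul a F _ h =>
    have h' := expr_coeff_mul (a := a) h
    simpa only [Pi.smul_apply', Pi.smul_apply, smul_eq_mul, mul_assoc] using h'

theorem nullG_mem (e : EquationOfState) (φ ψ : FluidVar) :
    (fun v p => gDot e v (p.d φ) (p.d ψ) : Expr) ∈ nullForms e :=
  Submodule.subset_span (Or.inl ⟨φ, ψ, rfl⟩)

/-- The standard antisymmetric null forms without the restriction `μ < ν`. -/
theorem nullAnti_mem (e : EquationOfState) (μ ν : Fin 4) (φ ψ : FluidVar) :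
    (fun _ p => p.d φ μ * p.d ψ ν - p.d φ ν * p.d ψ μ : Expr) ∈ nullForms e := by
  rcases lt_trichotomy μ ν with h | rfl | h
  · exact Submodule.subset_span (Or.inr ⟨φ, ψ, μ, ν, h, rfl⟩)
  · simpa only [sub_self] using expr_zero
  · have h' : nullAnti ν μ φ ψ ∈ nullForms e :=
      Submodule.subset_span (Or.inr ⟨φ, ψ, ν, μ, h, rfl⟩)
    simpa only [nullAnti, neg_sub] using expr_neg h'

/-- A contraction of `∂φ ⊗ ∂ψ` with an antisymmetric coefficient matrix is a null form. -/
theorem antisymm_mem (e : EquationOfState) (k : Fin 4 → Fin 4 → State → ℝ)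
    (hk : ∀ μ ν v, k ν μ v = -k μ ν v) (φ ψ : FluidVar) :
    (fun v p => ∑ μ, ∑ ν, k μ ν v * (p.d φ μ * p.d ψ ν) : Expr) ∈ nullForms e := by
  have h : (fun v p => ∑ μ, ∑ ν, (1 / 2 * k μ ν v) *
      (p.d φ μ * p.d ψ ν - p.d φ ν * p.d ψ μ) : Expr) ∈ nullForms e :=
    expr_sum fun μ => expr_sum fun ν =>
      expr_coeff_mul (a := fun v => 1 / 2 * k μ ν v) (nullAnti_mem e μ ν φ ψ)
  convert h using 3 with v p
  have h1 : ∑ μ, ∑ ν, k μ ν v * (p.d φ ν * p.d ψ μ) =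
      -∑ μ, ∑ ν, k μ ν v * (p.d φ μ * p.d ψ ν) := by
    rw [Finset.sum_comm]
    simp only [← Finset.sum_neg_distrib]
    refine Finset.sum_congr rfl fun μ _ => Finset.sum_congr rfl fun ν _ => ?_
    rw [hk μ ν v]
    ring
  have h2 : ∀ μ ν, (1 / 2 * k μ ν v) * (p.d φ μ * p.d ψ ν - p.d φ ν * p.d ψ μ) =
      1 / 2 * (k μ ν v * (p.d φ μ * p.d ψ ν)) - 1 / 2 * (k μ ν v * (p.d φ ν * p.d ψ μ)) :=
    fun μ ν => by ring
  simp only [h2, Finset.sum_sub_distrib, ← Finset.mul_sum, h1]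
  ring

theorem nullForms_le (e : EquationOfState) : nullForms e ≤ atMostQuadratic := by
  refine Submodule.span_le.2 ?_
  rintro F (⟨φ, ψ, rfl⟩ | ⟨φ, ψ, μ, ν, -, rfl⟩)
  · have h : (fun v p => ∑ α, ∑ β, acousticalMetricInv (e.c v.h v.s) v.u α β *
        (p.d φ α * p.d ψ β) : Expr) ∈ atMostQuadratic :=
      expr_sum fun α => expr_sum fun β =>
        expr_coeff_mul (a := fun v => acousticalMetricInv (e.c v.h v.s) v.u α β)
          (d_mul_d_mem_atMostQuadratic φ ψ α β)
    simp only [← mul_assoc] at h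
    exact h
  · exact expr_sub (d_mul_d_mem_atMostQuadratic φ ψ μ ν) (d_mul_d_mem_atMostQuadratic φ ψ ν μ)

section Expressions

variable (e : EquationOfState)

theorem Qh_mem : Qh e ∈ nullForms e := by
  refine expr_add (expr_neg (expr_coeff_mul (nullG_mem e .h .h)))
    (expr_coeff_mul (expr_sum fun κ => expr_sum fun l => ?_))
  exact nullAnti_mem e κ l (.u κ) (.u l)

theorem Qu_mem (α : Fin 4) : Qu e α ∈ nullForms e := by
  refine expr_sub (expr_add (expr_sum fun l => expr_coeff_mul (expr_sum fun κ => ?_))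
    (expr_coeff_mul (expr_sum fun κ => expr_sum fun l => ?_)))
    (expr_coeff_mul (nullG_mem e .h (.u α)))
  · exact nullAnti_mem e κ l (.u κ) .h
  · simpa only [Grad.d, mul_comm] using nullAnti_mem e κ l (.u l) (.u κ)

theorem QD_mem : QD e ∈ nullForms e := by
  refine expr_coeff_mul (a := fun v => 1 / e.n v.h v.s * (e.c v.h v.s ^ 2)⁻¹)
    (expr_sum fun κ => expr_coeff_mul (a := fun v => v.S κ) (expr_sum fun l => ?_))
  simpa only [Grad.d, neg_sub, mul_comm] using nullAnti_mem e κ l (.u l) .h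

theorem QDS_mem : QDS e ∈ nullForms e := by
  refine expr_add
    (expr_coeff_mul (a := fun v => 2 / e.n v.h v.s) (expr_sum fun κ => expr_sum fun l => ?_))
    (expr_coeff_mul (a := fun v => 1 / e.n v.h v.s * (e.c v.h v.s ^ 2)⁻¹)
      (expr_sum fun κ => expr_coeff_mul (a := fun v => v.u κ) (expr_sum fun l => ?_)))
  · exact nullAnti_mem e κ l (.S κ) (.u l)
  · exact nullAnti_mem e κ l .h (.S l)

theorem QCS_mem (α : Fin 4) : QCS e α ∈ nullForms e := by
  refine expr_add (expr_neg (expr_coeff_mul (a := fun _ => 2) ?_))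
    (expr_coeff_mul (a := fun v => ddh e.θ v.h v.s - e.θ v.h v.s)
      (expr_sum fun κ => expr_coeff_mul (a := fun v => eta α κ + 2 * v.u α * v.u κ)
        (expr_sum fun l => nullAnti_mem e κ l .h (.S l))))
  have h : (fun v p => ∑ β, ∑ κ, ∑ γ, ∑ δ, (epsUp α β γ δ * lower v.u β * eta κ κ) *
      (p.d (.w κ) γ * p.d (.u κ) δ) : Expr) ∈ nullForms e :=
    expr_sum fun β => expr_sum fun κ =>
      antisymm_mem e (fun γ δ v => epsUp α β γ δ * lower v.u β * eta κ κ)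
        (fun γ δ v => by simp only [epsUp_swap_last α β γ δ]; ring) (.w κ) (.u κ)
  convert h using 3 with v p
  refine Finset.sum_congr rfl fun β _ => ?_
  simp only [Finset.mul_sum, lower_eq, Grad.d]
  refine Eq.trans ?_ (sum_rotate _)
  refine Finset.sum_congr rfl fun γ _ => Finset.sum_congr rfl fun δ _ =>
    Finset.sum_congr rfl fun κ _ => ?_
  ring

theorem QC_mem (α : Fin 4) : QC e α ∈ nullForms e := by
  -- the first two terms are null by the antisymmetry of `ε` in the slots of the two derivatives;
  -- the others contain the bracket of a standard null form
  have h1 : (fun v p => (e.c v.h v.s ^ 2)⁻¹ * ∑ κ, ∑ β, ∑ γ, ∑ δ,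
      epsUp κ β γ δ * p.u κ α * lower v.u β * p.h γ * lower v.w δ : Expr) ∈ nullForms e := by
    refine expr_coeff_mul ?_
    have h : (fun v p => ∑ β, ∑ δ, ∑ κ, ∑ γ, (epsUp κ β γ δ * lower v.u β * lower v.w δ) *
        (p.d (.u α) κ * p.d .h γ) : Expr) ∈ nullForms e :=
      expr_sum fun β => expr_sum fun δ =>
        antisymm_mem e (fun κ γ v => epsUp κ β γ δ * lower v.u β * lower v.w δ)
          (fun κ γ v => by simp only [epsUp_swap_first_third κ β γ δ]; ring) (.u α) .h
    convert h using 3 with v p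
    rw [Finset.sum_comm]
    refine Finset.sum_congr rfl fun β _ => ?_
    refine Eq.trans ?_ (sum_rotate _)
    refine Finset.sum_congr rfl fun κ _ => Finset.sum_congr rfl fun γ _ =>
      Finset.sum_congr rfl fun δ _ => ?_
    simp only [Grad.d]
    ring
  have h2 : (fun v p => ((e.c v.h v.s ^ 2)⁻¹ + 2) * (∑ β, ∑ γ, ∑ δ,
      epsUp α β γ δ * lower v.u β * p.h γ * ∑ κ, v.w κ * lower (p.u δ) κ) : Expr)
      ∈ nullForms e := by
    refine expr_coeff_mul (a := fun v => (e.c v.h v.s ^ 2)⁻¹ + 2) ?_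
    have h : (fun v p => ∑ β, ∑ κ, ∑ γ, ∑ δ,
        (epsUp α β γ δ * lower v.u β * eta κ κ * v.w κ) *
        (p.d .h γ * p.d (.u κ) δ) : Expr) ∈ nullForms e :=
      expr_sum fun β => expr_sum fun κ =>
        antisymm_mem e (fun γ δ v => epsUp α β γ δ * lower v.u β * eta κ κ * v.w κ)
          (fun γ δ v => by simp only [epsUp_swap_last α β γ δ]; ring) .h (.u κ)
    convert h using 3 with v p
    refine Finset.sum_congr rfl fun β _ => ?_
    simp only [Finset.mul_sum, lower_eq, Grad.d]
    refine Eq.trans ?_ (sum_rotate _)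
    refine Finset.sum_congr rfl fun γ _ => Finset.sum_congr rfl fun δ _ =>
      Finset.sum_congr rfl fun κ _ => ?_
    ring
  refine expr_add (expr_add (expr_add (expr_add (expr_add (expr_add (expr_add (expr_add
    (expr_neg h1) h2) ?_) ?_) ?_) ?_) ?_) ?_) ?_
  · refine expr_coeff_mul (expr_sum fun β => expr_sum fun γ => expr_sum fun δ => expr_coeff_mul
      (a := fun v => epsUp α β γ δ * lower v.u β * lower v.w δ) (expr_sum fun κ => ?_))
    exact nullAnti_mem e κ γ (.u κ) .h
  · refine expr_coeff_mul (a := fun v => (ddh (ddh e.θ) v.h v.s - ddh e.θ v.h v.s) +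
        (e.c v.h v.s ^ 2)⁻¹ * (e.θ v.h v.s - ddh e.θ v.h v.s))
      (expr_sum fun κ => expr_sum fun l => expr_sum fun β => expr_coeff_mul
        (a := fun v => v.u κ * eta α l * v.S β) ?_)
    have h := expr_coeff_mul (a := fun _ => eta β β) (nullAnti_mem e κ l .h (.u β))
    convert h using 3 with v p
    simp only [lower_eq, Grad.d]
    ring
  · refine expr_coeff_mul (a := fun v => ddh e.θ v.h v.s - e.θ v.h v.s)
      (expr_sum fun κ => expr_sum fun l => expr_coeff_mul (a := fun v => v.S κ * v.u l) ?_)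
    exact nullAnti_mem e κ l (.u α) .h
  · refine expr_coeff_mul (a := fun v => ddh e.θ v.h v.s - e.θ v.h v.s)
      (expr_sum fun κ => expr_coeff_mul (a := fun v => 2 * eta α κ + v.u α * v.u κ)
      (expr_sum fun β => expr_coeff_mul (a := fun v => v.S β) (expr_sum fun l => ?_)))
    have h := expr_coeff_mul (a := fun _ => eta β β) (nullAnti_mem e κ l (.u β) (.u l))
    convert h using 3 with v p
    simp only [lower_eq, Grad.d]
    ring
  · refine expr_coeff_mul (a := fun v => (ddh e.θ v.h v.s - e.θ v.h v.s) * v.S α)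
      (expr_sum fun κ => expr_sum fun l => ?_)
    simpa only [Grad.d, mul_comm] using nullAnti_mem e κ l (.u l) (.u κ)
  · refine expr_coeff_mul (a := fun v => ddh e.θ v.h v.s - e.θ v.h v.s)
      (expr_sum fun κ => expr_coeff_mul (a := fun v => v.S κ) (expr_sum fun l => ?_))
    exact nullAnti_mem e κ l (.u α) (.u l)
  · exact expr_coeff_mul (a := fun v => v.S α * ((e.c v.h v.s ^ 2)⁻¹ * (ddh e.θ v.h v.s -
      ddh (ddh e.θ) v.h v.s) + (e.c v.h v.s ^ 4)⁻¹ * (ddh e.θ v.h v.s - e.θ v.h v.s)))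
      (nullG_mem e .h .h)

theorem modC_mem (α : Fin 4) : modC e α ∈ atMostLinear := by
  refine expr_add (expr_add (expr_add (expr_add ?_ ?_) ?_) ?_) ?_
  · refine expr_neg (expr_sum fun β => expr_sum fun γ => expr_sum fun δ => ?_)
    simp only [lower_eq]
    exact expr_coeff_mul (a := fun v => epsUp α β γ δ * (eta β β * v.u β))
      (expr_coeff_mul (a := fun _ => eta δ δ) (d_mem_atMostLinear (.w δ) γ))
  · exact expr_coeff_mul (a := fun v => (e.c v.h v.s ^ 2)⁻¹) (expr_sum fun β => expr_sum fun γ =>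
      expr_sum fun δ => expr_mul_coeff (a := fun v => lower v.w δ)
      (expr_coeff_mul (a := fun v => epsUp α β γ δ * lower v.u β) (d_mem_atMostLinear .h γ)))
  · exact expr_coeff_mul (a := fun v => (e.θ v.h v.s - ddh e.θ v.h v.s) * v.S α)
      (expr_sum fun κ => d_mem_atMostLinear (.u κ) κ)
  · exact expr_coeff_mul (a := fun v => (e.θ v.h v.s - ddh e.θ v.h v.s) * v.u α)
      (expr_sum fun κ => expr_coeff_mul (a := fun v => v.S κ) (d_mem_atMostLinear .h κ))
  · simp only [lower_eq]
    exact expr_coeff_mul (a := fun v => ddh e.θ v.h v.s - e.θ v.h v.s)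
      (expr_sum fun κ => expr_coeff_mul (a := fun v => v.S κ) (expr_sum fun l => expr_coeff_mul
        (a := fun _ => eta α l) (expr_coeff_mul (a := fun _ => eta κ κ)
          (d_mem_atMostLinear (.u κ) l))))

theorem modD_mem : modD e ∈ atMostLinear := by
  refine expr_sub (expr_add ?_ ?_) ?_
  · exact expr_coeff_mul (a := fun v => 1 / e.n v.h v.s)
      (expr_sum fun κ => d_mem_atMostLinear (.S κ) κ)
  · exact expr_coeff_mul (a := fun v => 1 / e.n v.h v.s)
      (expr_sum fun κ => expr_coeff_mul (a := fun v => v.S κ) (d_mem_atMostLinear .h κ))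
  · exact expr_coeff_mul (a := fun v => 1 / e.n v.h v.s * (e.c v.h v.s ^ 2)⁻¹)
      (expr_sum fun κ => expr_coeff_mul (a := fun v => v.S κ) (d_mem_atMostLinear .h κ))

theorem Lh_mem : Lh e ∈ atMostLinear := by
  unfold Lh
  simp only [lower_eq]
  repeat' first
    | (refine expr_sum (ι := Fin 4) fun _ => ?_)
    | exact coeff_mem_atMostLinear _
    | exact d_mem_atMostLinear .h _
    | exact d_mem_atMostLinear (.u _) _
    | apply expr_add
    | apply expr_sub
    | apply expr_neg
    | apply expr_coeff_mul

theorem Ls_mem : Ls e ∈ atMostLinear := by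
  unfold Ls
  simp only [lower_eq]
  repeat' first
    | (refine expr_sum (ι := Fin 4) fun _ => ?_)
    | exact coeff_mem_atMostLinear _
    | exact d_mem_atMostLinear .h _
    | exact d_mem_atMostLinear (.u _) _
    | apply expr_add
    | apply expr_sub
    | apply expr_neg
    | apply expr_coeff_mul

theorem Lu_mem (α : Fin 4) : Lu e α ∈ atMostLinear := by
  unfold Lu
  simp only [lower_eq]
  repeat' first
    | (refine expr_sum (ι := Fin 4) fun _ => ?_)
    | exact coeff_mem_atMostLinear _
    | exact d_mem_atMostLinear .h _
    | exact d_mem_atMostLinear (.u _) _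
    | apply expr_add
    | apply expr_sub
    | apply expr_neg
    | apply expr_coeff_mul
    | apply expr_mul_coeff

theorem LC_mem (α : Fin 4) : LC e α ∈ atMostLinear := by
  unfold LC
  simp only [lower_eq]
  repeat' first
    | (refine expr_sum (ι := Fin 4) fun _ => ?_)
    | exact coeff_mem_atMostLinear _
    | exact d_mem_atMostLinear .h _
    | exact d_mem_atMostLinear (.u _) _
    | apply expr_add
    | apply expr_sub
    | apply expr_neg
    | apply expr_coeff_mul
    | apply expr_mul_coeff

theorem LD_mem : LD e ∈ linearForms := by
  unfold LD
  simp only [lower_eq]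
  repeat' first
    | (refine expr_sum (ι := Fin 4) fun _ => ?_)
    | exact d_mem_linearForms .h _
    | exact d_mem_linearForms (.u _) _
    | apply expr_add
    | apply expr_sub
    | apply expr_neg
    | apply expr_coeff_mul
    | apply expr_mul_coeff

/-- A right-hand side of the asserted form is at most quadratic in the derivatives after the
insertion of `𝒞` and `𝒟`, since these are at most linear. -/
theorem hasNullStructure_of {F : RHS} (A : Fin 4 → Expr) (B Q L : Expr)
    (hA : ∀ κ, A κ ∈ atMostLinear) (hB : B ∈ atMostLinear) (hQ : Q ∈ nullForms e)
    (hL : L ∈ atMostLinear)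
    (h : ∀ v p C D, F v p C D = (∑ κ, A κ v p * C κ) + B v p * D + Q v p + L v p) :
    HasNullStructure e F := by
  refine ⟨?_, A, B, Q, L, hA, hB, hQ, hL, h⟩
  simp only [h]
  exact expr_add (expr_add (expr_add
    (expr_sum fun κ => mul_mem_atMostQuadratic (hA κ) (modC_mem e κ))
    (mul_mem_atMostQuadratic hB (modD_mem e))) (nullForms_le e hQ)) (atMostLinear_le hL)

theorem hasNullStructure_rhsWaveH : HasNullStructure e (rhsWaveH e) :=
  hasNullStructure_of e (fun _ _ _ => 0) (fun v _ => e.n v.h v.s * e.c v.h v.s ^ 2 * e.q v.h v.s)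
    (Qh e) (Lh e) (fun _ => expr_zero) (coeff_mem_atMostLinear _) (Qh_mem e) (Lh_mem e)
    fun v p C D => by simp [rhsWaveH]

theorem hasNullStructure_rhsWaveS : HasNullStructure e (rhsWaveS e) :=
  hasNullStructure_of e (fun _ _ _ => 0) (fun v _ => e.c v.h v.s ^ 2 * e.n v.h v.s)
    (fun _ _ => 0) (Ls e) (fun _ => expr_zero) (coeff_mem_atMostLinear _) expr_zero (Ls_mem e)
    fun v p C D => by simp [rhsWaveS]

theorem hasNullStructure_rhsWaveU (α : Fin 4) : HasNullStructure e (rhsWaveU e α) :=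
  hasNullStructure_of e (fun κ v _ => if κ = α then -(e.c v.h v.s ^ 2 / e.H v.h) else 0)
    (fun _ _ => 0) (Qu e α) (Lu e α) (fun _ => coeff_mem_atMostLinear _) expr_zero
    (Qu_mem e α) (Lu_mem e α) fun v p C D => by simp [rhsWaveU]

theorem hasNullStructure_of_mem {F : RHS} (L : Expr) (hL : L ∈ atMostLinear)
    (h : ∀ v p C D, F v p C D = L v p) : HasNullStructure e F :=
  hasNullStructure_of e (fun _ _ _ => 0) (fun _ _ => 0) (fun _ _ => 0) L (fun _ => expr_zero)
    expr_zero expr_zero hL fun v p C D => by simp [h]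

theorem hasNullStructure_rhsTransportS (α : Fin 4) : HasNullStructure e (rhsTransportS α) := by
  refine hasNullStructure_of_mem e (fun v p => rhsTransportS α v p 0 0) ?_ fun _ _ _ _ => rfl
  unfold rhsTransportS
  repeat' first
    | (refine expr_sum (ι := Fin 4) fun _ => ?_)
    | exact coeff_mem_atMostLinear _
    | exact d_mem_atMostLinear .h _
    | exact d_mem_atMostLinear (.u _) _
    | exact d_mem_atMostLinear (.S _) _
    | apply expr_add
    | apply expr_sub
    | apply expr_neg
    | apply expr_coeff_mul

theorem hasNullStructure_rhsTransportW (α : Fin 4) : HasNullStructure e (rhsTransportW e α) := by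
  refine hasNullStructure_of_mem e (fun v p => rhsTransportW e α v p 0 0) ?_ fun _ _ _ _ => rfl
  unfold rhsTransportW
  repeat' first
    | (refine expr_sum (ι := Fin 4) fun _ => ?_)
    | exact coeff_mem_atMostLinear _
    | exact d_mem_atMostLinear .h _
    | exact d_mem_atMostLinear (.u _) _
    | exact d_mem_atMostLinear (.S _) _
    | apply expr_add
    | apply expr_sub
    | apply expr_neg
    | apply expr_coeff_mul
    | apply expr_mul_coeff

theorem hasNullStructure_rhsDivW : HasNullStructure e (rhsDivW e) := by
  refine hasNullStructure_of_mem e (fun v p => rhsDivW e v p 0 0) ?_ fun _ _ _ _ => rfl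
  unfold rhsDivW
  repeat' first
    | (refine expr_sum (ι := Fin 4) fun _ => ?_)
    | exact coeff_mem_atMostLinear _
    | exact d_mem_atMostLinear .h _
    | exact d_mem_atMostLinear (.u _) _
    | exact d_mem_atMostLinear (.S _) _
    | apply expr_add
    | apply expr_sub
    | apply expr_neg
    | apply expr_coeff_mul

theorem hasNullStructure_rhsTransportD : HasNullStructure e (rhsTransportD e) :=
  hasNullStructure_of e (fun κ v _ => lower v.S κ / (e.n v.h v.s * e.H v.h)) (fun _ _ => 0)
    (fun v p => QDS e v p + QD e v p) (LD e) (fun _ => coeff_mem_atMostLinear _) expr_zero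
    (expr_add (QDS_mem e) (QD_mem e)) (Submodule.span_mono Set.subset_union_right (LD_mem e))
    fun v p C D => by
      simp only [rhsTransportD, Finset.sum_div, div_mul_eq_mul_div]
      ring

theorem hasNullStructure_rhsTransportC (α : Fin 4) : HasNullStructure e (rhsTransportC e α) := by
  refine hasNullStructure_of e
    (fun κ v p => p.u κ α - (if κ = α then 2 else 0) * (∑ κ, p.u κ κ)
      + v.u α * ∑ l, v.u l * lower (p.u l) κ)
    (fun v p => (e.θ v.h v.s - ddh e.θ v.h v.s) * e.n v.h v.s * v.u α * ∑ κ, v.u κ * p.h κ)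
    (fun v p => QCS e α v p + QC e α v p)
    (fun v p => (e.θ v.h v.s - ddh e.θ v.h v.s) * e.q v.h v.s * v.S α * (∑ κ, p.S κ κ)
      + (ddh e.θ v.h v.s - e.θ v.h v.s) * e.q v.h v.s *
        (∑ κ, lower v.S κ * ∑ l, eta α l * p.S l κ) + LC e α v p)
    (fun κ => ?_) ?_ (expr_add (QCS_mem e α) (QC_mem e α)) (expr_add ?_ (LC_mem e α))
    fun v p C D => ?_
  · simp only [lower_eq]
    repeat' first
    | (refine expr_sum (ι := Fin 4) fun _ => ?_)
    | exact coeff_mem_atMostLinear _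
    | exact d_mem_atMostLinear .h _
    | exact d_mem_atMostLinear (.u _) _
    | exact d_mem_atMostLinear (.S _) _
    | apply expr_add
    | apply expr_sub
    | apply expr_neg
    | apply expr_coeff_mul
  · repeat' first
    | (refine expr_sum (ι := Fin 4) fun _ => ?_)
    | exact coeff_mem_atMostLinear _
    | exact d_mem_atMostLinear .h _
    | exact d_mem_atMostLinear (.u _) _
    | exact d_mem_atMostLinear (.S _) _
    | apply expr_add
    | apply expr_sub
    | apply expr_neg
    | apply expr_coeff_mul
  · simp only [lower_eq]
    repeat' first
    | (refine expr_sum (ι := Fin 4) fun _ => ?_)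
    | exact coeff_mem_atMostLinear _
    | exact d_mem_atMostLinear .h _
    | exact d_mem_atMostLinear (.u _) _
    | exact d_mem_atMostLinear (.S _) _
    | apply expr_add
    | apply expr_sub
    | apply expr_neg
    | apply expr_coeff_mul
  -- the coefficient of `𝒞^κ` is `∂_κ u^α - 2 δ_κ^α ∂_l u^l + u^α u^l ∂_l u_κ`
  · have h : ∑ κ, (p.u κ α - (if κ = α then 2 else 0) * (∑ κ, p.u κ κ)
        + v.u α * ∑ l, v.u l * lower (p.u l) κ) * C κ =
        (∑ κ, C κ * p.u κ α) - 2 * C α * (∑ κ, p.u κ κ)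
          + v.u α * (∑ κ, C κ * ∑ l, v.u l * lower (p.u l) κ) := by
      simp only [add_mul, sub_mul, Finset.sum_add_distrib, Finset.sum_sub_distrib, ite_mul,
        zero_mul, Finset.sum_ite_eq', Finset.mem_univ, if_true]
      congr 2
      · exact Finset.sum_congr rfl fun κ _ => mul_comm _ _
      · ring
      · rw [Finset.mul_sum]
        exact Finset.sum_congr rfl fun κ _ => by ring
    rw [h]
    simp only [rhsTransportC]
    ring

end Expressions

/-! ### Calculus of coordinate derivatives -/

section Directional

variable {E : Type*} [NormedAddCommGroup E] [NormedSpace ℝ E] {f : E → ℝ} {x : E}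

theorem fderiv_fderiv_comm (hf : ContDiffAt ℝ 2 f x) (v w : E) :
    fderiv ℝ (fun y => fderiv ℝ f y v) x w = fderiv ℝ (fun y => fderiv ℝ f y w) x v := by
  have hd : DifferentiableAt ℝ (fderiv ℝ f) x :=
    (hf.fderiv_right (m := 1) (by norm_num)).differentiableAt (by norm_num)
  have hs := hf.isSymmSndFDerivAt (by simp)
  have key : ∀ v, fderiv ℝ (fun y => fderiv ℝ f y v) x = (fderiv ℝ (fderiv ℝ f) x).flip v := by
    intro v
    rw [fderiv_clm_apply hd (differentiableAt_const v)]
    simp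
  rw [key, key]
  exact hs.eq w v

theorem contDiffAt_fderiv_apply {m n : WithTop ℕ∞} (hf : ContDiffAt ℝ n f x) (hmn : m + 1 ≤ n)
    (v : E) : ContDiffAt ℝ m (fun y => fderiv ℝ f y v) x :=
  (hf.fderiv_right hmn).clm_apply contDiffAt_const

end Directional

section Pd

variable {f g : Spacetime → ℝ} {x : Spacetime}

theorem pd_congr (h : f =ᶠ[nhds x] g) (μ : Fin 4) : pd μ f x = pd μ g x := by
  unfold pd
  rw [h.fderiv_eq]

theorem pd_const (μ : Fin 4) (a : ℝ) : pd μ (fun _ => a) x = 0 := by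
  simp [pd]

theorem pd_add (hf : DifferentiableAt ℝ f x) (hg : DifferentiableAt ℝ g x) (μ : Fin 4) :
    pd μ (fun y => f y + g y) x = pd μ f x + pd μ g x := by
  unfold pd
  rw [fderiv_fun_add hf hg]
  rfl

theorem pd_sub (hf : DifferentiableAt ℝ f x) (hg : DifferentiableAt ℝ g x) (μ : Fin 4) :
    pd μ (fun y => f y - g y) x = pd μ f x - pd μ g x := by
  unfold pd
  rw [fderiv_fun_sub hf hg]
  rfl

theorem pd_neg (μ : Fin 4) : pd μ (fun y => -f y) x = -pd μ f x := by
  unfold pd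
  rw [fderiv_fun_neg]
  rfl

theorem pd_mul (hf : DifferentiableAt ℝ f x) (hg : DifferentiableAt ℝ g x) (μ : Fin 4) :
    pd μ (fun y => f y * g y) x = pd μ f x * g x + f x * pd μ g x := by
  unfold pd
  rw [fderiv_fun_mul hf hg]
  simp only [add_apply, smul_apply, smul_eq_mul]
  ring

theorem pd_const_mul (a : ℝ) (hf : DifferentiableAt ℝ f x) (μ : Fin 4) :
    pd μ (fun y => a * f y) x = a * pd μ f x := by
  rw [pd_mul (differentiableAt_const a) hf, pd_const]
  ring

theorem pd_sum {ι : Type*} [Fintype ι] {F : ι → Spacetime → ℝ}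
    (hF : ∀ i, DifferentiableAt ℝ (F i) x) (μ : Fin 4) :
    pd μ (fun y => ∑ i, F i y) x = ∑ i, pd μ (F i) x := by
  unfold pd
  rw [fderiv_fun_sum fun i _ => hF i]
  simp

theorem pd_inv (hf : DifferentiableAt ℝ f x) (h0 : f x ≠ 0) (μ : Fin 4) :
    pd μ (fun y => (f y)⁻¹) x = -((f x)⁻¹ ^ 2 * pd μ f x) := by
  have h1 : HasFDerivAt (fun y => (f y)⁻¹) (-((f x) ^ 2)⁻¹ • fderiv ℝ f x) x :=
    (hasDerivAt_inv h0).comp_hasFDerivAt x hf.hasFDerivAt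
  unfold pd
  rw [h1.fderiv]
  simp

theorem pd_pow (hf : DifferentiableAt ℝ f x) (n : ℕ) (μ : Fin 4) :
    pd μ (fun y => f y ^ n) x = n * f x ^ (n - 1) * pd μ f x := by
  have h1 : HasFDerivAt (fun y => f y ^ n) ((n * f x ^ (n - 1)) • fderiv ℝ f x) x :=
    (hasDerivAt_pow n (f x)).comp_hasFDerivAt x hf.hasFDerivAt
  unfold pd
  rw [h1.fderiv]
  simp

theorem pd_comm (hf : ContDiffAt ℝ 2 f x) (μ ν : Fin 4) : pd μ (pd ν f) x = pd ν (pd μ f) x :=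
  fderiv_fderiv_comm hf _ _

theorem contDiffAt_pd {m n : WithTop ℕ∞} (hf : ContDiffAt ℝ n f x) (hmn : m + 1 ≤ n) (μ : Fin 4) :
    ContDiffAt ℝ m (pd μ f) x := contDiffAt_fderiv_apply hf hmn _

end Pd

/-! ### Functions of `(h, s)` -/

section Partial

variable {G : ℝ → ℝ → ℝ} {h s : ℝ}

theorem hasDerivAt_left (hG : DifferentiableAt ℝ (fun z : ℝ × ℝ => G z.1 z.2) (h, s)) :
    HasDerivAt (fun h' => G h' s) (fderiv ℝ (fun z : ℝ × ℝ => G z.1 z.2) (h, s) (1, 0)) h :=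
  HasFDerivAt.comp_hasDerivAt h (f := fun h' => (h', s)) hG.hasFDerivAt
    ((hasDerivAt_id h).prodMk (hasDerivAt_const h s))

theorem hasDerivAt_right (hG : DifferentiableAt ℝ (fun z : ℝ × ℝ => G z.1 z.2) (h, s)) :
    HasDerivAt (fun s' => G h s') (fderiv ℝ (fun z : ℝ × ℝ => G z.1 z.2) (h, s) (0, 1)) s :=
  HasFDerivAt.comp_hasDerivAt s (f := fun s' => (h, s')) hG.hasFDerivAt
    ((hasDerivAt_const s h).prodMk (hasDerivAt_id s))

theorem ddh_eq (hG : DifferentiableAt ℝ (fun z : ℝ × ℝ => G z.1 z.2) (h, s)) :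
    ddh G h s = fderiv ℝ (fun z : ℝ × ℝ => G z.1 z.2) (h, s) (1, 0) := (hasDerivAt_left hG).deriv

theorem dds_eq (hG : DifferentiableAt ℝ (fun z : ℝ × ℝ => G z.1 z.2) (h, s)) :
    dds G h s = fderiv ℝ (fun z : ℝ × ℝ => G z.1 z.2) (h, s) (0, 1) := (hasDerivAt_right hG).deriv

theorem hasDerivAt_ddh (hG : DifferentiableAt ℝ (fun z : ℝ × ℝ => G z.1 z.2) (h, s)) :
    HasDerivAt (fun h' => G h' s) (ddh G h s) h := ddh_eq hG ▸ hasDerivAt_left hG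

theorem hasDerivAt_dds (hG : DifferentiableAt ℝ (fun z : ℝ × ℝ => G z.1 z.2) (h, s)) :
    HasDerivAt (fun s' => G h s') (dds G h s) s := dds_eq hG ▸ hasDerivAt_right hG

theorem eventually_contDiffAt {E : Type*} [NormedAddCommGroup E] [NormedSpace ℝ E] {F : E → ℝ}
    {z : E} (hF : ContDiffAt ℝ ∞ F z) : ∀ᶠ y in nhds z, DifferentiableAt ℝ F y := by
  have h1 : ContDiffAt ℝ 1 F z := hF.of_le (by simp)
  exact (h1.eventually (by simp)).mono fun y hy => hy.differentiableAt (by norm_num)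

theorem contDiffAt_ddh (hG : ContDiffAt ℝ ∞ (fun z : ℝ × ℝ => G z.1 z.2) (h, s)) :
    ContDiffAt ℝ ∞ (fun z : ℝ × ℝ => ddh G z.1 z.2) (h, s) :=
  (contDiffAt_fderiv_apply (m := ∞) hG (by simp) (1, 0)).congr_of_eventuallyEq
    ((eventually_contDiffAt hG).mono fun _ hz => ddh_eq hz)

theorem contDiffAt_dds (hG : ContDiffAt ℝ ∞ (fun z : ℝ × ℝ => G z.1 z.2) (h, s)) :
    ContDiffAt ℝ ∞ (fun z : ℝ × ℝ => dds G z.1 z.2) (h, s) :=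
  (contDiffAt_fderiv_apply (m := ∞) hG (by simp) (0, 1)).congr_of_eventuallyEq
    ((eventually_contDiffAt hG).mono fun _ hz => dds_eq hz)

theorem differentiableAt_of_smooth {E : Type*} [NormedAddCommGroup E] [NormedSpace ℝ E]
    {F : E → ℝ} {z : E} (hF : ContDiffAt ℝ ∞ F z) : DifferentiableAt ℝ F z :=
  hF.differentiableAt (by simp)

theorem dds_ddh_comm (hG : ContDiffAt ℝ ∞ (fun z : ℝ × ℝ => G z.1 z.2) (h, s)) :
    dds (ddh G) h s = ddh (dds G) h s := by
  rw [dds_eq (differentiableAt_of_smooth (contDiffAt_ddh hG)),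
    ddh_eq (differentiableAt_of_smooth (contDiffAt_dds hG))]
  have h1 : (fun z : ℝ × ℝ => ddh G z.1 z.2) =ᶠ[nhds (h, s)]
      fun z => fderiv ℝ (fun z : ℝ × ℝ => G z.1 z.2) z (1, 0) :=
    (eventually_contDiffAt hG).mono fun _ hz => ddh_eq hz
  have h2 : (fun z : ℝ × ℝ => dds G z.1 z.2) =ᶠ[nhds (h, s)]
      fun z => fderiv ℝ (fun z : ℝ × ℝ => G z.1 z.2) z (0, 1) :=
    (eventually_contDiffAt hG).mono fun _ hz => dds_eq hz
  rw [h1.fderiv_eq, h2.fderiv_eq]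
  exact fderiv_fderiv_comm (hG.of_le (WithTop.coe_le_coe.2 le_top)) _ _

theorem ddh_congr {F : ℝ → ℝ → ℝ}
    (hFG : (fun z : ℝ × ℝ => F z.1 z.2) =ᶠ[nhds (h, s)] fun z => G z.1 z.2) :
    ddh F h s = ddh G h s := by
  have hc : Filter.Tendsto (fun h' : ℝ => (h', s)) (nhds h) (nhds (h, s)) := by
    exact (Continuous.prodMk_left s).tendsto h
  exact Filter.EventuallyEq.deriv_eq (hc.eventually hFG)

theorem dds_congr {F : ℝ → ℝ → ℝ}
    (hFG : (fun z : ℝ × ℝ => F z.1 z.2) =ᶠ[nhds (h, s)] fun z => G z.1 z.2) :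
    dds F h s = dds G h s := by
  have hc : Filter.Tendsto (fun s' : ℝ => (h, s')) (nhds s) (nhds (h, s)) := by
    exact (Continuous.prodMk_right h).tendsto s
  exact Filter.EventuallyEq.deriv_eq (hc.eventually hFG)

/-- The chain rule for a function of `(h, s)` along scalar fields. -/
theorem pd_comp {a b : Spacetime → ℝ} {x : Spacetime}
    (hG : DifferentiableAt ℝ (fun z : ℝ × ℝ => G z.1 z.2) (a x, b x))
    (ha : DifferentiableAt ℝ a x) (hb : DifferentiableAt ℝ b x) (μ : Fin 4) :
    pd μ (fun y => G (a y) (b y)) x =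
      ddh G (a x) (b x) * pd μ a x + dds G (a x) (b x) * pd μ b x := by
  have h1 : HasFDerivAt (fun y => G (a y) (b y))
      ((fderiv ℝ (fun z : ℝ × ℝ => G z.1 z.2) (a x, b x)).comp
        ((fderiv ℝ a x).prod (fderiv ℝ b x))) x :=
    HasFDerivAt.comp x (f := fun y => (a y, b y)) hG.hasFDerivAt
      (ha.hasFDerivAt.prodMk hb.hasFDerivAt)
  unfold pd
  rw [h1.fderiv, ddh_eq hG, dds_eq hG]
  simp only [ContinuousLinearMap.comp_apply, ContinuousLinearMap.prod_apply]
  generalize fderiv ℝ a x (Pi.single μ 1) = r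
  generalize fderiv ℝ b x (Pi.single μ 1) = t
  have h2 : ((r, t) : ℝ × ℝ) = r • (1, 0) + t • (0, 1) := by simp
  rw [h2, map_add, map_smul, map_smul, smul_eq_mul, smul_eq_mul]
  ring

theorem contDiffAt_comp {a b : Spacetime → ℝ} {x : Spacetime} {n : WithTop ℕ∞}
    (hG : ContDiffAt ℝ n (fun z : ℝ × ℝ => G z.1 z.2) (a x, b x))
    (ha : ContDiffAt ℝ n a x) (hb : ContDiffAt ℝ n b x) :
    ContDiffAt ℝ n (fun y => G (a y) (b y)) x :=
  ContDiffAt.comp x (f := fun y => (a y, b y)) hG (ha.prodMk hb)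

end Partial

/-! ### Thermodynamic identities -/

namespace EquationOfState

variable (e : EquationOfState) {h s : ℝ}

theorem H_pos (h : ℝ) : 0 < e.H h := mul_pos e.Hbar_pos (Real.exp_pos h)

theorem contDiff_H : ContDiff ℝ ∞ e.H := contDiff_const.mul Real.contDiff_exp

theorem hasDerivAt_H (h : ℝ) : HasDerivAt e.H (e.H h) h := (Real.hasDerivAt_exp h).const_mul e.Hbar

theorem contDiffAt_H (h s : ℝ) : ContDiffAt ℝ ∞ (fun z : ℝ × ℝ => e.H z.1) (h, s) :=
  (e.contDiff_H.comp contDiff_fst).contDiffAt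

theorem n_pos (hz : (h, s) ∈ e.dom) : 0 < e.n h s := e.number_pos h s hz

theorem eventually_dom (hz : (h, s) ∈ e.dom) : ∀ᶠ z in nhds (h, s), (z.1, z.2) ∈ e.dom :=
  e.isOpen_dom.mem_nhds hz

theorem contDiffAt_n (hz : (h, s) ∈ e.dom) :
    ContDiffAt ℝ ∞ (fun z : ℝ × ℝ => e.n z.1 z.2) (h, s) :=
  e.contDiffOn_number.contDiffAt (e.isOpen_dom.mem_nhds hz)

theorem contDiffAt_number_snd (hz : (h, s) ∈ e.dom) :
    ContDiffAt ℝ ∞ (fun z : ℝ × ℝ => (e.n z.1 z.2, z.2)) (h, s) :=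
  (e.contDiffAt_n hz).prodMk contDiffAt_snd

theorem deriv_energy_right (hz : (h, s) ∈ e.dom) :
    deriv (fun s' => e.energy (e.n h s) s') s =
      fderiv ℝ (fun z : ℝ × ℝ => e.energy z.1 z.2) (e.n h s, s) (0, 1) :=
  (hasDerivAt_right (differentiableAt_of_smooth (e.contDiffAt_energy h s hz))).deriv

theorem contDiffAt_θ (hz : (h, s) ∈ e.dom) :
    ContDiffAt ℝ ∞ (fun z : ℝ × ℝ => e.θ z.1 z.2) (h, s) := by
  have h1 : ContDiffAt ℝ ∞ (fun z : ℝ × ℝ =>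
      fderiv ℝ (fun z : ℝ × ℝ => e.energy z.1 z.2) (e.n z.1 z.2, z.2) (0, 1)) (h, s) :=
    ContDiffAt.comp (h, s) (f := fun z : ℝ × ℝ => (e.n z.1 z.2, z.2))
      (contDiffAt_fderiv_apply (m := ∞) (e.contDiffAt_energy h s hz) (by simp) (0, 1))
      (e.contDiffAt_number_snd hz)
  refine (h1.div (e.contDiffAt_n hz) (e.n_pos hz).ne').congr_of_eventuallyEq ?_
  filter_upwards [e.eventually_dom hz] with z hz
  exact congrArg (· / e.n z.1 z.2) (e.deriv_energy_right hz)

theorem contDiffAt_q (hz : (h, s) ∈ e.dom) :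
    ContDiffAt ℝ ∞ (fun z : ℝ × ℝ => e.q z.1 z.2) (h, s) :=
  (e.contDiffAt_θ hz).div (e.contDiffAt_H h s) (e.H_pos h).ne'

/-- The energy density as a function of `(h, s)`. -/
def energyHS (h s : ℝ) : ℝ := e.energy (e.n h s) s

/-- The pressure as a function of `(h, s)`, expressed through `ρ + p = n H`. -/
def pressureHS (h s : ℝ) : ℝ := e.n h s * e.H h - e.energyHS h s

theorem contDiffAt_energyHS (hz : (h, s) ∈ e.dom) :
    ContDiffAt ℝ ∞ (fun z : ℝ × ℝ => e.energyHS z.1 z.2) (h, s) :=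
  ContDiffAt.comp (h, s) (f := fun z : ℝ × ℝ => (e.n z.1 z.2, z.2))
    (e.contDiffAt_energy h s hz) (e.contDiffAt_number_snd hz)

theorem contDiffAt_pressureHS (hz : (h, s) ∈ e.dom) :
    ContDiffAt ℝ ∞ (fun z : ℝ × ℝ => e.pressureHS z.1 z.2) (h, s) :=
  ((e.contDiffAt_n hz).mul (e.contDiffAt_H h s)).sub (e.contDiffAt_energyHS hz)

theorem pressure_eq (hz : (h, s) ∈ e.dom) :
    e.pressure (e.energyHS h s) s = e.pressureHS h s := by
  have h1 := e.enthalpy_eq h s hz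
  have h2 := (e.n_pos hz).ne'
  rw [eq_div_iff (show e.number h s ≠ 0 from h2)] at h1
  simp only [pressureHS, energyHS, H, n]
  linarith

theorem fderiv_energy (hz : (h, s) ∈ e.dom) (a b : ℝ) :
    fderiv ℝ (fun z : ℝ × ℝ => e.energy z.1 z.2) (e.n h s, s) (a, b) =
      a * e.H h + b * (e.n h s * e.θ h s) := by
  have hd := differentiableAt_of_smooth (e.contDiffAt_energy h s hz)
  have h1 : fderiv ℝ (fun z : ℝ × ℝ => e.energy z.1 z.2) (e.n h s, s) (1, 0) = e.H h := by
    rw [← e.deriv_energy h s hz |>.trans (show _ = e.H h from rfl)]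
    exact (hasDerivAt_left hd).deriv.symm
  have h2 : fderiv ℝ (fun z : ℝ × ℝ => e.energy z.1 z.2) (e.n h s, s) (0, 1) =
      e.n h s * e.θ h s := by
    rw [← e.deriv_energy_right hz]
    exact (mul_div_cancel₀ _ (e.n_pos hz).ne').symm
  have h3 : ((a, b) : ℝ × ℝ) = a • (1, 0) + b • (0, 1) := by simp
  rw [h3, map_add, map_smul, map_smul, h1, h2, smul_eq_mul, smul_eq_mul]

theorem hasDerivAt_n_left (hz : (h, s) ∈ e.dom) :
    HasDerivAt (fun h' => e.n h' s) (ddh e.n h s) h :=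
  hasDerivAt_ddh (differentiableAt_of_smooth (e.contDiffAt_n hz))

theorem hasDerivAt_n_right (hz : (h, s) ∈ e.dom) :
    HasDerivAt (fun s' => e.n h s') (dds e.n h s) s :=
  hasDerivAt_dds (differentiableAt_of_smooth (e.contDiffAt_n hz))

theorem hasDerivAt_energyHS_left (hz : (h, s) ∈ e.dom) :
    HasDerivAt (fun h' => e.energyHS h' s) (ddh e.n h s * e.H h) h := by
  have h1 := HasFDerivAt.comp_hasDerivAt h (f := fun h' => (e.n h' s, s))
    (differentiableAt_of_smooth (e.contDiffAt_energy h s hz)).hasFDerivAt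
    ((e.hasDerivAt_n_left hz).prodMk (hasDerivAt_const h s))
  have h2 := e.fderiv_energy hz (ddh e.n h s) 0
  rw [zero_mul, add_zero] at h2
  rw [← h2]
  exact h1

theorem hasDerivAt_energyHS_right (hz : (h, s) ∈ e.dom) :
    HasDerivAt (fun s' => e.energyHS h s') (dds e.n h s * e.H h + e.n h s * e.θ h s) s := by
  have h1 := HasFDerivAt.comp_hasDerivAt s (f := fun s' => (e.n h s', s'))
    (differentiableAt_of_smooth (e.contDiffAt_energy h s hz)).hasFDerivAt
    ((e.hasDerivAt_n_right hz).prodMk (hasDerivAt_id s))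
  have h2 := e.fderiv_energy hz (dds e.n h s) 1
  rw [one_mul] at h2
  rw [← h2]
  exact h1

/-- `∂p/∂h|_s = n H`. -/
theorem ddh_pressureHS (hz : (h, s) ∈ e.dom) : ddh e.pressureHS h s = e.n h s * e.H h := by
  have h1 := ((e.hasDerivAt_n_left hz).mul (e.hasDerivAt_H h)).sub (e.hasDerivAt_energyHS_left hz)
  refine h1.deriv.trans ?_
  ring

/-- `∂p/∂s|_h = -n θ`: in `p = n H - ρ` the contributions of `n_{;s}` cancel. -/
theorem dds_pressureHS (hz : (h, s) ∈ e.dom) : dds e.pressureHS h s = -(e.n h s * e.θ h s) := by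
  have h1 := ((e.hasDerivAt_n_right hz).mul_const (e.H h)).sub (e.hasDerivAt_energyHS_right hz)
  refine h1.deriv.trans ?_
  ring

theorem c_pos (hz : (h, s) ∈ e.dom) : 0 < e.c h s := Real.sqrt_pos.2 (e.deriv_pressure_pos h s hz)

theorem c_sq (hz : (h, s) ∈ e.dom) :
    e.c h s ^ 2 = deriv (fun ρ => e.pressure ρ s) (e.energyHS h s) :=
  Real.sq_sqrt (e.deriv_pressure_pos h s hz).le

/-- From `∂p/∂h|_s = n H`: the chain rule for `p(ρ(h, s), s)` and `∂ρ/∂h|_s = H n_{;h}` give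
`∂p/∂h|_s = c² H n_{;h}` as well. -/
theorem c_sq_mul_ddh_n (hz : (h, s) ∈ e.dom) : e.c h s ^ 2 * ddh e.n h s = e.n h s := by
  have hp : HasDerivAt (fun ρ => e.pressure ρ s) (e.c h s ^ 2) (e.energyHS h s) := by
    rw [e.c_sq hz]
    -- a function with nonzero derivative is differentiable
    exact (differentiableAt_of_deriv_ne_zero (e.deriv_pressure_pos h s hz).ne').hasDerivAt
  have h1 : HasDerivAt (fun h' => e.pressure (e.energyHS h' s) s)
      (e.c h s ^ 2 * (ddh e.n h s * e.H h)) h :=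
    HasDerivAt.comp (h := fun h' => e.energyHS h' s) h hp (e.hasDerivAt_energyHS_left hz)
  have h2 : (fun h' => e.pressure (e.energyHS h' s) s) =ᶠ[nhds h] fun h' => e.pressureHS h' s := by
    have hc : Filter.Tendsto (fun h' : ℝ => (h', s)) (nhds h) (nhds (h, s)) :=
      (Continuous.prodMk_left s).tendsto h
    exact (hc.eventually (e.eventually_dom hz)).mono fun h' hz' => e.pressure_eq hz'
  have h3 := h2.deriv_eq
  rw [h1.deriv, show deriv (fun h' => e.pressureHS h' s) h = _ from e.ddh_pressureHS hz] at h3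
  have h4 := (e.H_pos h).ne'
  exact mul_right_cancel₀ h4 (by linarith)

theorem ddh_n_pos (hz : (h, s) ∈ e.dom) : 0 < ddh e.n h s := by
  have h1 := e.c_sq_mul_ddh_n hz
  have h2 := e.n_pos hz
  have h3 := pow_pos (e.c_pos hz) 2
  rw [← h1] at h2
  exact pos_of_mul_pos_right h2 h3.le

/-- The speed of sound in terms of `n(h, s)`. No smoothness of the pressure in `ρ` is assumed, so
that the smoothness of `c` comes from this formula. -/
theorem c_eq (hz : (h, s) ∈ e.dom) : e.c h s = Real.sqrt (e.n h s / ddh e.n h s) := by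
  rw [← e.c_sq_mul_ddh_n hz, mul_div_cancel_right₀ _ (e.ddh_n_pos hz).ne',
    Real.sqrt_sq (e.c_pos hz).le]

theorem contDiffAt_c (hz : (h, s) ∈ e.dom) :
    ContDiffAt ℝ ∞ (fun z : ℝ × ℝ => e.c z.1 z.2) (h, s) := by
  have h1 := ((e.contDiffAt_n hz).div (contDiffAt_ddh (e.contDiffAt_n hz))
    (e.ddh_n_pos hz).ne').sqrt (div_pos (e.n_pos hz) (e.ddh_n_pos hz)).ne'
  refine h1.congr_of_eventuallyEq ?_
  filter_upwards [e.eventually_dom hz] with z hz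
  exact e.c_eq hz

theorem ddh_n (hz : (h, s) ∈ e.dom) : ddh e.n h s = e.n h s * (e.c h s ^ 2)⁻¹ := by
  rw [eq_mul_inv_iff_mul_eq₀ (pow_pos (e.c_pos hz) 2).ne', mul_comm, e.c_sq_mul_ddh_n hz]

theorem hasDerivAt_θ_left (hz : (h, s) ∈ e.dom) :
    HasDerivAt (fun h' => e.θ h' s) (ddh e.θ h s) h :=
  hasDerivAt_ddh (differentiableAt_of_smooth (e.contDiffAt_θ hz))

theorem ddh_q (hz : (h, s) ∈ e.dom) : ddh e.q h s = (ddh e.θ h s - e.θ h s) / e.H h := by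
  have h1 := (e.hasDerivAt_θ_left hz).div (e.hasDerivAt_H h) (e.H_pos h).ne'
  refine h1.deriv.trans ?_
  have := (e.H_pos h).ne'
  field_simp

theorem dds_q (hz : (h, s) ∈ e.dom) : dds e.q h s = dds e.θ h s / e.H h :=
  ((hasDerivAt_dds (differentiableAt_of_smooth (e.contDiffAt_θ hz))).div_const (e.H h)).deriv

/-- The Maxwell relation, from the symmetry of the second derivatives of the pressure. -/
theorem dds_n (hz : (h, s) ∈ e.dom) :
    dds e.n h s = -(e.n h s * (e.θ h s * (e.c h s ^ 2)⁻¹ + ddh e.θ h s) * (e.H h)⁻¹) := by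
  have h1 := dds_ddh_comm (e.contDiffAt_pressureHS hz)
  have h2 : dds (ddh e.pressureHS) h s = dds e.n h s * e.H h := by
    rw [dds_congr (G := fun h s => e.n h s * e.H h)
      ((e.eventually_dom hz).mono fun z hz => e.ddh_pressureHS hz)]
    exact ((e.hasDerivAt_n_right hz).mul_const (e.H h)).deriv
  have h3 : ddh (dds e.pressureHS) h s =
      -(ddh e.n h s * e.θ h s + e.n h s * ddh e.θ h s) := by
    rw [ddh_congr (G := fun h s => -(e.n h s * e.θ h s))
      ((e.eventually_dom hz).mono fun z hz => e.dds_pressureHS hz)]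
    exact ((e.hasDerivAt_n_left hz).mul (e.hasDerivAt_θ_left hz)).neg.deriv
  rw [h2, h3, e.ddh_n hz] at h1
  rw [← div_eq_mul_inv, ← neg_div, eq_div_iff (e.H_pos h).ne', h1]
  ring

end EquationOfState

/-! ### Regularity of the derived quantities -/

theorem contDiffAt_lower {V : Spacetime → Fin 4 → ℝ} {x : Spacetime} {n : WithTop ℕ∞}
    (hV : ∀ α, ContDiffAt ℝ n (fun y => V y α) x) (α : Fin 4) :
    ContDiffAt ℝ n (fun y => lower (V y) α) x := by
  simp only [lower_eq]
  exact contDiffAt_const.mul (hV α)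

theorem contDiffAt_vort {u V : Spacetime → Fin 4 → ℝ} {x : Spacetime} {m n : WithTop ℕ∞}
    (hu : ∀ α, ContDiffAt ℝ m (fun y => u y α) x) (hV : ∀ α, ContDiffAt ℝ n (fun y => V y α) x)
    (hmn : m + 1 ≤ n) (α : Fin 4) : ContDiffAt ℝ m (fun y => vort u V y α) x :=
  (ContDiffAt.sum fun β _ => ContDiffAt.sum fun γ _ => ContDiffAt.sum fun δ _ =>
    (contDiffAt_const.mul (contDiffAt_lower hu β)).mul (contDiffAt_pd (hV δ) hmn γ)).neg

namespace Fluid.IsSolution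

variable {f : Fluid} {e : EquationOfState} {Ω : Set Spacetime} (hf : f.IsSolution e Ω)
  {x : Spacetime} (hx : x ∈ Ω)

include hf hx

theorem mem_nhds : Ω ∈ nhds x := hf.isOpen.mem_nhds hx

theorem eventually_mem : ∀ᶠ y in nhds x, y ∈ Ω := hf.mem_nhds hx

theorem contDiffAt_h : ContDiffAt ℝ 3 f.h x := hf.contDiffOn_h.contDiffAt (hf.mem_nhds hx)

theorem contDiffAt_s : ContDiffAt ℝ 3 f.s x := hf.contDiffOn_s.contDiffAt (hf.mem_nhds hx)

theorem contDiffAt_u (α : Fin 4) : ContDiffAt ℝ 3 (fun y => f.u y α) x :=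
  contDiffAt_pi.1 (hf.contDiffOn_u.contDiffAt (hf.mem_nhds hx)) α

theorem contDiffAt_eos {G : ℝ → ℝ → ℝ}
    (hG : ContDiffAt ℝ ∞ (fun z : ℝ × ℝ => G z.1 z.2) (f.h x, f.s x)) :
    ContDiffAt ℝ 3 (fun y => G (f.h y) (f.s y)) x :=
  contDiffAt_comp (hG.of_le (WithTop.coe_le_coe.2 le_top)) (hf.contDiffAt_h hx)
    (hf.contDiffAt_s hx)

theorem contDiffAt_H : ContDiffAt ℝ 3 (fun y => e.H (f.h y)) x :=
  hf.contDiffAt_eos hx (G := fun h _ => e.H h) (e.contDiffAt_H _ _)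

theorem contDiffAt_n : ContDiffAt ℝ 3 (fun y => e.n (f.h y) (f.s y)) x :=
  hf.contDiffAt_eos hx (e.contDiffAt_n (hf.mem_dom x hx))

theorem contDiffAt_θ : ContDiffAt ℝ 3 (fun y => e.θ (f.h y) (f.s y)) x :=
  hf.contDiffAt_eos hx (e.contDiffAt_θ (hf.mem_dom x hx))

theorem contDiffAt_ddh_θ : ContDiffAt ℝ 3 (fun y => ddh e.θ (f.h y) (f.s y)) x :=
  hf.contDiffAt_eos hx (contDiffAt_ddh (e.contDiffAt_θ (hf.mem_dom x hx)))

theorem contDiffAt_c : ContDiffAt ℝ 3 (fun y => e.c (f.h y) (f.s y)) x :=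
  hf.contDiffAt_eos hx (e.contDiffAt_c (hf.mem_dom x hx))

theorem c_ne_zero : e.c (f.h x) (f.s x) ≠ 0 := (e.c_pos (hf.mem_dom x hx)).ne'

theorem contDiffAt_inv_c_sq : ContDiffAt ℝ 3 (fun y => (e.c (f.h y) (f.s y) ^ 2)⁻¹) x :=
  ((hf.contDiffAt_c hx).pow 2).inv (pow_ne_zero 2 (hf.c_ne_zero hx))

theorem contDiffAt_S (α : Fin 4) : ContDiffAt ℝ 2 (fun y => f.S y α) x :=
  contDiffAt_lower (V := f.SForm) (fun β => contDiffAt_pd (hf.contDiffAt_s hx) (by norm_num) β) α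

theorem contDiffAt_w (α : Fin 4) : ContDiffAt ℝ 2 (fun y => f.w e y α) x :=
  contDiffAt_vort (n := 3) (fun α => (hf.contDiffAt_u hx α).of_le (by norm_num))
    (fun α => (hf.contDiffAt_H hx).mul (contDiffAt_lower (hf.contDiffAt_u hx) α)) (by norm_num) α

theorem contDiffAt_C (α : Fin 4) : ContDiffAt ℝ 1 (fun y => f.C e y α) x := by
  have hu : ∀ α, ContDiffAt ℝ 1 (fun y => f.u y α) x := fun α =>
    (hf.contDiffAt_u hx α).of_le (by norm_num)
  have hS : ∀ α, ContDiffAt ℝ 1 (fun y => f.S y α) x := fun α =>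
    (hf.contDiffAt_S hx α).of_le (by norm_num)
  have hw : ∀ α, ContDiffAt ℝ 1 (fun y => f.w e y α) x := fun α =>
    (hf.contDiffAt_w hx α).of_le (by norm_num)
  have hθ : ContDiffAt ℝ 1 (fun y => e.θ (f.h y) (f.s y)) x :=
    (hf.contDiffAt_θ hx).of_le (by norm_num)
  have hθ' : ContDiffAt ℝ 1 (fun y => ddh e.θ (f.h y) (f.s y)) x :=
    (hf.contDiffAt_ddh_θ hx).of_le (by norm_num)
  have hdh : ∀ κ, ContDiffAt ℝ 1 (fun y => pd κ f.h y) x := fun κ =>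
    contDiffAt_pd (hf.contDiffAt_h hx) (by norm_num) κ
  have hdu : ∀ κ α, ContDiffAt ℝ 1 (fun y => pd κ (fun z => f.u z α) y) x := fun κ α =>
    contDiffAt_pd (hf.contDiffAt_u hx α) (by norm_num) κ
  have hdw : ∀ κ α, ContDiffAt ℝ 1 (fun y => pd κ (fun z => f.w e z α) y) x := fun κ α =>
    contDiffAt_pd (hf.contDiffAt_w hx α) (by norm_num) κ
  refine ((((ContDiffAt.neg ?_).add (ContDiffAt.mul ?_ ?_)).add (ContDiffAt.mul ?_ ?_)).add
    (ContDiffAt.mul ?_ ?_)).add (ContDiffAt.mul ?_ ?_)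
  · exact ContDiffAt.sum fun β _ => ContDiffAt.sum fun γ _ => ContDiffAt.sum fun δ _ =>
      (contDiffAt_const.mul (contDiffAt_lower hu β)).mul
        (contDiffAt_lower (V := fun y δ => pd γ (fun z => f.w e z δ) y) (hdw γ) δ)
  · exact (hf.contDiffAt_inv_c_sq hx).of_le (by norm_num)
  · exact ContDiffAt.sum fun β _ => ContDiffAt.sum fun γ _ => ContDiffAt.sum fun δ _ =>
      ((contDiffAt_const.mul (contDiffAt_lower hu β)).mul (hdh γ)).mul (contDiffAt_lower hw δ)
  · exact (hθ.sub hθ').mul (hS α)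
  · exact ContDiffAt.sum fun κ _ => hdu κ κ
  · exact (hθ.sub hθ').mul (hu α)
  · exact ContDiffAt.sum fun κ _ => (hS κ).mul (hdh κ)
  · exact hθ'.sub hθ
  · exact ContDiffAt.sum fun κ _ => (hS κ).mul (ContDiffAt.sum fun l _ =>
      contDiffAt_const.mul (contDiffAt_lower (V := fun y κ => pd l (fun z => f.u z κ) y) (hdu l) κ))

theorem contDiffAt_D : ContDiffAt ℝ 1 (f.D e) x := by
  have hn : ContDiffAt ℝ 1 (fun y => 1 / e.n (f.h y) (f.s y)) x :=
    contDiffAt_const.div ((hf.contDiffAt_n hx).of_le (by norm_num))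
      (e.n_pos (hf.mem_dom x hx)).ne'
  have hSh : ContDiffAt ℝ 1 (fun y => ∑ κ, f.S y κ * pd κ f.h y) x :=
    ContDiffAt.sum fun κ _ => ((hf.contDiffAt_S hx κ).of_le (by norm_num)).mul
      (contDiffAt_pd (hf.contDiffAt_h hx) (by norm_num) κ)
  have hS : ContDiffAt ℝ 1 (fun y => ∑ κ, pd κ (fun z => f.S z κ) y) x :=
    ContDiffAt.sum fun κ _ => contDiffAt_pd (hf.contDiffAt_S hx κ) (by norm_num) κ
  exact ((hn.mul hS).add (hn.mul hSh)).sub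
    ((hn.mul ((hf.contDiffAt_inv_c_sq hx).of_le (by norm_num))).mul hSh)

end Fluid.IsSolution

/-! ### The antisymmetric symbol in components -/

theorem eta_zero_zero : eta 0 0 = -1 := by simp [eta]
theorem eta_one_one : eta 1 1 = 1 := by simp [eta]
theorem eta_two_two : eta 2 2 = 1 := by simp [eta]
theorem eta_three_three : eta 3 3 = 1 := by simp [eta]

/-- A nonzero component has four distinct indices, exactly one of which is the time index. -/
theorem epsUp_eq (α β γ δ : Fin 4) :
    epsUp α β γ δ = -(epsInt α β γ δ : ℝ) := by
  have h : ∀ α β γ δ : Fin 4, epsInt α β γ δ = 0 ∨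
      ((if α = 0 then (-1 : ℤ) else 1) * (if β = 0 then -1 else 1) * (if γ = 0 then -1 else 1) *
        (if δ = 0 then -1 else 1)) = -1 := by decide
  have h2 : ∀ α, eta α α = ((if α = 0 then (-1 : ℤ) else 1 : ℤ) : ℝ) := by
    intro α
    fin_cases α <;> simp [eta]
  rcases h α β γ δ with h | h
  · simp [epsUp, h]
  · unfold epsUp
    simp only [h2]
    rw [← Int.cast_mul, ← Int.cast_mul, ← Int.cast_mul, h]
    simp

/-- The contraction of `ε^{αβγδ}` with a tensor in its last three slots, in components. -/
theorem sum_epsUp (F : Fin 4 → Fin 4 → Fin 4 → ℝ) (α : Fin 4) :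
    ∑ β, ∑ γ, ∑ δ, epsUp α β γ δ * F β γ δ =
      ![F 1 3 2 + F 2 1 3 + F 3 2 1 - F 1 2 3 - F 2 3 1 - F 3 1 2,
        F 0 2 3 + F 2 3 0 + F 3 0 2 - F 0 3 2 - F 2 0 3 - F 3 2 0,
        F 0 3 1 + F 1 0 3 + F 3 1 0 - F 0 1 3 - F 1 3 0 - F 3 0 1,
        F 0 1 2 + F 1 2 0 + F 2 0 1 - F 0 2 1 - F 1 0 2 - F 2 1 0] α := by
  simp only [epsUp_eq, epsInt, signDiff]
  fin_cases α <;> simp [Fin.sum_univ_four] <;> ring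

/-! ### Lorentz covariance: algebra -/

/-- A proper Lorentz matrix: it preserves the Minkowski metric and has determinant one. -/
structure IsLorentz (M : Matrix (Fin 4) (Fin 4) ℝ) : Prop where
  metric : M.transpose * eta * M = eta
  det : M.det = 1

/-- The vectors `A'`, `A` are the components of one vector in the coordinates `y` and
`x = x₀ + M y`. -/
def IsVec (M : Matrix (Fin 4) (Fin 4) ℝ) (A' A : Fin 4 → ℝ) : Prop :=
  ∀ α, A α = ∑ β, M α β * A' β

/-- The covectors `B'`, `B` are the components of one covector in the coordinates `y` and
`x = x₀ + M y`. -/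
def IsCov (M : Matrix (Fin 4) (Fin 4) ℝ) (B' B : Fin 4 → ℝ) : Prop :=
  ∀ κ, B' κ = ∑ l, M l κ * B l

/-- The analogue of `IsVec` for tensors with first index down and second index up. Equivalently,
every contraction of the first index with a vector is a vector. -/
def IsMix (M : Matrix (Fin 4) (Fin 4) ℝ) (T' T : Fin 4 → Fin 4 → ℝ) : Prop :=
  ∀ κ, IsVec M (T' κ) (fun α => ∑ l, M l κ * T l α)

/-- The analogue of `IsCov` for tensors with two indices down. -/
def IsCovTwo (M : Matrix (Fin 4) (Fin 4) ℝ) (T' T : Fin 4 → Fin 4 → ℝ) : Prop :=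
  ∀ κ, IsCov M (T' κ) (fun α => ∑ l, M l κ * T l α)

variable {M : Matrix (Fin 4) (Fin 4) ℝ}

section Linear

variable {A' A X' X B' B Y' Y : Fin 4 → ℝ} {T' T R' R : Fin 4 → Fin 4 → ℝ} {k' k : ℝ}

theorem IsVec.add (hA : IsVec M A' A) (hX : IsVec M X' X) :
    IsVec M (fun α => A' α + X' α) (fun α => A α + X α) := fun α => by
  simp only [hA α, hX α, mul_add, Finset.sum_add_distrib]

theorem IsVec.sub (hA : IsVec M A' A) (hX : IsVec M X' X) :
    IsVec M (fun α => A' α - X' α) (fun α => A α - X α) := fun α => by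
  simp only [hA α, hX α, mul_sub, Finset.sum_sub_distrib]

theorem IsVec.neg (hA : IsVec M A' A) : IsVec M (fun α => -A' α) (fun α => -A α) := fun α => by
  simp only [hA α, mul_neg, Finset.sum_neg_distrib]

theorem IsVec.smul (hk : k' = k) (hA : IsVec M A' A) :
    IsVec M (fun α => k' * A' α) (fun α => k * A α) := fun α => by
  simp only [hA α, hk, Finset.mul_sum, mul_left_comm]

theorem IsVec.smul_right (hA : IsVec M A' A) (hk : k' = k) :
    IsVec M (fun α => A' α * k') (fun α => A α * k) := by
  simpa only [mul_comm] using IsVec.smul hk hA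

theorem IsVec.sum {ι : Type*} [Fintype ι] {A' A : ι → Fin 4 → ℝ} (hA : ∀ i, IsVec M (A' i) (A i)) :
    IsVec M (fun α => ∑ i, A' i α) (fun α => ∑ i, A i α) := fun α => by
  simp only [hA _ α, Finset.mul_sum]
  rw [Finset.sum_comm]

theorem IsCov.sub (hB : IsCov M B' B) (hY : IsCov M Y' Y) :
    IsCov M (fun α => B' α - Y' α) (fun α => B α - Y α) := fun α => by
  simp only [hB α, hY α, mul_sub, Finset.sum_sub_distrib]

theorem IsCov.smul (hk : k' = k) (hB : IsCov M B' B) :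
    IsCov M (fun α => k' * B' α) (fun α => k * B α) := fun α => by
  simp only [hB α, hk, Finset.mul_sum, mul_left_comm]

theorem IsCov.smul_right (hB : IsCov M B' B) (hk : k' = k) :
    IsCov M (fun α => B' α * k') (fun α => B α * k) := by
  simpa only [mul_comm] using IsCov.smul hk hB

theorem IsVec.dot (hA : IsVec M A' A) (hB : IsCov M B' B) :
    ∑ κ, A' κ * B' κ = ∑ κ, A κ * B κ := by
  simp only [hA _, hB _, Finset.mul_sum, Finset.sum_mul]
  rw [Finset.sum_comm]
  exact Finset.sum_congr rfl fun _ _ => Finset.sum_congr rfl fun _ _ => by ring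

theorem IsCov.dot (hB : IsCov M B' B) (hA : IsVec M A' A) :
    ∑ κ, B' κ * A' κ = ∑ κ, B κ * A κ := by
  simpa only [mul_comm] using hA.dot hB

theorem IsMix.dot_left (hA : IsVec M A' A) (hT : IsMix M T' T) :
    IsVec M (fun α => ∑ κ, A' κ * T' κ α) (fun α => ∑ κ, A κ * T κ α) := by
  have h := IsVec.sum (A' := fun κ α => A' κ * T' κ α)
    (A := fun κ α => A' κ * ∑ l, M l κ * T l α) fun κ => (hT κ).smul rfl
  convert h using 2 with α
  simp only [hA _, Finset.mul_sum, Finset.sum_mul]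
  rw [Finset.sum_comm]
  exact Finset.sum_congr rfl fun _ _ => Finset.sum_congr rfl fun _ _ => by ring

theorem IsMix.dot_right (hT : IsMix M T' T) (hB : IsCov M B' B) :
    IsCov M (fun κ => ∑ α, T' κ α * B' α) (fun κ => ∑ α, T κ α * B α) := fun κ => by
  refine ((hT κ).dot hB).trans ?_
  simp only [Finset.mul_sum, Finset.sum_mul]
  rw [Finset.sum_comm]
  exact Finset.sum_congr rfl fun _ _ => Finset.sum_congr rfl fun _ _ => by ring

theorem IsCovTwo.dot_right (hT : IsCovTwo M T' T) (hA : IsVec M A' A) :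
    IsCov M (fun κ => ∑ α, T' κ α * A' α) (fun κ => ∑ α, T κ α * A α) := fun κ => by
  refine ((hT κ).dot hA).trans ?_
  simp only [Finset.mul_sum, Finset.sum_mul]
  rw [Finset.sum_comm]
  exact Finset.sum_congr rfl fun _ _ => Finset.sum_congr rfl fun _ _ => by ring

theorem IsCovTwo.dot_right' (hA : IsVec M A' A) (hT : IsCovTwo M T' T) :
    IsCov M (fun κ => ∑ α, A' α * T' κ α) (fun κ => ∑ α, A α * T κ α) := by
  simpa only [mul_comm] using hT.dot_right hA

theorem IsCovTwo.swap (hT : IsCovTwo M T' T) :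
    IsCovTwo M (fun κ l => T' l κ) (fun κ l => T l κ) := fun κ l => by
  have h := hT l κ
  simp only [Finset.mul_sum] at h ⊢
  rw [h, Finset.sum_comm]
  exact Finset.sum_congr rfl fun _ _ => Finset.sum_congr rfl fun _ _ => by ring

theorem IsCovTwo.dot_left (hA : IsVec M A' A) (hT : IsCovTwo M T' T) :
    IsCov M (fun κ => ∑ l, A' l * T' l κ) (fun κ => ∑ l, A l * T l κ) :=
  hT.swap.dot_right' hA

theorem IsMix.comp (hT : IsMix M T' T) (hR : IsMix M R' R) :
    IsMix M (fun κ α => ∑ l, T' κ l * R' l α) (fun κ α => ∑ l, T κ l * R l α) := fun κ => by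
  have h := IsMix.dot_left (hT κ) hR
  convert h using 2 with α
  simp only [Finset.mul_sum, Finset.sum_mul]
  rw [Finset.sum_comm]
  exact Finset.sum_congr rfl fun _ _ => Finset.sum_congr rfl fun _ _ => by ring

theorem IsMix.compCov (hT : IsMix M T' T) (hR : IsCovTwo M R' R) :
    IsCovTwo M (fun κ α => ∑ l, T' κ l * R' l α) (fun κ α => ∑ l, T κ l * R l α) := fun κ => by
  have h := IsCovTwo.dot_left (hT κ) hR
  convert h using 2 with α
  simp only [Finset.mul_sum, Finset.sum_mul]
  rw [Finset.sum_comm]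
  exact Finset.sum_congr rfl fun _ _ => Finset.sum_congr rfl fun _ _ => by ring

end Linear

namespace IsLorentz

variable (hM : IsLorentz M) {A' A B' B Y' Y Z' Z : Fin 4 → ℝ} {T' T R' R : Fin 4 → Fin 4 → ℝ}

include hM

theorem inv_mul : eta * M.transpose * eta * M = 1 := by
  rw [Matrix.mul_assoc, Matrix.mul_assoc, ← Matrix.mul_assoc M.transpose, hM.metric, eta_mul_eta]

theorem mul_inv : M * (eta * M.transpose * eta) = 1 := mul_eq_one_comm.1 hM.inv_mul

theorem metric_inv : M * eta * M.transpose = eta := by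
  have h := hM.mul_inv
  calc M * eta * M.transpose = M * (eta * M.transpose * eta) * eta := by
        simp only [Matrix.mul_assoc, eta_mul_eta, Matrix.mul_one]
    _ = eta := by rw [h, Matrix.one_mul]

theorem lower (hA : IsVec M A' A) : IsCov M (lower A') (lower A) := fun κ => by
  have h : Matrix.mulVec (M.transpose * eta * M) A' κ = Matrix.mulVec eta A' κ := by
    rw [hM.metric]
  have hA2 : A = Matrix.mulVec M A' := funext hA
  rw [← Matrix.mulVec_mulVec, ← Matrix.mulVec_mulVec, ← hA2] at h
  exact h.symm

theorem raise (hB : IsCov M B' B) : IsVec M (raise B') (raise B) := fun κ => by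
  have h : Matrix.mulVec (M * eta * M.transpose) B κ = Matrix.mulVec eta B κ := by
    rw [hM.metric_inv]
  have hB2 : B' = Matrix.mulVec M.transpose B := funext hB
  rw [← Matrix.mulVec_mulVec, ← Matrix.mulVec_mulVec, ← hB2] at h
  exact h.symm

theorem lowerMix (hT : IsMix M T' T) :
    IsCovTwo M (fun κ l => RelEuler.lower (T' κ) l) (fun κ l => RelEuler.lower (T κ) l) :=
  fun κ => by
    have h := hM.lower (hT κ)
    convert h using 2 with l
    simp only [lower_eq, Finset.mul_sum, mul_left_comm]

theorem trace (hT : IsMix M T' T) : ∑ κ, T' κ κ = ∑ κ, T κ κ := by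
  have h : Matrix.of T' * M.transpose = M.transpose * Matrix.of T := by
    ext κ α
    simp only [Matrix.mul_apply, Matrix.transpose_apply, Matrix.of_apply]
    refine Eq.trans ?_ (hT κ α).symm
    exact Finset.sum_congr rfl fun _ _ => mul_comm _ _
  have hu : M.transpose * (eta * M * eta) = 1 := by
    have h1 := congrArg Matrix.transpose hM.inv_mul
    have he : eta.transpose = eta := Matrix.diagonal_transpose _
    simpa only [Matrix.transpose_mul, Matrix.transpose_transpose, Matrix.transpose_one, he,
      Matrix.mul_assoc] using h1
  have h2 : (Matrix.of T').trace = (Matrix.of T).trace := by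
    calc (Matrix.of T').trace = (Matrix.of T' * (M.transpose * (eta * M * eta))).trace := by
          rw [hu, Matrix.mul_one]
      _ = (M.transpose * Matrix.of T * (eta * M * eta)).trace := by
          rw [← Matrix.mul_assoc, h]
      _ = (Matrix.of T).trace := by
          rw [Matrix.trace_mul_comm, ← Matrix.mul_assoc, mul_eq_one_comm.1 hu, Matrix.one_mul]
  exact h2

end IsLorentz

/-- The complete contraction of `ε^{αβγδ}` with four covectors is minus their determinant. -/
theorem sum_mul_sum_epsUp (a b c d : Fin 4 → ℝ) :
    ∑ α, a α * ∑ β, ∑ γ, ∑ δ, epsUp α β γ δ * b β * c γ * d δ =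
      -(Matrix.of ![a, b, c, d]).det := by
  have h : ∀ α, ∑ β, ∑ γ, ∑ δ, epsUp α β γ δ * b β * c γ * d δ =
      ∑ β, ∑ γ, ∑ δ, epsUp α β γ δ * (b β * c γ * d δ) := fun α => by
    simp only [mul_assoc]
  simp only [h, sum_epsUp]
  simp [Matrix.det_succ_row_zero, Fin.sum_univ_four, Fin.sum_univ_three, Fin.succAbove]
  ring

namespace IsLorentz

variable (hM : IsLorentz M) {A' A B' B Y' Y Z' Z : Fin 4 → ℝ} {T' T R' R : Fin 4 → Fin 4 → ℝ}
  {k' k : ℝ}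

include hM

/-- Covariance of the antisymmetric symbol, from the multiplicativity of the determinant and
`det M = 1`. -/
theorem eps (hB : IsCov M B' B) (hY : IsCov M Y' Y) (hZ : IsCov M Z' Z) :
    IsVec M (fun α => ∑ β, ∑ γ, ∑ δ, epsUp α β γ δ * B' β * Y' γ * Z' δ)
      (fun α => ∑ β, ∑ γ, ∑ δ, epsUp α β γ δ * B β * Y γ * Z δ) := fun α => by
  have h1 := sum_mul_sum_epsUp (M α) B' Y' Z'
  have h2 := sum_mul_sum_epsUp (Pi.single α 1) B Y Z
  have h3 : Matrix.of ![M α, B', Y', Z'] = Matrix.of ![Pi.single α 1, B, Y, Z] * M := by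
    ext i j
    fin_cases i
    · simp [Matrix.mul_apply, Pi.single_apply]
    · simpa [Matrix.mul_apply, mul_comm] using hB j
    · simpa [Matrix.mul_apply, mul_comm] using hY j
    · simpa [Matrix.mul_apply, mul_comm] using hZ j
  rw [h3, Matrix.det_mul, hM.det, mul_one, ← h2] at h1
  refine Eq.trans ?_ h1.symm
  simp [Pi.single_apply]

theorem epsRight (hB : IsCov M B' B) (hT : IsCovTwo M T' T) :
    IsVec M (fun α => ∑ β, ∑ γ, ∑ δ, epsUp α β γ δ * B' β * T' γ δ)
      (fun α => ∑ β, ∑ γ, ∑ δ, epsUp α β γ δ * B β * T γ δ) := by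
  -- expand the second slot in the coordinate covectors
  have h := IsVec.sum fun g : Fin 4 => hM.eps (Y' := M g) (Y := Pi.single g 1)
    (Z' := fun δ => ∑ l, M l δ * T g l) (Z := T g) hB (fun κ => by simp [Pi.single_apply])
    (fun κ => rfl)
  convert h using 2 with α α
  · have hT' : ∀ γ δ, T' γ δ = ∑ g, M g γ * ∑ l, M l δ * T g l := fun γ δ => by
      refine (hT γ δ).trans ?_
      simp only [Finset.mul_sum]
      rw [Finset.sum_comm]
      exact Finset.sum_congr rfl fun _ _ => Finset.sum_congr rfl fun _ _ => by ring
    refine Eq.trans ?_ Finset.sum_comm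
    refine Finset.sum_congr rfl fun β _ => ?_
    refine Eq.trans ?_ Finset.sum_comm
    refine Finset.sum_congr rfl fun γ _ => ?_
    refine Eq.trans ?_ Finset.sum_comm
    refine Finset.sum_congr rfl fun δ _ => ?_
    rw [hT', Finset.mul_sum]
    exact Finset.sum_congr rfl fun _ _ => by ring
  · refine Eq.trans ?_ Finset.sum_comm
    refine Finset.sum_congr rfl fun β _ => ?_
    refine Eq.trans ?_ Finset.sum_comm
    refine Finset.sum_congr rfl fun γ _ => ?_
    refine Eq.trans ?_ Finset.sum_comm
    refine Finset.sum_congr rfl fun δ _ => ?_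
    simp [Pi.single_apply]

theorem epsLeft (hT : IsCovTwo M T' T) (hB : IsCov M B' B) :
    IsVec M (fun α => ∑ β, ∑ γ, ∑ δ, epsUp α β γ δ * T' β γ * B' δ)
      (fun α => ∑ β, ∑ γ, ∑ δ, epsUp α β γ δ * T β γ * B δ) := by
  have h := hM.epsRight hB hT
  have key : ∀ (B : Fin 4 → ℝ) (T : Fin 4 → Fin 4 → ℝ) (α : Fin 4),
      ∑ β, ∑ γ, ∑ δ, epsUp α β γ δ * T β γ * B δ =
        ∑ β, ∑ γ, ∑ δ, epsUp α β γ δ * B β * T γ δ := fun B T α => by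
    simp only [mul_assoc]
    rw [sum_epsUp (fun β γ δ => T β γ * B δ), sum_epsUp (fun β γ δ => B β * T γ δ)]
    fin_cases α <;> simp <;> ring
  simpa only [key] using h

theorem epsFour (hA : IsCov M A' A) (hB : IsCov M B' B) (hY : IsCov M Y' Y) (hZ : IsCov M Z' Z) :
    ∑ α, ∑ β, ∑ γ, ∑ δ, epsUp α β γ δ * A' α * B' β * Y' γ * Z' δ =
      ∑ α, ∑ β, ∑ γ, ∑ δ, epsUp α β γ δ * A α * B β * Y γ * Z δ := by
  have h := hA.dot (hM.eps hB hY hZ)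
  simp only [Finset.mul_sum] at h
  simpa only [mul_assoc, mul_left_comm (epsUp _ _ _ _)] using h

theorem epsFourLeft (hA : IsCov M A' A) (hT : IsCovTwo M T' T) (hZ : IsCov M Z' Z) :
    ∑ α, ∑ β, ∑ γ, ∑ δ, epsUp α β γ δ * A' α * T' β γ * Z' δ =
      ∑ α, ∑ β, ∑ γ, ∑ δ, epsUp α β γ δ * A α * T β γ * Z δ := by
  have h := hA.dot (hM.epsLeft hT hZ)
  simp only [Finset.mul_sum] at h
  simpa only [mul_assoc, mul_left_comm (epsUp _ _ _ _)] using h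

theorem epsMix (hT : IsMix M T' T) (hB : IsCov M B' B) (hY : IsCov M Y' Y) (hZ : IsCov M Z' Z) :
    IsVec M (fun α => ∑ κ, ∑ β, ∑ γ, ∑ δ, epsUp κ β γ δ * T' κ α * B' β * Y' γ * Z' δ)
      (fun α => ∑ κ, ∑ β, ∑ γ, ∑ δ, epsUp κ β γ δ * T κ α * B β * Y γ * Z δ) := by
  have h := IsMix.dot_left (hM.eps hB hY hZ) hT
  simp only [Finset.sum_mul] at h
  simpa only [mul_assoc, mul_comm, mul_left_comm] using h

theorem raiseSum (hB : IsCov M B' B) :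
    IsVec M (fun α => ∑ l, eta α l * B' l) (fun α => ∑ l, eta α l * B l) := hM.raise hB

/-- The vector field `X^α = (a η^{ακ} + b u^α u^κ) ξ_κ`. -/
theorem raiseAdd (a b : ℝ) (hA : IsVec M A' A) (hB : IsCov M B' B) :
    IsVec M (fun α => ∑ κ, (a * eta α κ + b * A' α * A' κ) * B' κ)
      (fun α => ∑ κ, (a * eta α κ + b * A α * A κ) * B κ) := by
  have h := ((hM.raiseSum hB).smul (k := a) rfl).add ((hA.smul (k := b) rfl).smul_right
    (hA.dot hB))
  simpa only [add_mul, Finset.sum_add_distrib, Finset.mul_sum, mul_assoc] using h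

/-- The covector `T_κ^κ ξ_l - T_l^κ ξ_κ`. -/
theorem traceSub (hT : IsMix M T' T) (hB : IsCov M B' B) :
    IsCov M (fun l => ∑ κ, (T' κ κ * B' l - T' l κ * B' κ))
      (fun l => ∑ κ, (T κ κ * B l - T l κ * B κ)) := by
  have h := (hB.smul (hM.trace hT)).sub (hT.dot_right hB)
  simpa only [Finset.sum_sub_distrib, Finset.sum_mul] using h

/-- The scalar `T_κ^κ R_l^l - T_l^κ R_κ^l`. -/
theorem traceTrace (hT : IsMix M T' T) (hR : IsMix M R' R) :
    ∑ κ, ∑ l, (T' κ κ * R' l l - T' l κ * R' κ l) = ∑ κ, ∑ l, (T κ κ * R l l - T l κ * R κ l) := by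
  have h : ∀ T R : Fin 4 → Fin 4 → ℝ, ∑ κ, ∑ l, (T κ κ * R l l - T l κ * R κ l) =
      (∑ κ, T κ κ) * (∑ l, R l l) - ∑ κ, ∑ l, T κ l * R l κ := fun T R => by
    rw [Finset.sum_mul_sum, Finset.sum_comm (f := fun κ l => T κ l * R l κ)]
    simp only [Finset.sum_sub_distrib]
  rw [h, h, hM.trace hT, hM.trace hR, hM.trace (hT.comp hR)]

/-- The vector `A^κ (T_κ^α R_l^l - T_l^α R_κ^l)`. -/
theorem mixTrace (hT : IsMix M T' T) (hR : IsMix M R' R) (hA : IsVec M A' A) :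
    IsVec M (fun α => ∑ κ, A' κ * ∑ l, (T' κ α * R' l l - T' l α * R' κ l))
      (fun α => ∑ κ, A κ * ∑ l, (T κ α * R l l - T l α * R κ l)) := by
  have h := ((IsMix.dot_left hA hT).smul_right (hM.trace hR)).sub (IsMix.dot_left hA (hR.comp hT))
  have key : ∀ (A : Fin 4 → ℝ) (T R : Fin 4 → Fin 4 → ℝ) (α : Fin 4),
      ∑ κ, A κ * ∑ l, (T κ α * R l l - T l α * R κ l) =
        (∑ κ, A κ * T κ α) * (∑ l, R l l) - ∑ κ, A κ * ∑ l, R κ l * T l α := fun A T R α => by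
    rw [Finset.sum_mul, ← Finset.sum_sub_distrib]
    refine Finset.sum_congr rfl fun κ _ => ?_
    simp only [Finset.sum_sub_distrib, ← Finset.mul_sum, mul_comm (R κ _)]
    ring
  simpa only [key] using h

end IsLorentz

/-! ### Lorentz covariance of the null forms and the linear terms -/

/-- The values and first derivatives `v'`, `p'` and `v`, `p` of the solution variables represent the
same tensors in two inertial coordinate systems related by `M`. -/
structure IsRelated (M : Matrix (Fin 4) (Fin 4) ℝ) (v' v : State) (p' p : Grad) : Prop where
  val_h : v'.h = v.h
  val_s : v'.s = v.s
  val_u : IsVec M v'.u v.u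
  val_S : IsVec M v'.S v.S
  val_w : IsVec M v'.w v.w
  grad_h : IsCov M p'.h p.h
  grad_u : IsMix M p'.u p.u
  grad_S : IsMix M p'.S p.S
  grad_w : IsMix M p'.w p.w

theorem gDot_eq (e : EquationOfState) (v : State) (ξ ζ : Fin 4 → ℝ) :
    gDot e v ξ ζ = ∑ α, (∑ β, (e.c v.h v.s ^ 2 * eta α β +
      (e.c v.h v.s ^ 2 - 1) * v.u α * v.u β) * ξ β) * ζ α := by
  have h : ∀ α β, eta α β = eta β α := fun α β => by
    by_cases hab : α = β
    · rw [hab]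
    · rw [eta_of_ne hab, eta_of_ne (Ne.symm hab)]
  simp only [gDot, acousticalMetricInv, Matrix.of_apply, Finset.sum_mul]
  rw [Finset.sum_comm]
  refine Finset.sum_congr rfl fun α _ => Finset.sum_congr rfl fun β _ => ?_
  rw [h]
  ring

namespace IsRelated

variable (hM : IsLorentz M) {v' v : State} {p' p : Grad} (R : IsRelated M v' v p' p)
  (e : EquationOfState) {B' B : Fin 4 → ℝ} {T' T : Fin 4 → Fin 4 → ℝ}

include hM R

theorem lower_u : IsCov M (lower v'.u) (lower v.u) := hM.lower R.val_u
theorem lower_S : IsCov M (lower v'.S) (lower v.S) := hM.lower R.val_S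
theorem lower_w : IsCov M (lower v'.w) (lower v.w) := hM.lower R.val_w

theorem lower_grad_u :
    IsCovTwo M (fun κ l => lower (p'.u κ) l) (fun κ l => lower (p.u κ) l) :=
  hM.lowerMix R.grad_u

theorem gDot_mix (hB : IsCov M B' B) (hT : IsMix M T' T) :
    IsVec M (fun α => gDot e v' B' (fun l => T' l α)) (fun α => gDot e v B (fun l => T l α)) := by
  simp only [gDot_eq, R.val_h, R.val_s]
  exact IsMix.dot_left (hM.raiseAdd _ _ R.val_u hB) hT

theorem gDot_cov (hB : IsCov M B' B) : gDot e v' B' B' = gDot e v B B := by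
  simp only [gDot_eq, R.val_h, R.val_s]
  exact (hM.raiseAdd _ _ R.val_u hB).dot hB

theorem div_u : ∑ κ, p'.u κ κ = ∑ κ, p.u κ κ := hM.trace R.grad_u

omit hM in
theorem S_dot_h : ∑ κ, v'.S κ * p'.h κ = ∑ κ, v.S κ * p.h κ := R.val_S.dot R.grad_h

omit hM in
theorem u_dot_h : ∑ κ, v'.u κ * p'.h κ = ∑ κ, v.u κ * p.h κ := R.val_u.dot R.grad_h

omit hM in
theorem w_dot_h : ∑ κ, v'.w κ * p'.h κ = ∑ κ, v.w κ * p.h κ := R.val_w.dot R.grad_h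

theorem S_dot_S : ∑ κ, lower v'.S κ * v'.S κ = ∑ κ, lower v.S κ * v.S κ :=
  (R.lower_S hM).dot R.val_S

theorem w_dot_S : ∑ κ, v'.w κ * lower v'.S κ = ∑ κ, v.w κ * lower v.S κ :=
  R.val_w.dot (R.lower_S hM)

theorem div_u_sq : ∑ κ, ∑ l, (p'.u κ l * p'.u l κ - p'.u l l * p'.u κ κ) =
    ∑ κ, ∑ l, (p.u κ l * p.u l κ - p.u l l * p.u κ κ) := by
  have h := congrArg Neg.neg (hM.traceTrace R.grad_u R.grad_u)
  simpa only [← Finset.sum_neg_distrib, neg_sub, mul_comm] using h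

/-- The vector `S^κ ∂^α u_κ`. -/
theorem S_raise_grad_u :
    IsVec M (fun α => ∑ κ, v'.S κ * ∑ l, eta α l * lower (p'.u l) κ)
      (fun α => ∑ κ, v.S κ * ∑ l, eta α l * lower (p.u l) κ) := by
  have h := hM.raiseSum (IsCovTwo.dot_right' R.val_S (R.lower_grad_u hM))
  have key : ∀ (A : Fin 4 → ℝ) (T : Fin 4 → Fin 4 → ℝ) (α : Fin 4),
      ∑ κ, A κ * ∑ l, eta α l * T l κ = ∑ l, eta α l * ∑ κ, A κ * T l κ := fun A T α => by
    simp only [Finset.mul_sum, mul_left_comm (A _)]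
    rw [Finset.sum_comm]
  simpa only [key] using h

theorem modC : IsVec M (fun α => modC e α v' p') (fun α => modC e α v p) := by
  simp only [RelEuler.modC, R.val_h, R.val_s]
  refine ((((IsVec.neg ?_).add ?_).add ?_).add ?_).add ?_
  · exact hM.epsRight (R.lower_u hM) (hM.lowerMix R.grad_w)
  · exact (hM.eps (R.lower_u hM) R.grad_h (R.lower_w hM)).smul rfl
  · exact (R.val_S.smul rfl).smul_right (R.div_u hM)
  · exact (R.val_u.smul rfl).smul_right (R.S_dot_h)
  · exact (R.S_raise_grad_u hM).smul rfl

theorem modD : modD e v' p' = modD e v p := by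
  simp only [RelEuler.modD, R.val_h, R.val_s, R.S_dot_h, hM.trace R.grad_S]

theorem Qh : Qh e v' p' = Qh e v p := by
  simp only [RelEuler.Qh, R.val_h, R.val_s, R.gDot_cov hM e R.grad_h,
    hM.traceTrace R.grad_u R.grad_u]

theorem Lh : Lh e v' p' = Lh e v p := by
  simp only [RelEuler.Lh, R.val_h, R.val_s, R.S_dot_h, R.S_dot_S hM]

theorem Ls : Ls e v' p' = Ls e v p := by
  simp only [RelEuler.Ls, R.val_h, R.val_s, R.S_dot_h, R.S_dot_S hM]

theorem Qu : IsVec M (fun α => Qu e α v' p') (fun α => Qu e α v p) := by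
  simp only [RelEuler.Qu, R.val_h, R.val_s, R.div_u_sq hM]
  refine (IsVec.add ?_ ?_).sub ?_
  · exact hM.raiseSum (hM.traceSub R.grad_u R.grad_h)
  · exact (R.val_u.smul rfl).smul_right rfl
  · exact (R.gDot_mix hM e R.grad_h R.grad_u).smul rfl

theorem S_dot_accel : ∑ κ, v'.S κ * ∑ l, v'.u l * lower (p'.u l) κ =
    ∑ κ, v.S κ * ∑ l, v.u l * lower (p.u l) κ :=
  R.val_S.dot (IsCovTwo.dot_left R.val_u (R.lower_grad_u hM))

theorem Lu : IsVec M (fun α => Lu e α v' p') (fun α => Lu e α v p) := by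
  simp only [RelEuler.Lu, R.val_h, R.val_s, R.S_dot_accel hM, R.div_u hM, R.S_dot_h,
    R.u_dot_h]
  refine ((((((((IsVec.neg ?_).add ?_).add ?_).add ?_).add ?_).add ?_).add ?_).add ?_).add ?_
  · exact (hM.epsLeft (R.lower_grad_u hM) (R.lower_w hM)).smul rfl
  · exact (hM.eps (R.lower_u hM) R.grad_h (R.lower_w hM)).smul rfl
  · exact (hM.eps (R.lower_S hM) (R.lower_u hM) (R.lower_w hM)).smul rfl
  · exact (IsMix.dot_left R.val_S R.grad_u).smul rfl
  · exact (R.val_u.smul rfl).smul_right rfl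
  · exact (R.S_raise_grad_u hM).smul rfl
  · exact (((R.val_S.smul rfl).add (R.val_S.smul rfl)).sub (R.val_S.smul rfl)).smul_right rfl
  · exact (R.val_S.smul_right rfl).smul_right rfl
  · exact (R.val_u.smul rfl).smul_right rfl

theorem QD : QD e v' p' = QD e v p := by
  have h := R.val_S.dot (hM.traceSub R.grad_u R.grad_h)
  have h' : ∑ κ, v'.S κ * ∑ l, (p'.u κ l * p'.h l - p'.u l l * p'.h κ) =
      ∑ κ, v.S κ * ∑ l, (p.u κ l * p.h l - p.u l l * p.h κ) := by
    have h2 := congrArg Neg.neg h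
    simpa only [← Finset.sum_neg_distrib, ← mul_neg, neg_sub] using h2
  simp only [RelEuler.QD, R.val_h, R.val_s, h']

/-- The covector `∂_κ h ∂_l S^l - ∂_l h ∂_κ S^l`. -/
theorem h_S_cov : IsCov M (fun κ => ∑ l, (p'.h κ * p'.S l l - p'.h l * p'.S κ l))
    (fun κ => ∑ l, (p.h κ * p.S l l - p.h l * p.S κ l)) := by
  simpa only [mul_comm] using hM.traceSub R.grad_S R.grad_h

theorem QDS : QDS e v' p' = QDS e v p := by
  simp only [RelEuler.QDS, R.val_h, R.val_s, hM.traceTrace R.grad_S R.grad_u,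
    R.val_u.dot (R.h_S_cov hM)]

theorem LD : LD e v' p' = LD e v p := by
  have h := R.val_S.dot (IsCovTwo.dot_right' R.val_S (R.lower_grad_u hM))
  simp only [Finset.mul_sum, ← mul_assoc] at h
  simp only [RelEuler.LD, R.val_h, R.val_s, R.S_dot_S hM, R.div_u hM, h,
    hM.epsFour (R.lower_S hM) (R.lower_u hM) R.grad_h (R.lower_w hM),
    hM.epsFourLeft (R.lower_S hM) (R.lower_grad_u hM) (R.lower_w hM)]

theorem QCS : IsVec M (fun α => QCS e α v' p') (fun α => QCS e α v p) := by
  simp only [RelEuler.QCS, R.val_h, R.val_s]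
  refine (IsVec.neg (IsVec.smul rfl ?_)).add (IsVec.smul rfl ?_)
  · exact hM.epsRight (R.lower_u hM) (R.grad_w.compCov (R.lower_grad_u hM).swap)
  · simpa only [one_mul] using hM.raiseAdd 1 2 R.val_u (R.h_S_cov hM)

/-- The covector `w^κ ∂_δ u_κ`. -/
theorem w_grad_u : IsCov M (fun δ => ∑ κ, v'.w κ * lower (p'.u δ) κ)
    (fun δ => ∑ κ, v.w κ * lower (p.u δ) κ) :=
  IsCovTwo.dot_right' R.val_w (R.lower_grad_u hM)

theorem S_grad_u : IsCov M (fun δ => ∑ κ, v'.S κ * lower (p'.u δ) κ)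
    (fun δ => ∑ κ, v.S κ * lower (p.u δ) κ) :=
  IsCovTwo.dot_right' R.val_S (R.lower_grad_u hM)

theorem QC : IsVec M (fun α => QC e α v' p') (fun α => QC e α v p) := by
  simp only [RelEuler.QC, R.val_h, R.val_s, R.div_u_sq hM, R.gDot_cov hM e R.grad_h]
  refine ((((((((IsVec.neg ?_).add ?_).add ?_).add ?_).add ?_).add ?_).add ?_).add ?_).add ?_
  · exact (hM.epsMix R.grad_u (R.lower_u hM) R.grad_h (R.lower_w hM)).smul rfl
  · exact (hM.eps (R.lower_u hM) R.grad_h (R.w_grad_u hM)).smul rfl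
  · have h := hM.eps (R.lower_u hM) (hM.traceSub R.grad_u R.grad_h) (R.lower_w hM)
    simp only [mul_right_comm _ (∑ κ, _) _] at h
    exact h.smul rfl
  · refine IsVec.smul rfl ?_
    have h := hM.raiseSum (((R.S_grad_u hM).smul (R.u_dot_h)).sub
      (R.grad_h.smul_right (R.val_u.dot (R.S_grad_u hM))))
    have key : ∀ (u S B : Fin 4 → ℝ) (T : Fin 4 → Fin 4 → ℝ) (α : Fin 4),
        ∑ κ, ∑ l, ∑ β, u κ * eta α l * S β * (B κ * T l β - B l * T κ β) =
          ∑ l, eta α l * ((∑ κ, u κ * B κ) * (∑ κ, S κ * T l κ) -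
            B l * ∑ κ, u κ * ∑ β, S β * T κ β) := fun u S B T α => by
      rw [Finset.sum_comm]
      refine Finset.sum_congr rfl fun l _ => ?_
      rw [Finset.sum_mul, Finset.mul_sum, ← Finset.sum_sub_distrib, Finset.mul_sum]
      refine Finset.sum_congr rfl fun κ _ => ?_
      simp only [Finset.mul_sum, ← Finset.sum_sub_distrib]
      exact Finset.sum_congr rfl fun β _ => by ring
    simpa only [key _ _ _ (fun l β => lower _ β)] using h
  · refine IsVec.smul rfl ?_
    have h := ((IsMix.dot_left R.val_S R.grad_u).smul_right (R.u_dot_h)).sub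
      ((IsMix.dot_left R.val_u R.grad_u).smul_right (R.S_dot_h))
    have key : ∀ (u S B : Fin 4 → ℝ) (T : Fin 4 → Fin 4 → ℝ) (α : Fin 4),
        ∑ κ, ∑ l, S κ * u l * (T κ α * B l - T l α * B κ) =
          (∑ κ, S κ * T κ α) * (∑ κ, u κ * B κ) - (∑ κ, u κ * T κ α) * (∑ κ, S κ * B κ) :=
      fun u S B T α => by
        rw [mul_comm (∑ κ, u κ * T κ α)]
        simp only [Finset.sum_mul_sum, ← Finset.sum_sub_distrib]
        exact Finset.sum_congr rfl fun _ _ => Finset.sum_congr rfl fun _ _ => by ring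
    simpa only [key] using h
  · refine IsVec.smul rfl ?_
    have h := hM.raiseAdd 2 1 R.val_u (((R.S_grad_u hM).smul_right (R.div_u hM)).sub
      (R.grad_u.dot_right (R.S_grad_u hM)))
    have key : ∀ (S : Fin 4 → ℝ) (T U : Fin 4 → Fin 4 → ℝ) (κ : Fin 4),
        ∑ β, S β * ∑ l, (T κ β * U l l - T l β * U κ l) =
          (∑ β, S β * T κ β) * (∑ l, U l l) - ∑ l, U κ l * ∑ β, S β * T l β := fun S T U κ => by
      have h1 : ∑ l, U κ l * ∑ β, S β * T l β = ∑ β, S β * ∑ l, T l β * U κ l := by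
        simp only [Finset.mul_sum]
        rw [Finset.sum_comm]
        exact Finset.sum_congr rfl fun _ _ => Finset.sum_congr rfl fun _ _ => by ring
      rw [h1, Finset.sum_mul, ← Finset.sum_sub_distrib]
      refine Finset.sum_congr rfl fun β _ => ?_
      rw [Finset.sum_sub_distrib, ← Finset.mul_sum]
      ring
    simpa only [key v'.S (fun l β => lower (p'.u l) β), key v.S (fun l β => lower (p.u l) β),
      one_mul] using h
  · exact (R.val_S.smul rfl).smul_right rfl
  · exact (hM.mixTrace R.grad_u R.grad_u R.val_S).smul rfl
  · exact (R.val_S.smul_right rfl).smul_right rfl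

theorem LC : IsVec M (fun α => LC e α v' p') (fun α => LC e α v p) := by
  simp only [RelEuler.LC, R.val_h, R.val_s, R.w_dot_S hM, R.w_dot_h, R.u_dot_h, R.div_u hM,
    R.S_dot_S hM, R.S_dot_h,
    hM.epsFour (R.lower_S hM) (R.lower_u hM) R.grad_h (R.lower_w hM)]
  refine (((((((((((IsVec.sub ?_ ?_).add ?_).sub ?_).sub ?_).add ?_).add ?_).sub ?_).add ?_).add
    ?_).add ?_).add ?_)
  · exact R.val_w.smul rfl
  · exact (R.val_w.smul rfl).smul_right rfl
  · exact ((hM.eps (R.lower_u hM) (R.lower_S hM) (R.lower_w hM)).smul rfl).smul_right rfl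
  · exact (hM.eps (R.lower_u hM) (R.lower_S hM) (R.w_grad_u hM)).smul rfl
  · exact ((hM.eps (R.lower_S hM) (R.lower_u hM) (R.lower_w hM)).smul rfl).smul_right rfl
  · exact (hM.epsMix R.grad_u (R.lower_S hM) (R.lower_u hM) (R.lower_w hM)).smul rfl
  · exact (hM.eps (R.lower_S hM) R.grad_h (R.lower_w hM)).smul rfl
  · exact (R.val_u.smul rfl).smul_right rfl
  · exact (IsMix.dot_left R.val_u R.grad_u).smul rfl
  · exact ((R.val_u.smul_right rfl).smul_right rfl).smul_right rfl
  · exact (R.val_S.smul_right rfl).smul_right rfl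
  · exact (hM.raiseSum R.grad_h).smul rfl

end IsRelated

namespace IsRelated

variable (hM : IsLorentz M) {v' v : State} {p' p : Grad} (R : IsRelated M v' v p' p)
  (e : EquationOfState) {C' C : Fin 4 → ℝ} (D : ℝ)

include hM R

theorem rhsWaveH : rhsWaveH e v' p' C' D = rhsWaveH e v p C D := by
  simp only [RelEuler.rhsWaveH, R.val_h, R.val_s, R.Qh hM, R.Lh hM]

theorem rhsWaveS : rhsWaveS e v' p' C' D = rhsWaveS e v p C D := by
  simp only [RelEuler.rhsWaveS, R.val_h, R.val_s, R.Ls hM]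

theorem rhsWaveU (hC : IsVec M C' C) :
    IsVec M (fun α => rhsWaveU e α v' p' C' D) (fun α => rhsWaveU e α v p C D) := by
  simp only [RelEuler.rhsWaveU, R.val_h, R.val_s]
  exact ((hC.smul rfl).neg.add (R.Qu hM e)).add (R.Lu hM e)

theorem rhsTransportS :
    IsVec M (fun α => rhsTransportS α v' p' C' D) (fun α => rhsTransportS α v p C D) := by
  have h := hM.raiseSum (R.grad_u.dot_right (R.lower_S hM))
  have key : ∀ (A : Fin 4 → ℝ) (T : Fin 4 → Fin 4 → ℝ) (α : Fin 4),
      ∑ κ, A κ * ∑ l, eta α l * T l κ = ∑ l, eta α l * ∑ κ, T l κ * A κ := fun A T α => by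
    simp only [Finset.mul_sum]
    rw [Finset.sum_comm]
    exact Finset.sum_congr rfl fun _ _ => Finset.sum_congr rfl fun _ _ => by ring
  simp only [← key] at h
  exact h.neg

theorem rhsTransportW :
    IsVec M (fun α => rhsTransportW e α v' p' C' D) (fun α => rhsTransportW e α v p C D) := by
  simp only [RelEuler.rhsTransportW, R.val_h, R.val_s, R.w_dot_h, R.div_u hM, R.w_dot_S hM]
  refine ((((R.val_u.smul_right rfl).neg.add (IsMix.dot_left R.val_w R.grad_u)).sub
    (R.val_w.smul_right rfl)).add (IsVec.smul rfl ?_)).add ((R.val_u.smul rfl).smul_right rfl)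
  exact hM.eps (R.lower_u hM) R.grad_h (R.lower_S hM)

theorem rhsDivW : rhsDivW e v' p' C' D = rhsDivW e v p C D := by
  simp only [RelEuler.rhsDivW, R.val_h, R.val_s, R.w_dot_h, R.w_dot_S hM]

theorem rhsTransportD (hC : IsVec M C' C) :
    rhsTransportD e v' p' C' D = rhsTransportD e v p C D := by
  simp only [RelEuler.rhsTransportD, R.val_h, R.val_s, R.QDS hM, R.QD hM, R.LD hM,
    (R.lower_S hM).dot hC]

theorem rhsTransportC (hC : IsVec M C' C) :
    IsVec M (fun α => rhsTransportC e α v' p' C' D) (fun α => rhsTransportC e α v p C D) := by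
  have hacc : ∑ κ, C' κ * ∑ l, v'.u l * lower (p'.u l) κ =
      ∑ κ, C κ * ∑ l, v.u l * lower (p.u l) κ :=
    hC.dot (IsCovTwo.dot_left R.val_u (R.lower_grad_u hM))
  have h := hM.raiseSum (R.grad_S.dot_right (R.lower_S hM))
  have key : ∀ (A : Fin 4 → ℝ) (T : Fin 4 → Fin 4 → ℝ) (α : Fin 4),
      ∑ κ, A κ * ∑ l, eta α l * T l κ = ∑ l, eta α l * ∑ κ, T l κ * A κ := fun A T α => by
    simp only [Finset.mul_sum]
    rw [Finset.sum_comm]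
    exact Finset.sum_congr rfl fun _ _ => Finset.sum_congr rfl fun _ _ => by ring
  simp only [← key] at h
  simp only [RelEuler.rhsTransportC, R.val_h, R.val_s, R.div_u hM, R.u_dot_h, hacc,
    hM.trace R.grad_S]
  exact ((((((((IsMix.dot_left hC R.grad_u).sub ((hC.smul rfl).smul_right rfl)).add
    (R.val_u.smul_right rfl)).add (R.QCS hM e)).add
    (((R.val_u.smul rfl).smul_right rfl).smul_right rfl)).add
    ((R.val_S.smul rfl).smul_right rfl)).add (h.smul rfl)).add (R.QC hM e)).add (R.LC hM e)

end IsRelated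

/-! ### Lorentz covariance: transformation of a flow -/

/-- The change of inertial coordinates `x = x₀ + M y`. -/
def chart (x₀ : Spacetime) (M : Matrix (Fin 4) (Fin 4) ℝ) (y : Spacetime) : Spacetime :=
  x₀ + M.mulVec y

theorem contDiff_chart (x₀ : Spacetime) (n : WithTop ℕ∞) : ContDiff ℝ n (chart x₀ M) :=
  contDiff_const.add (LinearMap.toContinuousLinearMap M.mulVecLin).contDiff

theorem continuous_chart (x₀ : Spacetime) : Continuous (chart x₀ M) :=
  (contDiff_chart x₀ 0).continuous

theorem hasFDerivAt_chart (x₀ y : Spacetime) :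
    HasFDerivAt (chart x₀ M) (LinearMap.toContinuousLinearMap M.mulVecLin) y :=
  (LinearMap.toContinuousLinearMap M.mulVecLin).hasFDerivAt.const_add x₀

/-- The differential of a scalar field is a covector. -/
theorem isCov_pd {F : Spacetime → ℝ} {x₀ y : Spacetime}
    (hF : DifferentiableAt ℝ F (chart x₀ M y)) :
    IsCov M (fun κ => pd κ (fun z => F (chart x₀ M z)) y) (fun κ => pd κ F (chart x₀ M y)) :=
  fun κ => by
    have h1 := (hF.hasFDerivAt.comp y (hasFDerivAt_chart x₀ y)).fderiv
    have h2 : M.mulVec (Pi.single κ 1) = ∑ l, M l κ • (Pi.single l 1 : Spacetime) := by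
      ext i
      simp [Finset.sum_apply, Pi.single_apply]
    unfold pd
    rw [show (fun z => F (chart x₀ M z)) = F ∘ chart x₀ M from rfl, h1]
    simp only [ContinuousLinearMap.comp_apply, LinearMap.coe_toContinuousLinearMap',
      Matrix.mulVecLin_apply, h2, map_sum, map_smul, smul_eq_mul]

/-- The derivative of a vector field is a mixed tensor. -/
theorem isMix_pd {V' V : Spacetime → Fin 4 → ℝ} {x₀ y : Spacetime}
    (hV : ∀ α, DifferentiableAt ℝ (fun z => V z α) (chart x₀ M y))
    (hV' : ∀ α, DifferentiableAt ℝ (fun z => V' z α) y)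
    (h : ∀ᶠ z in nhds y, IsVec M (V' z) (V (chart x₀ M z))) :
    IsMix M (fun κ α => pd κ (fun z => V' z α) y)
      (fun κ α => pd κ (fun z => V z α) (chart x₀ M y)) := fun κ α => by
  refine (isCov_pd (hV α) κ).symm.trans ((pd_congr (g := fun z => ∑ β, M α β * V' z β)
    (h.mono fun z hz => hz α) κ).trans ?_)
  rw [pd_sum fun β => (hV' β).const_mul _]
  exact Finset.sum_congr rfl fun β _ => pd_const_mul _ (hV' β) κ

/-- The derivative of a covector field is a tensor with two indices down. -/
theorem isCovTwo_pd {V' V : Spacetime → Fin 4 → ℝ} {x₀ y : Spacetime}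
    (hV : ∀ α, DifferentiableAt ℝ (fun z => V z α) (chart x₀ M y))
    (h : ∀ᶠ z in nhds y, IsCov M (V' z) (V (chart x₀ M z))) :
    IsCovTwo M (fun κ α => pd κ (fun z => V' z α) y)
      (fun κ α => pd κ (fun z => V z α) (chart x₀ M y)) := fun κ α => by
  have hd : ∀ l, DifferentiableAt ℝ (fun z => V (chart x₀ M z) l) y := fun l =>
    DifferentiableAt.comp y (f := chart x₀ M) (hV l) (hasFDerivAt_chart x₀ y).differentiableAt
  refine (pd_congr (g := fun z => ∑ l, M l α * V (chart x₀ M z) l)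
    (h.mono fun z hz => hz α) κ).trans ?_
  rw [pd_sum fun l => (hd l).const_mul _]
  refine Finset.sum_congr rfl fun l _ => ?_
  rw [pd_const_mul _ (hd l) κ]
  exact congrArg _ (isCov_pd (hV l) κ)

namespace Fluid

/-- The flow in the coordinates `y` with `x = x₀ + M y`; the matrix `η Mᵀ η` is the inverse of the
Lorentz matrix `M`. -/
def transform (f : Fluid) (x₀ : Spacetime) (M : Matrix (Fin 4) (Fin 4) ℝ) : Fluid where
  h y := f.h (chart x₀ M y)
  s y := f.s (chart x₀ M y)
  u y := (eta * M.transpose * eta).mulVec (f.u (chart x₀ M y))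

/-- The region in the coordinates `y` in which the transformed flow is future-directed. -/
def transformDomain (f : Fluid) (Ω : Set Spacetime) (x₀ : Spacetime)
    (M : Matrix (Fin 4) (Fin 4) ℝ) : Set Spacetime :=
  {y | chart x₀ M y ∈ Ω ∧ 0 < (f.transform x₀ M).u y 0}

end Fluid

/-- A vector is determined in one inertial coordinate system by its components in another. -/
theorem IsLorentz.eq_of_isVec (hM : IsLorentz M) {A' A X' X : Fin 4 → ℝ} (hA : IsVec M A' A)
    (hX : IsVec M X' X) (h : A = X) : A' = X' := by
  have h1 : ∀ A' A : Fin 4 → ℝ, IsVec M A' A →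
      A' = (eta * M.transpose * eta).mulVec A := fun A' A hA => by
    rw [show A = M.mulVec A' from funext hA, Matrix.mulVec_mulVec, hM.inv_mul, Matrix.one_mulVec]
  rw [h1 _ _ hA, h1 _ _ hX, h]

namespace Fluid.IsSolution

variable {f : Fluid} {e : EquationOfState} {Ω : Set Spacetime} (hf : f.IsSolution e Ω)
  (hM : IsLorentz M) {x₀ y : Spacetime}

include hM in
theorem isVec_u : IsVec M ((f.transform x₀ M).u y) (f.u (chart x₀ M y)) := fun α => by
  have h : M.mulVec ((f.transform x₀ M).u y) = f.u (chart x₀ M y) := by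
    rw [transform, Matrix.mulVec_mulVec, hM.mul_inv, Matrix.one_mulVec]
  exact (congrFun h α).symm

include hf

theorem contDiffOn_transform_u :
    ContDiffOn ℝ 3 (f.transform x₀ M).u (chart x₀ M ⁻¹' Ω) :=
  (LinearMap.toContinuousLinearMap (eta * M.transpose * eta).mulVecLin).contDiff.comp_contDiffOn
    (hf.contDiffOn_u.comp (contDiff_chart x₀ 3).contDiffOn fun _ hz => hz)

theorem isOpen_transformDomain : IsOpen (f.transformDomain Ω x₀ M) := by
  have h1 : IsOpen (chart x₀ M ⁻¹' Ω) := hf.isOpen.preimage (continuous_chart x₀)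
  have h2 : ContinuousOn (fun y => (f.transform x₀ M).u y 0) (chart x₀ M ⁻¹' Ω) :=
    (continuous_apply 0).comp_continuousOn hf.contDiffOn_transform_u.continuousOn
  exact h2.isOpen_inter_preimage h1 isOpen_Ioi

include hM

omit hM in
theorem isCov_pd_h (hy : chart x₀ M y ∈ Ω) :
    IsCov M (fun κ => pd κ (f.transform x₀ M).h y) (fun κ => pd κ f.h (chart x₀ M y)) :=
  isCov_pd ((hf.contDiffAt_h hy).differentiableAt (by norm_num))

omit hM in
theorem isCov_pd_s (hy : chart x₀ M y ∈ Ω) :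
    IsCov M (fun κ => pd κ (f.transform x₀ M).s y) (fun κ => pd κ f.s (chart x₀ M y)) :=
  isCov_pd ((hf.contDiffAt_s hy).differentiableAt (by norm_num))

theorem isMix_pd_u (hy : chart x₀ M y ∈ Ω) :
    IsMix M (fun κ α => pd κ (fun z => (f.transform x₀ M).u z α) y)
      (fun κ α => pd κ (fun z => f.u z α) (chart x₀ M y)) := by
  refine isMix_pd (fun α => (hf.contDiffAt_u hy α).differentiableAt (by norm_num)) (fun α => ?_)
    (Filter.Eventually.of_forall fun z => isVec_u hM)
  have h := hf.contDiffOn_transform_u.contDiffAt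
    ((hf.isOpen.preimage (continuous_chart (M := M) x₀)).mem_nhds hy)
  exact (contDiffAt_pi.1 h α).differentiableAt (by norm_num)

/-- The relativistic Euler equations are Lorentz invariant. -/
theorem transform : (f.transform x₀ M).IsSolution e (f.transformDomain Ω x₀ M) where
  isOpen := hf.isOpen_transformDomain
  contDiffOn_h := hf.contDiffOn_h.comp (contDiff_chart x₀ 3).contDiffOn fun _ hz => hz.1
  contDiffOn_s := hf.contDiffOn_s.comp (contDiff_chart x₀ 3).contDiffOn fun _ hz => hz.1
  contDiffOn_u := hf.contDiffOn_transform_u.mono fun _ hz => hz.1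
  mem_dom y hy := hf.mem_dom _ hy.1
  c_le_one y hy := hf.c_le_one _ hy.1
  future y hy := hy.2
  unit y hy := ((hM.lower (isVec_u hM)).dot (isVec_u hM)).trans (hf.unit _ hy.1)
  enthalpy y hy := by
    rw [(isVec_u hM).dot (hf.isCov_pd_h hy.1), hM.trace (hf.isMix_pd_u hM hy.1)]
    exact hf.enthalpy _ hy.1
  velocity y hy := by
    have hu : IsVec M ((f.transform x₀ M).u y) (f.u (chart x₀ M y)) := isVec_u hM
    have h := ((IsMix.dot_left hu (hf.isMix_pd_u hM hy.1)).add
      (hM.raiseAdd 1 1 hu (hf.isCov_pd_h hy.1))).sub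
      ((hM.raiseSum (hf.isCov_pd_s hy.1)).smul
        (k := e.q (f.h (chart x₀ M y)) (f.s (chart x₀ M y))) rfl)
    simp only [one_mul] at h
    have h0 : IsVec M (fun _ => 0) (fun _ => 0) := fun α => by simp
    exact congrFun (hM.eq_of_isVec h h0 (funext (hf.velocity _ hy.1)))
  entropy y hy := by
    rw [(isVec_u hM).dot (hf.isCov_pd_s hy.1)]
    exact hf.entropy _ hy.1

end Fluid.IsSolution

/-! ### Lorentz covariance: derived quantities of a flow -/

namespace Fluid.IsSolution

variable {f : Fluid} {e : EquationOfState} {Ω : Set Spacetime} (hf : f.IsSolution e Ω)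
  (hM : IsLorentz M) {x₀ y : Spacetime}

include hf hM

theorem isVec_S (hy : chart x₀ M y ∈ Ω) :
    IsVec M ((f.transform x₀ M).S y) (f.S (chart x₀ M y)) := hM.raise (hf.isCov_pd_s hy)

theorem isVec_w (hy : chart x₀ M y ∈ Ω) :
    IsVec M ((f.transform x₀ M).w e y) (f.w e (chart x₀ M y)) := by
  have h := isCovTwo_pd (V := fun z δ => e.H (f.h z) * lower (f.u z) δ) (x₀ := x₀) (y := y) (M := M)
    (V' := fun z δ => e.H ((f.transform x₀ M).h z) * lower ((f.transform x₀ M).u z) δ)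
    (fun α => ((hf.contDiffAt_H hy).mul
      (contDiffAt_lower (hf.contDiffAt_u hy) α)).differentiableAt (by norm_num))
    (Filter.Eventually.of_forall fun z => (hM.lower (isVec_u hM)).smul rfl)
  exact (hM.epsRight (hM.lower (isVec_u hM)) h).neg

theorem eventually_chart_mem (hy : y ∈ f.transformDomain Ω x₀ M) :
    ∀ᶠ z in nhds y, chart x₀ M z ∈ Ω :=
  ((hf.transform hM).eventually_mem hy).mono fun _ hz => hz.1

theorem isRelated (hy : y ∈ f.transformDomain Ω x₀ M) :
    IsRelated M ((f.transform x₀ M).state e y) (f.state e (chart x₀ M y))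
      ((f.transform x₀ M).grad e y) (f.grad e (chart x₀ M y)) where
  val_h := rfl
  val_s := rfl
  val_u := isVec_u hM
  val_S := hf.isVec_S hM hy.1
  val_w := hf.isVec_w hM hy.1
  grad_h := hf.isCov_pd_h hy.1
  grad_u := hf.isMix_pd_u hM hy.1
  grad_S := isMix_pd (fun α => (hf.contDiffAt_S hy.1 α).differentiableAt (by norm_num))
    (fun α => ((hf.transform hM).contDiffAt_S hy α).differentiableAt (by norm_num))
    ((hf.eventually_chart_mem hM hy).mono fun _ hz => hf.isVec_S hM hz)
  grad_w := isMix_pd (fun α => (hf.contDiffAt_w hy.1 α).differentiableAt (by norm_num))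
    (fun α => ((hf.transform hM).contDiffAt_w hy α).differentiableAt (by norm_num))
    ((hf.eventually_chart_mem hM hy).mono fun _ hz => hf.isVec_w hM hz)

theorem isVec_C (hy : y ∈ f.transformDomain Ω x₀ M) :
    IsVec M ((f.transform x₀ M).C e y) (f.C e (chart x₀ M y)) := (hf.isRelated hM hy).modC hM e

theorem D_transform (hy : y ∈ f.transformDomain Ω x₀ M) :
    (f.transform x₀ M).D e y = f.D e (chart x₀ M y) := (hf.isRelated hM hy).modD hM e

/-- The derivative of a vector field along the flow is a vector. -/
theorem isVec_transport {V' V : Spacetime → Fin 4 → ℝ}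
    (hV : ∀ α, DifferentiableAt ℝ (fun z => V z α) (chart x₀ M y))
    (hV' : ∀ α, DifferentiableAt ℝ (fun z => V' z α) y)
    (hy : y ∈ f.transformDomain Ω x₀ M)
    (h : ∀ z ∈ f.transformDomain Ω x₀ M, IsVec M (V' z) (V (chart x₀ M z))) :
    IsVec M (fun α => (f.transform x₀ M).transport (fun z => V' z α) y)
      (fun α => f.transport (fun z => V z α) (chart x₀ M y)) :=
  IsMix.dot_left (isVec_u hM) (isMix_pd hV hV'
    (((hf.transform hM).eventually_mem hy).mono fun z hz => h z hz))

theorem transport_transform {F' F : Spacetime → ℝ}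
    (hF : DifferentiableAt ℝ F (chart x₀ M y)) (hy : y ∈ f.transformDomain Ω x₀ M)
    (h : ∀ z ∈ f.transformDomain Ω x₀ M, F' z = F (chart x₀ M z)) :
    (f.transform x₀ M).transport F' y = f.transport F (chart x₀ M y) := by
  have h1 : IsCov M (fun κ => pd κ F' y) (fun κ => pd κ F (chart x₀ M y)) := fun κ =>
    (pd_congr (((hf.transform hM).eventually_mem hy).mono fun z hz => h z hz) κ).trans
      (isCov_pd hF κ)
  exact (isVec_u hM).dot h1

end Fluid.IsSolution

/-! ### The wave operator of the acoustical metric -/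

theorem unit_components {u : Fin 4 → ℝ} (hu : ∑ κ, lower u κ * u κ = -1) :
    u 0 ^ 2 = 1 + u 1 ^ 2 + u 2 ^ 2 + u 3 ^ 2 := by
  simp only [lower_eq, Fin.sum_univ_four, eta_zero_zero, eta_one_one, eta_two_two,
    eta_three_three] at hu
  linarith

/-- In a rest frame of `u` the acoustical metric is `diag(-1, c⁻², c⁻², c⁻²)`. -/
theorem det_acousticalMetric {c : ℝ} (hc : c ≠ 0) {u : Fin 4 → ℝ}
    (hu : ∑ κ, lower u κ * u κ = -1) : (acousticalMetric c u).det = -(c ^ 3)⁻¹ ^ 2 := by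
  have h := unit_components hu
  have key : ∀ a b : ℝ, (Matrix.of fun α β => a * eta α β + b * lower u α * lower u β).det =
      -a ^ 3 * (a - b * (u 0 ^ 2 - u 1 ^ 2 - u 2 ^ 2 - u 3 ^ 2)) := by
    intro a b
    simp [Matrix.det_succ_row_zero, Fin.sum_univ_four, Fin.sum_univ_three, Fin.succAbove, lower_eq,
      eta]
    ring
  unfold acousticalMetric
  rw [key, h]
  field_simp
  ring

namespace Fluid.IsSolution

variable {f : Fluid} {e : EquationOfState} {Ω : Set Spacetime} (hf : f.IsSolution e Ω)
  {x : Spacetime} (hx : x ∈ Ω)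

include hf hx

theorem sqrt_det : Real.sqrt |(f.g e x).det| = (e.c (f.h x) (f.s x) ^ 3)⁻¹ := by
  rw [Fluid.g, det_acousticalMetric (hf.c_ne_zero hx) (hf.unit x hx), abs_neg, abs_sq,
    Real.sqrt_sq (inv_nonneg.2 (pow_nonneg (e.c_pos (hf.mem_dom x hx)).le 3))]

theorem contDiffAt_gInv (α β : Fin 4) : ContDiffAt ℝ 3 (fun y => f.gInv e y α β) x :=
  (((hf.contDiffAt_c hx).pow 2).mul contDiffAt_const).add
    (((((hf.contDiffAt_c hx).pow 2).sub contDiffAt_const).mul (hf.contDiffAt_u hx α)).mul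
      (hf.contDiffAt_u hx β))

theorem contDiffAt_gInv_pd {φ : Spacetime → ℝ} (hφ : ContDiffAt ℝ 2 φ x) (α : Fin 4) :
    ContDiffAt ℝ 1 (fun y => ∑ β, f.gInv e y α β * pd β φ y) x :=
  ContDiffAt.sum fun β _ => ((hf.contDiffAt_gInv hx α β).of_le (by norm_num)).mul
    (contDiffAt_pd hφ (by norm_num) β)

/-- The wave operator as a divergence, with the logarithmic derivative of the volume density
`c⁻³` of the acoustical metric. -/
theorem boxg_eq_div {φ : Spacetime → ℝ} (hφ : ContDiffAt ℝ 2 φ x) :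
    f.boxg e φ x = (∑ α, pd α (fun y => ∑ β, f.gInv e y α β * pd β φ y) x) -
      3 * (e.c (f.h x) (f.s x))⁻¹ * ∑ α, (∑ β, f.gInv e x α β * pd β φ x) *
        pd α (fun y => e.c (f.h y) (f.s y)) x := by
  have hc := hf.c_ne_zero hx
  have hcd : DifferentiableAt ℝ (fun y => e.c (f.h y) (f.s y)) x :=
    (hf.contDiffAt_c hx).differentiableAt (by norm_num)
  have hc3 : DifferentiableAt ℝ (fun y => e.c (f.h y) (f.s y) ^ 3) x := hcd.pow 3
  have hJ : ∀ α, DifferentiableAt ℝ (fun y => ∑ β, f.gInv e y α β * pd β φ y) x := fun α =>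
    (hf.contDiffAt_gInv_pd hx hφ α).differentiableAt (by norm_num)
  have h1 : ∀ α, pd α (fun y => Real.sqrt |(f.g e y).det| * ∑ β, f.gInv e y α β * pd β φ y) x =
      (e.c (f.h x) (f.s x) ^ 3)⁻¹ * pd α (fun y => ∑ β, f.gInv e y α β * pd β φ y) x -
      (e.c (f.h x) (f.s x) ^ 3)⁻¹ ^ 2 * (3 * e.c (f.h x) (f.s x) ^ 2) *
        ((∑ β, f.gInv e x α β * pd β φ x) * pd α (fun y => e.c (f.h y) (f.s y)) x) := fun α => by
    rw [pd_congr (g := fun y => (e.c (f.h y) (f.s y) ^ 3)⁻¹ * ∑ β, f.gInv e y α β * pd β φ y)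
      ((hf.eventually_mem hx).mono fun y hy => by simp only [hf.sqrt_det hy]),
      pd_mul (hc3.fun_inv (pow_ne_zero 3 hc)) (hJ α), pd_inv hc3 (pow_ne_zero 3 hc), pd_pow hcd]
    push_cast
    ring
  simp only [Fluid.boxg, box, h1, hf.sqrt_det hx, Finset.sum_sub_distrib, ← Finset.mul_sum]
  field_simp

end Fluid.IsSolution

namespace Fluid.IsSolution

variable {f : Fluid} {e : EquationOfState} {Ω : Set Spacetime} (hf : f.IsSolution e Ω)
  (hM : IsLorentz M) {x₀ y : Spacetime}

include hf hM

omit hf in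
theorem isVec_gInv_pd {φ' φ : Spacetime → ℝ}
    (hφ : IsCov M (fun κ => pd κ φ' y) (fun κ => pd κ φ (chart x₀ M y))) :
    IsVec M (fun α => ∑ β, (f.transform x₀ M).gInv e y α β * pd β φ' y)
      (fun α => ∑ β, f.gInv e (chart x₀ M y) α β * pd β φ (chart x₀ M y)) :=
  hM.raiseAdd _ _ (isVec_u hM) hφ

/-- The wave operator of the acoustical metric is Lorentz covariant. -/
theorem boxg_transform {φ' φ : Spacetime → ℝ} (hy : y ∈ f.transformDomain Ω x₀ M)
    (hφ : ∀ z ∈ Ω, ContDiffAt ℝ 2 φ z)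
    (h : ∀ z ∈ f.transformDomain Ω x₀ M, φ' z = φ (chart x₀ M z)) :
    (f.transform x₀ M).boxg e φ' y = f.boxg e φ (chart x₀ M y) := by
  have hf' := hf.transform (x₀ := x₀) hM
  have hev : ∀ z ∈ f.transformDomain Ω x₀ M, φ' =ᶠ[nhds z] fun z => φ (chart x₀ M z) :=
    fun z hz => (hf'.eventually_mem hz).mono fun z hz => h z hz
  have hcov : ∀ z ∈ f.transformDomain Ω x₀ M,
      IsCov M (fun κ => pd κ φ' z) (fun κ => pd κ φ (chart x₀ M z)) := fun z hz κ =>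
    (pd_congr (hev z hz) κ).trans (isCov_pd ((hφ _ hz.1).differentiableAt (by norm_num)) κ)
  have hφ' : ContDiffAt ℝ 2 φ' y :=
    (ContDiffAt.comp y (f := chart x₀ M) (hφ _ hy.1)
      (contDiff_chart x₀ 2).contDiffAt).congr_of_eventuallyEq (hev y hy)
  rw [hf'.boxg_eq_div hy hφ', hf.boxg_eq_div hy.1 (hφ _ hy.1)]
  have hc : IsCov M
      (fun κ => pd κ (fun z => e.c ((f.transform x₀ M).h z) ((f.transform x₀ M).s z)) y)
      (fun κ => pd κ (fun z => e.c (f.h z) (f.s z)) (chart x₀ M y)) :=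
    isCov_pd (F := fun z => e.c (f.h z) (f.s z))
      ((hf.contDiffAt_c hy.1).differentiableAt (by norm_num))
  have hdiv := hM.trace (isMix_pd (x₀ := x₀) (y := y)
    (V' := fun z α => ∑ β, (f.transform x₀ M).gInv e z α β * pd β φ' z)
    (V := fun z α => ∑ β, f.gInv e z α β * pd β φ z)
    (fun α => (hf.contDiffAt_gInv_pd hy.1 (hφ _ hy.1) α).differentiableAt (by norm_num))
    (fun α => (hf'.contDiffAt_gInv_pd hy hφ' α).differentiableAt (by norm_num))
    ((hf'.eventually_mem hy).mono fun z hz => isVec_gInv_pd hM (hcov z hz)))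
  have hdot := (isVec_gInv_pd (f := f) (e := e) hM (hcov y hy)).dot hc
  exact congrArg₂ (· - ·) hdiv (congrArg₂ (· * ·) rfl hdot)

end Fluid.IsSolution

/-! ### The rest frame -/

/-- The boost that maps the time axis to the future-directed unit timelike vector `u`. -/
def boost (u : Fin 4 → ℝ) : Matrix (Fin 4) (Fin 4) ℝ :=
  !![u 0, u 1, u 2, u 3;
    u 1, 1 + u 1 * u 1 / (1 + u 0), u 1 * u 2 / (1 + u 0), u 1 * u 3 / (1 + u 0);
    u 2, u 2 * u 1 / (1 + u 0), 1 + u 2 * u 2 / (1 + u 0), u 2 * u 3 / (1 + u 0);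
    u 3, u 3 * u 1 / (1 + u 0), u 3 * u 2 / (1 + u 0), 1 + u 3 * u 3 / (1 + u 0)]

theorem isLorentz_boost {u : Fin 4 → ℝ} (hu : ∑ κ, lower u κ * u κ = -1) (h0 : 0 < u 0) :
    IsLorentz (boost u) := by
  have h := unit_components hu
  have h1 : (1 + u 0) ≠ 0 := by positivity
  have h2 : (1 + u 0) * (1 + u 0)⁻¹ = 1 := mul_inv_cancel₀ h1
  generalize hk : (1 + u 0)⁻¹ = k at h2
  have h3 : (u 1 ^ 2 + u 2 ^ 2 + u 3 ^ 2) * k = u 0 - 1 := by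
    linear_combination (u 0 - 1) * h2 - k * h
  have h4 : (u 1 ^ 2 + u 2 ^ 2 + u 3 ^ 2) * k ^ 2 = 1 - 2 * k := by
    linear_combination k * h3 + h2
  have h5 : ∀ i j, u i * u j * ((u 1 ^ 2 + u 2 ^ 2 + u 3 ^ 2) * k ^ 2) = u i * u j * (1 - 2 * k) :=
    fun i j => by rw [h4]
  have h6 : ∀ i, u i * ((u 1 ^ 2 + u 2 ^ 2 + u 3 ^ 2) * k) = u i * (u 0 - 1) :=
    fun i => by rw [h3]
  constructor
  · ext i j
    fin_cases i <;> fin_cases j <;>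
      simp [boost, Matrix.mul_apply, Fin.sum_univ_four, eta, div_eq_mul_inv, hk]
    · linear_combination -h
    · linear_combination h6 1
    · linear_combination h6 2
    · linear_combination h6 3
    · linear_combination h6 1
    · linear_combination h5 1 1
    · linear_combination h5 1 2
    · linear_combination h5 1 3
    · linear_combination h6 2
    · linear_combination h5 2 1
    · linear_combination h5 2 2
    · linear_combination h5 2 3
    · linear_combination h6 3
    · linear_combination h5 3 1
    · linear_combination h5 3 2
    · linear_combination h5 3 3
  · simp [boost, Matrix.det_succ_row_zero, Fin.sum_univ_four, Fin.sum_univ_three, Fin.succAbove,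
      div_eq_mul_inv, hk]
    linear_combination u 0 * h3 + h

/-- The four-velocity of a fluid at rest. -/
def restVelocity : Fin 4 → ℝ := ![1, 0, 0, 0]

theorem isVec_boost (u : Fin 4 → ℝ) : IsVec (boost u) restVelocity u := fun α => by
  fin_cases α <;> simp [boost, restVelocity, Fin.sum_univ_four]

/-- Every point of a flow is the origin of inertial coordinates in which the fluid is at rest at the
origin. -/
theorem Fluid.IsSolution.exists_restFrame {f : Fluid} {e : EquationOfState} {Ω : Set Spacetime}
    (hf : f.IsSolution e Ω) {x : Spacetime} (hx : x ∈ Ω) :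
    ∃ M, IsLorentz M ∧ chart x M 0 = x ∧ 0 ∈ f.transformDomain Ω x M ∧
      (f.transform x M).u 0 = restVelocity := by
  have hM := isLorentz_boost (hf.unit x hx) (hf.future x hx)
  have h0 : chart x (boost (f.u x)) 0 = x := by simp [chart]
  have hu : (f.transform x (boost (f.u x))).u 0 = restVelocity :=
    hM.eq_of_isVec (isVec_u hM) (isVec_boost (f.u x)) (by rw [h0])
  refine ⟨_, hM, h0, ⟨by rwa [h0], ?_⟩, hu⟩
  rw [hu]
  exact one_pos

/-- Equality of two vectors attached to flows may be checked in the rest frame. -/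
theorem eq_of_restFrame {e : EquationOfState} {A B : Fluid → Spacetime → Fin 4 → ℝ}
    (hA : ∀ {f : Fluid} {Ω : Set Spacetime}, f.IsSolution e Ω → ∀ {M} {x₀ y : Spacetime},
      IsLorentz M → y ∈ f.transformDomain Ω x₀ M →
        IsVec M (A (f.transform x₀ M) y) (A f (chart x₀ M y)))
    (hB : ∀ {f : Fluid} {Ω : Set Spacetime}, f.IsSolution e Ω → ∀ {M} {x₀ y : Spacetime},
      IsLorentz M → y ∈ f.transformDomain Ω x₀ M →
        IsVec M (B (f.transform x₀ M) y) (B f (chart x₀ M y)))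
    (h : ∀ {f : Fluid} {Ω : Set Spacetime}, f.IsSolution e Ω → ∀ {x : Spacetime}, x ∈ Ω →
      f.u x = restVelocity → A f x = B f x)
    {f : Fluid} {Ω : Set Spacetime} (hf : f.IsSolution e Ω) {x : Spacetime} (hx : x ∈ Ω) :
    A f x = B f x := by
  obtain ⟨M, hM, h0, hy, hu⟩ := hf.exists_restFrame hx
  have hA' := hA hf hM hy
  have hB' := hB hf hM hy
  rw [h0] at hA' hB'
  funext α
  rw [hA' α, hB' α, h (hf.transform hM) hy hu]

/-- Equality of two scalars attached to flows may be checked in the rest frame. -/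
theorem eq_of_restFrame_scalar {e : EquationOfState} {A B : Fluid → Spacetime → ℝ}
    (hA : ∀ {f : Fluid} {Ω : Set Spacetime}, f.IsSolution e Ω → ∀ {M} {x₀ y : Spacetime},
      IsLorentz M → y ∈ f.transformDomain Ω x₀ M → A (f.transform x₀ M) y = A f (chart x₀ M y))
    (hB : ∀ {f : Fluid} {Ω : Set Spacetime}, f.IsSolution e Ω → ∀ {M} {x₀ y : Spacetime},
      IsLorentz M → y ∈ f.transformDomain Ω x₀ M → B (f.transform x₀ M) y = B f (chart x₀ M y))
    (h : ∀ {f : Fluid} {Ω : Set Spacetime}, f.IsSolution e Ω → ∀ {x : Spacetime}, x ∈ Ω →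
      f.u x = restVelocity → A f x = B f x)
    {f : Fluid} {Ω : Set Spacetime} (hf : f.IsSolution e Ω) {x : Spacetime} (hx : x ∈ Ω) :
    A f x = B f x := by
  obtain ⟨M, hM, h0, hy, hu⟩ := hf.exists_restFrame hx
  have hA' := hA hf hM hy
  have hB' := hB hf hM hy
  rw [h0] at hA' hB'
  rw [← hA', ← hB', h (hf.transform hM) hy hu]

/-! ### The differentiated Euler equations -/

theorem pd_sum_mul {ι : Type*} [Fintype ι] {A B : ι → Spacetime → ℝ} {x : Spacetime}
    (hA : ∀ i, DifferentiableAt ℝ (A i) x) (hB : ∀ i, DifferentiableAt ℝ (B i) x) (μ : Fin 4) :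
    pd μ (fun y => ∑ i, A i y * B i y) x =
      ∑ i, (pd μ (A i) x * B i x + A i x * pd μ (B i) x) := by
  rw [pd_sum fun i => (hA i).fun_mul (hB i)]
  exact Finset.sum_congr rfl fun i _ => pd_mul (hA i) (hB i) μ

theorem pd_lower {V : Spacetime → Fin 4 → ℝ} {x : Spacetime}
    (hV : ∀ α, DifferentiableAt ℝ (fun y => V y α) x) (μ α : Fin 4) :
    pd μ (fun y => lower (V y) α) x = lower (fun β => pd μ (fun y => V y β) x) α := by
  simp only [lower_eq]
  exact pd_const_mul _ (hV α) μ

namespace Fluid.IsSolution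

variable {f : Fluid} {e : EquationOfState} {Ω : Set Spacetime} (hf : f.IsSolution e Ω)
  {x : Spacetime} (hx : x ∈ Ω)

include hf hx

theorem diff_h : DifferentiableAt ℝ f.h x := (hf.contDiffAt_h hx).differentiableAt (by norm_num)

theorem diff_s : DifferentiableAt ℝ f.s x := (hf.contDiffAt_s hx).differentiableAt (by norm_num)

theorem diff_u (α : Fin 4) : DifferentiableAt ℝ (fun y => f.u y α) x :=
  (hf.contDiffAt_u hx α).differentiableAt (by norm_num)

theorem diff_S (α : Fin 4) : DifferentiableAt ℝ (fun y => f.S y α) x :=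
  (hf.contDiffAt_S hx α).differentiableAt (by norm_num)

theorem diff_w (α : Fin 4) : DifferentiableAt ℝ (fun y => f.w e y α) x :=
  (hf.contDiffAt_w hx α).differentiableAt (by norm_num)

theorem diff_lower_u (α : Fin 4) : DifferentiableAt ℝ (fun y => lower (f.u y) α) x :=
  (contDiffAt_lower (hf.contDiffAt_u hx) α).differentiableAt (by norm_num)

theorem diff_pd_h (κ : Fin 4) : DifferentiableAt ℝ (fun y => pd κ f.h y) x :=
  (contDiffAt_pd (m := 2) (hf.contDiffAt_h hx) (by norm_num) κ).differentiableAt (by norm_num)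

theorem diff_pd_s (κ : Fin 4) : DifferentiableAt ℝ (fun y => pd κ f.s y) x :=
  (contDiffAt_pd (m := 2) (hf.contDiffAt_s hx) (by norm_num) κ).differentiableAt (by norm_num)

theorem diff_pd_u (κ α : Fin 4) : DifferentiableAt ℝ (fun y => pd κ (fun z => f.u z α) y) x :=
  (contDiffAt_pd (m := 2) (hf.contDiffAt_u hx α) (by norm_num) κ).differentiableAt (by norm_num)

theorem diff_pd_S (κ α : Fin 4) : DifferentiableAt ℝ (fun y => pd κ (fun z => f.S z α) y) x :=
  (contDiffAt_pd (m := 1) (hf.contDiffAt_S hx α) (by norm_num) κ).differentiableAt (by norm_num)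

theorem diff_pd_w (κ α : Fin 4) : DifferentiableAt ℝ (fun y => pd κ (fun z => f.w e z α) y) x :=
  (contDiffAt_pd (m := 1) (hf.contDiffAt_w hx α) (by norm_num) κ).differentiableAt (by norm_num)

theorem pd_eos {G : ℝ → ℝ → ℝ}
    (hG : ContDiffAt ℝ ∞ (fun z : ℝ × ℝ => G z.1 z.2) (f.h x, f.s x)) (κ : Fin 4) :
    pd κ (fun y => G (f.h y) (f.s y)) x =
      ddh G (f.h x) (f.s x) * pd κ f.h x + dds G (f.h x) (f.s x) * pd κ f.s x :=
  pd_comp (differentiableAt_of_smooth hG) (hf.diff_h hx) (hf.diff_s hx) κ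

theorem diff_eos {G : ℝ → ℝ → ℝ}
    (hG : ContDiffAt ℝ ∞ (fun z : ℝ × ℝ => G z.1 z.2) (f.h x, f.s x)) :
    DifferentiableAt ℝ (fun y => G (f.h y) (f.s y)) x :=
  (hf.contDiffAt_eos hx hG).differentiableAt (by norm_num)

theorem pd_c (κ : Fin 4) : pd κ (fun y => e.c (f.h y) (f.s y)) x =
    ddh e.c (f.h x) (f.s x) * pd κ f.h x + dds e.c (f.h x) (f.s x) * pd κ f.s x :=
  hf.pd_eos hx (e.contDiffAt_c (hf.mem_dom x hx)) κ

theorem diff_c : DifferentiableAt ℝ (fun y => e.c (f.h y) (f.s y)) x :=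
  hf.diff_eos hx (e.contDiffAt_c (hf.mem_dom x hx))

theorem diff_q : DifferentiableAt ℝ (fun y => e.q (f.h y) (f.s y)) x :=
  hf.diff_eos hx (e.contDiffAt_q (hf.mem_dom x hx))

theorem pd_c_sq (κ : Fin 4) : pd κ (fun y => e.c (f.h y) (f.s y) ^ 2) x =
    2 * e.c (f.h x) (f.s x) * (ddh e.c (f.h x) (f.s x) * pd κ f.h x +
      dds e.c (f.h x) (f.s x) * pd κ f.s x) := by
  rw [pd_pow (hf.diff_c hx), hf.pd_c hx]
  norm_num

theorem pd_H (κ : Fin 4) : pd κ (fun y => e.H (f.h y)) x = e.H (f.h x) * pd κ f.h x := by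
  have h := hf.pd_eos hx (G := fun h _ => e.H h) (e.contDiffAt_H _ _) κ
  have h1 : ddh (fun h _ => e.H h) (f.h x) (f.s x) = e.H (f.h x) := (e.hasDerivAt_H _).deriv
  have h2 : dds (fun h _ => e.H h) (f.h x) (f.s x) = 0 := deriv_const _ _
  rw [h, h1, h2, zero_mul, add_zero]

theorem pd_eq_zero {F : Spacetime → ℝ} {a : ℝ} (hF : ∀ y ∈ Ω, F y = a) (κ : Fin 4) :
    pd κ F x = 0 :=
  (pd_congr ((hf.eventually_mem hx).mono fun y hy => hF y hy) κ).trans (pd_const κ a)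

/-- The normalization of `u`, differentiated once. -/
theorem lower_u_mul_pd_u (κ : Fin 4) :
    ∑ l, lower (f.u x) l * pd κ (fun y => f.u y l) x = 0 := by
  have h := hf.pd_eq_zero hx hf.unit κ
  rw [pd_sum_mul (hf.diff_lower_u hx) (hf.diff_u hx)] at h
  simp only [pd_lower (hf.diff_u hx)] at h
  have h2 : ∀ l, lower (fun β => pd κ (fun y => f.u y β) x) l * f.u x l =
      lower (f.u x) l * pd κ (fun y => f.u y l) x := fun l => by
    simp only [lower_eq]
    ring
  simp only [h2, Finset.sum_add_distrib] at h
  linarith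

/-- The normalization of `u`, differentiated twice. -/
theorem pd_unit_pd (κ m : Fin 4) :
    ∑ l, (lower (fun β => pd κ (fun y => f.u y β) x) l * pd m (fun y => f.u y l) x +
      lower (f.u x) l * pd κ (pd m (fun y => f.u y l)) x) = 0 := by
  have h := hf.pd_eq_zero hx (fun y hy => hf.lower_u_mul_pd_u hy m) κ
  rw [pd_sum_mul (hf.diff_lower_u hx) (hf.diff_pd_u hx m)] at h
  simpa only [pd_lower (hf.diff_u hx)] using h

/-- The entropy equation, differentiated once. -/
theorem pd_entropy (κ : Fin 4) :
    ∑ l, (pd κ (fun y => f.u y l) x * pd l f.s x + f.u x l * pd κ (pd l f.s) x) = 0 := by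
  have h := hf.pd_eq_zero hx hf.entropy κ
  rwa [pd_sum_mul (hf.diff_u hx) (hf.diff_pd_s hx)] at h

/-- The enthalpy equation, differentiated once. -/
theorem pd_enthalpy (κ : Fin 4) :
    ∑ l, (pd κ (fun y => f.u y l) x * pd l f.h x + f.u x l * pd κ (pd l f.h) x) +
      (2 * e.c (f.h x) (f.s x) * (ddh e.c (f.h x) (f.s x) * pd κ f.h x +
        dds e.c (f.h x) (f.s x) * pd κ f.s x) * (∑ l, pd l (fun y => f.u y l) x) +
      e.c (f.h x) (f.s x) ^ 2 * ∑ l, pd κ (pd l (fun y => f.u y l)) x) = 0 := by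
  have h := hf.pd_eq_zero hx hf.enthalpy κ
  have h1 : DifferentiableAt ℝ (fun y => ∑ l, pd l (fun z => f.u z l) y) x :=
    DifferentiableAt.fun_sum fun l _ => hf.diff_pd_u hx l l
  have h2 : DifferentiableAt ℝ (fun y => e.c (f.h y) (f.s y) ^ 2) x := (hf.diff_c hx).pow 2
  rw [pd_add (DifferentiableAt.fun_sum fun l _ => (hf.diff_u hx l).fun_mul (hf.diff_pd_h hx l))
    (h2.fun_mul h1), pd_sum_mul (hf.diff_u hx) (hf.diff_pd_h hx), pd_mul h2 h1, hf.pd_c_sq hx,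
    pd_sum fun l => hf.diff_pd_u hx l l] at h
  exact h

/-- The velocity equation, differentiated once. -/
theorem pd_velocity (κ α : Fin 4) :
    ∑ l, (pd κ (fun y => f.u y l) x * pd l (fun y => f.u y α) x +
        f.u x l * pd κ (pd l (fun y => f.u y α)) x) +
      ∑ l, ((pd κ (fun y => f.u y α) x * f.u x l + f.u x α * pd κ (fun y => f.u y l) x) *
        pd l f.h x + (eta α l + f.u x α * f.u x l) * pd κ (pd l f.h) x) -
      ((ddh e.q (f.h x) (f.s x) * pd κ f.h x + dds e.q (f.h x) (f.s x) * pd κ f.s x) *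
        (∑ l, eta α l * pd l f.s x) +
      e.q (f.h x) (f.s x) * ∑ l, eta α l * pd κ (pd l f.s) x) = 0 := by
  have h := hf.pd_eq_zero hx (fun y hy => hf.velocity y hy α) κ
  have huu : ∀ l, DifferentiableAt ℝ (fun y => f.u y α * f.u y l) x := fun l =>
    (hf.diff_u hx α).fun_mul (hf.diff_u hx l)
  have h1 : ∀ l, DifferentiableAt ℝ (fun y => eta α l + f.u y α * f.u y l) x := fun l =>
    (huu l).const_add _
  have h2 : ∀ l, pd κ (fun y => eta α l + f.u y α * f.u y l) x =
      pd κ (fun y => f.u y α) x * f.u x l + f.u x α * pd κ (fun y => f.u y l) x := fun l => by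
    rw [pd_add (differentiableAt_const _) (huu l), pd_const, zero_add,
      pd_mul (hf.diff_u hx α) (hf.diff_u hx l)]
  have h3 : ∀ l, DifferentiableAt ℝ (fun y => eta α l * pd l f.s y) x := fun l =>
    (hf.diff_pd_s hx l).const_mul _
  have h4 : DifferentiableAt ℝ (fun y => ∑ l, eta α l * pd l f.s y) x :=
    DifferentiableAt.fun_sum fun l _ => h3 l
  have h5 : DifferentiableAt ℝ (fun y => ∑ l, f.u y l * pd l (fun z => f.u z α) y) x :=
    DifferentiableAt.fun_sum fun l _ => (hf.diff_u hx l).fun_mul (hf.diff_pd_u hx l α)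
  have h6 : DifferentiableAt ℝ (fun y => ∑ l, (eta α l + f.u y α * f.u y l) * pd l f.h y) x :=
    DifferentiableAt.fun_sum fun l _ => (h1 l).fun_mul (hf.diff_pd_h hx l)
  rw [pd_sub (h5.fun_add h6) ((hf.diff_q hx).fun_mul h4), pd_add h5 h6,
    pd_sum_mul (hf.diff_u hx) (fun l => hf.diff_pd_u hx l α), pd_sum_mul h1 (hf.diff_pd_h hx),
    pd_mul (hf.diff_q hx) h4, hf.pd_eos hx (e.contDiffAt_q (hf.mem_dom x hx)), pd_sum h3] at h
  simp only [h2, pd_const_mul _ (hf.diff_pd_s hx _)] at h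
  exact h

/-- The vorticity, with the term in which the derivative falls on `H` removed: it is proportional
to `ε^{αβγδ} u_β u_δ = 0`. -/
theorem w_eq (α : Fin 4) : f.w e x α = -(e.H (f.h x) * ∑ β, ∑ γ, ∑ δ, epsUp α β γ δ *
    (lower (f.u x) β * lower (fun ν => pd γ (fun y => f.u y ν) x) δ)) := by
  have hH : DifferentiableAt ℝ (fun y => e.H (f.h y)) x :=
    (hf.contDiffAt_H hx).differentiableAt (by norm_num)
  have h : ∀ γ δ, pd γ (fun y => e.H (f.h y) * lower (f.u y) δ) x =
      e.H (f.h x) * (pd γ f.h x * lower (f.u x) δ +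
        lower (fun ν => pd γ (fun y => f.u y ν) x) δ) := fun γ δ => by
    rw [pd_mul hH (hf.diff_lower_u hx δ), hf.pd_H hx, pd_lower (hf.diff_u hx)]
    ring
  simp only [Fluid.w, vort, vortAt, h, mul_assoc]
  rw [sum_epsUp (fun β γ δ => lower (f.u x) β * (e.H (f.h x) * (pd γ f.h x * lower (f.u x) δ +
        lower (fun ν => pd γ (fun y => f.u y ν) x) δ))),
    sum_epsUp (fun β γ δ => lower (f.u x) β * lower (fun ν => pd γ (fun y => f.u y ν) x) δ)]
  fin_cases α <;> simp <;> ring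

/-- The first derivatives of the vorticity, by differentiation of `w_eq`. -/
theorem pd_w (κ α : Fin 4) : pd κ (fun y => f.w e y α) x = pd κ f.h x * f.w e x α -
    e.H (f.h x) * ∑ β, ∑ γ, ∑ δ, epsUp α β γ δ *
      (lower (fun ν => pd κ (fun y => f.u y ν) x) β *
        lower (fun ν => pd γ (fun y => f.u y ν) x) δ +
      lower (f.u x) β * lower (fun ν => pd κ (pd γ (fun y => f.u y ν)) x) δ) := by
  have hH : DifferentiableAt ℝ (fun y => e.H (f.h y)) x :=
    (hf.contDiffAt_H hx).differentiableAt (by norm_num)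
  have h0 : ∀ γ δ, DifferentiableAt ℝ
      (fun y => lower (fun ν => pd γ (fun z => f.u z ν) y) δ) x := fun γ δ => by
    simp only [lower_eq]
    exact (hf.diff_pd_u hx γ δ).const_mul _
  have h1 : ∀ β γ δ, DifferentiableAt ℝ (fun y => lower (f.u y) β *
      lower (fun ν => pd γ (fun z => f.u z ν) y) δ) x := fun β γ δ =>
    (hf.diff_lower_u hx β).fun_mul (h0 γ δ)
  have h2 : ∀ β γ δ, pd κ (fun y => epsUp α β γ δ * (lower (f.u y) β *
      lower (fun ν => pd γ (fun z => f.u z ν) y) δ)) x = epsUp α β γ δ *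
      (lower (fun ν => pd κ (fun y => f.u y ν) x) β *
        lower (fun ν => pd γ (fun y => f.u y ν) x) δ +
      lower (f.u x) β * lower (fun ν => pd κ (pd γ (fun y => f.u y ν)) x) δ) := fun β γ δ => by
    rw [pd_const_mul _ (h1 β γ δ), pd_mul (hf.diff_lower_u hx β) (h0 γ δ),
      pd_lower (hf.diff_u hx), pd_lower (V := fun y ν => pd γ (fun z => f.u z ν) y)
        (hf.diff_pd_u hx γ)]
  have h3 : DifferentiableAt ℝ (fun y => ∑ β, ∑ γ, ∑ δ, epsUp α β γ δ *
      (lower (f.u y) β * lower (fun ν => pd γ (fun z => f.u z ν) y) δ)) x :=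
    DifferentiableAt.fun_sum fun β _ => DifferentiableAt.fun_sum fun γ _ =>
      DifferentiableAt.fun_sum fun δ _ => (h1 β γ δ).const_mul _
  rw [pd_congr ((hf.eventually_mem hx).mono fun y hy => hf.w_eq hy α), pd_neg, pd_mul hH h3,
    hf.pd_H hx, hf.w_eq hx,
    pd_sum fun β => DifferentiableAt.fun_sum fun γ _ =>
      DifferentiableAt.fun_sum fun δ _ => (h1 β γ δ).const_mul _]
  have h4 : ∀ β, pd κ (fun y => ∑ γ, ∑ δ, epsUp α β γ δ *
      (lower (f.u y) β * lower (fun ν => pd γ (fun z => f.u z ν) y) δ)) x =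
      ∑ γ, ∑ δ, pd κ (fun y => epsUp α β γ δ *
      (lower (f.u y) β * lower (fun ν => pd γ (fun z => f.u z ν) y) δ)) x := fun β => by
    rw [pd_sum fun γ => DifferentiableAt.fun_sum fun δ _ => (h1 β γ δ).const_mul _]
    exact Finset.sum_congr rfl fun γ _ => pd_sum (fun δ => (h1 β γ δ).const_mul _) κ
  simp only [h4, h2]
  ring

end Fluid.IsSolution

/-! ### The equations at a point of rest: first and second derivatives -/

namespace Fluid.IsSolution

variable {f : Fluid} {e : EquationOfState} {Ω : Set Spacetime} (hf : f.IsSolution e Ω)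
  {x : Spacetime} (hx : x ∈ Ω)

include hf hx

omit hf hx in
theorem S_apply (α : Fin 4) : f.S x α = eta α α * pd α f.s x := lower_eq _ α

theorem pd_S (κ α : Fin 4) : pd κ (fun y => f.S y α) x = eta α α * pd κ (pd α f.s) x := by
  have h : (fun y => f.S y α) = fun y => eta α α * pd α f.s y := funext fun y => lower_eq _ α
  rw [h, pd_const_mul _ (hf.diff_pd_s hx α)]

theorem pd_comm_h (κ l : Fin 4) : pd κ (pd l f.h) x = pd l (pd κ f.h) x :=
  pd_comm ((hf.contDiffAt_h hx).of_le (by norm_num)) κ l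

theorem pd_comm_s (κ l : Fin 4) : pd κ (pd l f.s) x = pd l (pd κ f.s) x :=
  pd_comm ((hf.contDiffAt_s hx).of_le (by norm_num)) κ l

theorem pd_comm_u (κ l α : Fin 4) :
    pd κ (pd l (fun y => f.u y α)) x = pd l (pd κ (fun y => f.u y α)) x :=
  pd_comm ((hf.contDiffAt_u hx α).of_le (by norm_num)) κ l

theorem pd_comm_w (κ l α : Fin 4) :
    pd κ (pd l (fun y => f.w e y α)) x = pd l (pd κ (fun y => f.w e y α)) x :=
  pd_comm (hf.contDiffAt_w hx α) κ l

variable (hu : f.u x = restVelocity)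

include hu

omit hf hx in
theorem rest_u : f.u x 0 = 1 ∧ f.u x 1 = 0 ∧ f.u x 2 = 0 ∧ f.u x 3 = 0 := by
  rw [hu]
  simp [restVelocity]

theorem rest_pd_u_zero (κ : Fin 4) : pd κ (fun y => f.u y 0) x = 0 := by
  have h := hf.lower_u_mul_pd_u hx κ
  obtain ⟨h0, h1, h2, h3⟩ := rest_u hu
  simp only [lower_eq, Fin.sum_univ_four, h0, h1, h2, h3, eta_zero_zero] at h
  linarith

theorem rest_pd_pd_u_zero (κ m : Fin 4) : pd κ (pd m (fun y => f.u y 0)) x =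
    pd κ (fun y => f.u y 1) x * pd m (fun y => f.u y 1) x +
    pd κ (fun y => f.u y 2) x * pd m (fun y => f.u y 2) x +
    pd κ (fun y => f.u y 3) x * pd m (fun y => f.u y 3) x := by
  have h := hf.pd_unit_pd hx κ m
  obtain ⟨h0, h1, h2, h3⟩ := rest_u hu
  simp only [lower_eq, Fin.sum_univ_four, h0, h1, h2, h3, eta_zero_zero, eta_one_one, eta_two_two,
    eta_three_three, hf.rest_pd_u_zero hx hu] at h
  linarith

theorem rest_pd_zero_s : pd 0 f.s x = 0 := by
  have h := hf.entropy x hx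
  obtain ⟨h0, h1, h2, h3⟩ := rest_u hu
  simp only [Fin.sum_univ_four, h0, h1, h2, h3] at h
  linarith

theorem rest_pd_zero_h : pd 0 f.h x = -(e.c (f.h x) (f.s x) ^ 2 *
    (pd 1 (fun y => f.u y 1) x + pd 2 (fun y => f.u y 2) x + pd 3 (fun y => f.u y 3) x)) := by
  have h := hf.enthalpy x hx
  obtain ⟨h0, h1, h2, h3⟩ := rest_u hu
  simp only [Fin.sum_univ_four, h0, h1, h2, h3, hf.rest_pd_u_zero hx hu] at h
  linarith

theorem rest_pd_zero_u {i : Fin 4} (hi : i ≠ 0) : pd 0 (fun y => f.u y i) x =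
    -pd i f.h x + e.q (f.h x) (f.s x) * pd i f.s x := by
  have h := hf.velocity x hx i
  obtain ⟨h0, h1, h2, h3⟩ := rest_u hu
  have hui : f.u x i = 0 := by
    fin_cases i
    · exact absurd rfl hi
    · exact h1
    · exact h2
    · exact h3
  have he : ∀ φ : Fin 4 → ℝ, ∑ κ, eta i κ * φ κ = φ i := fun φ => by
    refine (lower_eq φ i).trans ?_
    fin_cases i
    · exact absurd rfl hi
    all_goals simp [eta]
  simp only [hui, zero_mul, add_zero, he] at h
  simp only [Fin.sum_univ_four, h0, h1, h2, h3] at h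
  linarith

theorem rest_pd_pd_zero_s (κ : Fin 4) : pd κ (pd 0 f.s) x =
    -(pd κ (fun y => f.u y 1) x * pd 1 f.s x + pd κ (fun y => f.u y 2) x * pd 2 f.s x +
      pd κ (fun y => f.u y 3) x * pd 3 f.s x) := by
  have h := hf.pd_entropy hx κ
  obtain ⟨h0, h1, h2, h3⟩ := rest_u hu
  simp only [Fin.sum_univ_four, h0, h1, h2, h3, hf.rest_pd_u_zero hx hu] at h
  linarith

theorem rest_pd_pd_zero_h (κ : Fin 4) : pd κ (pd 0 f.h) x =
    -(pd κ (fun y => f.u y 1) x * pd 1 f.h x + pd κ (fun y => f.u y 2) x * pd 2 f.h x +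
      pd κ (fun y => f.u y 3) x * pd 3 f.h x) -
    2 * e.c (f.h x) (f.s x) * (ddh e.c (f.h x) (f.s x) * pd κ f.h x +
        dds e.c (f.h x) (f.s x) * pd κ f.s x) *
      (pd 1 (fun y => f.u y 1) x + pd 2 (fun y => f.u y 2) x + pd 3 (fun y => f.u y 3) x) -
    e.c (f.h x) (f.s x) ^ 2 * (pd κ (pd 0 (fun y => f.u y 0)) x +
      pd κ (pd 1 (fun y => f.u y 1)) x + pd κ (pd 2 (fun y => f.u y 2)) x +
      pd κ (pd 3 (fun y => f.u y 3)) x) := by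
  have h := hf.pd_enthalpy hx κ
  obtain ⟨h0, h1, h2, h3⟩ := rest_u hu
  simp only [Fin.sum_univ_four, h0, h1, h2, h3, hf.rest_pd_u_zero hx hu] at h
  linarith

theorem rest_pd_pd_zero_u (κ : Fin 4) {i : Fin 4} (hi : i ≠ 0) :
    pd κ (pd 0 (fun y => f.u y i)) x =
    -(pd κ (fun y => f.u y 1) x * pd 1 (fun y => f.u y i) x +
      pd κ (fun y => f.u y 2) x * pd 2 (fun y => f.u y i) x +
      pd κ (fun y => f.u y 3) x * pd 3 (fun y => f.u y i) x) -
    pd κ (fun y => f.u y i) x * pd 0 f.h x - pd κ (pd i f.h) x +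
    (ddh e.q (f.h x) (f.s x) * pd κ f.h x + dds e.q (f.h x) (f.s x) * pd κ f.s x) * pd i f.s x +
    e.q (f.h x) (f.s x) * pd κ (pd i f.s) x := by
  have h := hf.pd_velocity hx κ i
  obtain ⟨h0, h1, h2, h3⟩ := rest_u hu
  have hui : f.u x i = 0 := by
    fin_cases i
    · exact absurd rfl hi
    · exact h1
    · exact h2
    · exact h3
  have he : ∀ φ : Fin 4 → ℝ, ∑ κ, eta i κ * φ κ = φ i := fun φ => by
    refine (lower_eq φ i).trans ?_
    fin_cases i
    · exact absurd rfl hi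
    all_goals simp [eta]
  simp only [hui, zero_mul, add_zero, Finset.sum_add_distrib, he] at h
  simp only [Fin.sum_univ_four, h0, h1, h2, h3, hf.rest_pd_u_zero hx hu] at h
  linarith

/-- The wave operator at a point of rest. -/
theorem rest_boxg {φ : Spacetime → ℝ} (hφ : ContDiffAt ℝ 2 φ x) :
    f.boxg e φ x = -pd 0 (pd 0 φ) x + e.c (f.h x) (f.s x) ^ 2 *
        (pd 1 (pd 1 φ) x + pd 2 (pd 2 φ) x + pd 3 (pd 3 φ) x) +
      (e.c (f.h x) (f.s x) ^ 2 - 1) * (pd 1 (fun y => f.u y 1) x + pd 2 (fun y => f.u y 2) x +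
        pd 3 (fun y => f.u y 3) x) * pd 0 φ x +
      (e.c (f.h x) (f.s x) ^ 2 - 1) * (pd 0 (fun y => f.u y 1) x * pd 1 φ x +
        pd 0 (fun y => f.u y 2) x * pd 2 φ x + pd 0 (fun y => f.u y 3) x * pd 3 φ x) +
      3 * (e.c (f.h x) (f.s x))⁻¹ * pd 0 (fun y => e.c (f.h y) (f.s y)) x * pd 0 φ x -
      e.c (f.h x) (f.s x) * (pd 1 (fun y => e.c (f.h y) (f.s y)) x * pd 1 φ x +
        pd 2 (fun y => e.c (f.h y) (f.s y)) x * pd 2 φ x +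
        pd 3 (fun y => e.c (f.h y) (f.s y)) x * pd 3 φ x) := by
  have hc := hf.c_ne_zero hx
  have h1 : ∀ α β, pd α (fun y => f.gInv e y α β) x =
      2 * e.c (f.h x) (f.s x) * pd α (fun y => e.c (f.h y) (f.s y)) x *
        (eta α β + f.u x α * f.u x β) + (e.c (f.h x) (f.s x) ^ 2 - 1) *
        (pd α (fun y => f.u y α) x * f.u x β + f.u x α * pd α (fun y => f.u y β) x) := by
    intro α β
    have hc2 : DifferentiableAt ℝ (fun y => e.c (f.h y) (f.s y) ^ 2) x := (hf.diff_c hx).pow 2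
    have hc3 : DifferentiableAt ℝ (fun y => e.c (f.h y) (f.s y) ^ 2 - 1) x := hc2.sub_const 1
    change pd α (fun y => e.c (f.h y) (f.s y) ^ 2 * eta α β +
      (e.c (f.h y) (f.s y) ^ 2 - 1) * f.u y α * f.u y β) x = _
    rw [pd_add (hc2.mul_const _) ((hc3.fun_mul (hf.diff_u hx α)).fun_mul (hf.diff_u hx β)),
      pd_mul hc2 (differentiableAt_const _), pd_const,
      pd_mul (hc3.fun_mul (hf.diff_u hx α)) (hf.diff_u hx β), pd_mul hc3 (hf.diff_u hx α),
      pd_sub hc2 (differentiableAt_const 1), pd_const, pd_pow (hf.diff_c hx)]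
    norm_num
    ring
  have h2 : ∀ α, pd α (fun y => ∑ β, f.gInv e y α β * pd β φ y) x =
      ∑ β, (pd α (fun y => f.gInv e y α β) x * pd β φ x +
        f.gInv e x α β * pd α (pd β φ) x) := fun α =>
    pd_sum_mul (fun β => (hf.contDiffAt_gInv hx α β).differentiableAt (by norm_num))
      (fun β => (contDiffAt_pd (m := 1) hφ (by norm_num) β).differentiableAt (by norm_num)) α
  obtain ⟨u0, u1, u2, u3⟩ := rest_u hu
  rw [hf.boxg_eq_div hx hφ]
  simp only [h2, h1]
  simp [Fluid.gInv, acousticalMetricInv, Fin.sum_univ_four, u0, u1, u2, u3, eta,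
    hf.rest_pd_u_zero hx hu]
  field_simp
  ring

end Fluid.IsSolution

set_option linter.unusedSimpArgs false

/-! ### The second order equations at a point of rest -/

theorem sum_eta (α : Fin 4) (V : Fin 4 → ℝ) : ∑ β, eta α β * V β = eta α α * V α := lower_eq V α

theorem gDot_rest (e : EquationOfState) {h s : ℝ} {u S w : Fin 4 → ℝ} (hu : u = restVelocity)
    (ξ ζ : Fin 4 → ℝ) : gDot e ⟨h, s, u, S, w⟩ ξ ζ =
      -(ξ 0 * ζ 0) + e.c h s ^ 2 * (ξ 1 * ζ 1 + ξ 2 * ζ 2 + ξ 3 * ζ 3) := by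
  simp [gDot, acousticalMetricInv, hu, restVelocity, eta, Fin.sum_univ_four]
  ring

namespace Fluid.IsSolution

variable {f : Fluid} {e : EquationOfState} {Ω : Set Spacetime} (hf : f.IsSolution e Ω)
  {x : Spacetime} (hx : x ∈ Ω) (hu : f.u x = restVelocity)

include hf hx hu

theorem rest_waveS : f.boxg e f.s x = f.eval e (rhsWaveS e) x := by
  have hc := hf.c_ne_zero hx
  have hn := (e.n_pos (hf.mem_dom x hx)).ne'
  rw [hf.rest_boxg hx hu ((hf.contDiffAt_s hx).of_le (by norm_num))]
  simp only [Fluid.eval, rhsWaveS, Ls, Fluid.D, modD, Fluid.state, Fluid.grad, Fin.sum_univ_four,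
    hf.pd_S hx, lower_eq]
  simp only [S_apply, eta_zero_zero, eta_one_one, eta_two_two, eta_three_three,
    hf.pd_c hx, hf.rest_pd_zero_s hx hu, hf.rest_pd_pd_zero_s hx hu, hf.rest_pd_zero_h hx hu,
    hf.rest_pd_zero_u hx hu (i := 1) (by decide), hf.rest_pd_zero_u hx hu (i := 2) (by decide),
    hf.rest_pd_zero_u hx hu (i := 3) (by decide)]
  field_simp
  ring

theorem rest_waveH : f.boxg e f.h x = f.eval e (rhsWaveH e) x := by
  have hc := hf.c_ne_zero hx
  have hz := hf.mem_dom x hx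
  have hn := (e.n_pos hz).ne'
  rw [hf.rest_boxg hx hu ((hf.contDiffAt_h hx).of_le (by norm_num))]
  simp only [Fluid.eval, rhsWaveH, Lh, Qh, Fluid.D, modD, Fluid.state, Fluid.grad,
    gDot_rest e hu, Fin.sum_univ_four, hf.pd_S hx, lower_eq]
  simp only [S_apply, eta_zero_zero, eta_one_one, eta_two_two, eta_three_three,
    hf.pd_c hx, hf.rest_pd_pd_zero_h hx hu, hf.rest_pd_pd_zero_s hx hu,
    hf.rest_pd_pd_u_zero hx hu, hf.rest_pd_u_zero hx hu,
    hf.pd_comm_u hx 0 1, hf.pd_comm_u hx 0 2, hf.pd_comm_u hx 0 3,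
    hf.rest_pd_pd_zero_u hx hu 1 (i := 1) (by decide),
    hf.rest_pd_pd_zero_u hx hu 2 (i := 2) (by decide),
    hf.rest_pd_pd_zero_u hx hu 3 (i := 3) (by decide)]
  simp only [hf.rest_pd_zero_s hx hu, hf.rest_pd_zero_h hx hu,
    hf.rest_pd_zero_u hx hu (i := 1) (by decide), hf.rest_pd_zero_u hx hu (i := 2) (by decide),
    hf.rest_pd_zero_u hx hu (i := 3) (by decide)]
  field_simp
  ring

/-- The vorticity of a fluid at rest is `H` times the spatial curl of the velocity. -/
theorem rest_w : f.w e x 0 = 0 ∧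
    f.w e x 1 = e.H (f.h x) * (pd 2 (fun y => f.u y 3) x - pd 3 (fun y => f.u y 2) x) ∧
    f.w e x 2 = e.H (f.h x) * (pd 3 (fun y => f.u y 1) x - pd 1 (fun y => f.u y 3) x) ∧
    f.w e x 3 = e.H (f.h x) * (pd 1 (fun y => f.u y 2) x - pd 2 (fun y => f.u y 1) x) := by
  obtain ⟨u0, u1, u2, u3⟩ := rest_u hu
  simp only [hf.w_eq hx, sum_epsUp, lower_eq, u0, u1, u2, u3, eta_zero_zero, eta_one_one,
    eta_two_two, eta_three_three]
  refine ⟨?_, ?_, ?_, ?_⟩ <;> simp <;> ring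

/-- The derivatives of `ϖ` at a point of rest. Besides the derivatives of the curl there are
products of derivatives of `u`, because the fluid is at rest at one point only. -/
theorem rest_pd_w (κ : Fin 4) :
    pd κ (fun y => f.w e y 0) x = pd κ (fun y => f.u y 1) x * f.w e x 1 +
      pd κ (fun y => f.u y 2) x * f.w e x 2 + pd κ (fun y => f.u y 3) x * f.w e x 3 ∧
    pd κ (fun y => f.w e y 1) x = pd κ f.h x * f.w e x 1 + e.H (f.h x) *
      (pd κ (pd 2 (fun y => f.u y 3)) x - pd κ (pd 3 (fun y => f.u y 2)) x +
        pd κ (fun y => f.u y 2) x * pd 0 (fun y => f.u y 3) x -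
        pd κ (fun y => f.u y 3) x * pd 0 (fun y => f.u y 2) x) ∧
    pd κ (fun y => f.w e y 2) x = pd κ f.h x * f.w e x 2 + e.H (f.h x) *
      (pd κ (pd 3 (fun y => f.u y 1)) x - pd κ (pd 1 (fun y => f.u y 3)) x +
        pd κ (fun y => f.u y 3) x * pd 0 (fun y => f.u y 1) x -
        pd κ (fun y => f.u y 1) x * pd 0 (fun y => f.u y 3) x) ∧
    pd κ (fun y => f.w e y 3) x = pd κ f.h x * f.w e x 3 + e.H (f.h x) *
      (pd κ (pd 1 (fun y => f.u y 2)) x - pd κ (pd 2 (fun y => f.u y 1)) x +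
        pd κ (fun y => f.u y 1) x * pd 0 (fun y => f.u y 2) x -
        pd κ (fun y => f.u y 2) x * pd 0 (fun y => f.u y 1) x) := by
  obtain ⟨u0, u1, u2, u3⟩ := rest_u hu
  obtain ⟨w0, w1, w2, w3⟩ := hf.rest_w hx hu
  simp only [hf.pd_w hx, sum_epsUp, lower_eq, u0, u1, u2, u3, w0, w1, w2, w3, eta_zero_zero,
    eta_one_one, eta_two_two, eta_three_three, hf.rest_pd_u_zero hx hu]
  refine ⟨?_, ?_, ?_, ?_⟩ <;> simp <;> ring

theorem rest_waveU (α : Fin 4) :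
    f.boxg e (fun y => f.u y α) x = f.eval e (rhsWaveU e α) x := by
  have hc := hf.c_ne_zero hx
  have hz := hf.mem_dom x hx
  have hn := (e.n_pos hz).ne'
  have hH := (e.H_pos (f.h x)).ne'
  -- `θ` and `θ_{;h}` are eliminated in favour of `q` and `q_{;h}`
  have hq : e.θ (f.h x) (f.s x) = e.q (f.h x) (f.s x) * e.H (f.h x) := by
    rw [EquationOfState.q, div_mul_cancel₀ _ hH]
  have hqh : ddh e.θ (f.h x) (f.s x) = e.H (f.h x) * (ddh e.q (f.h x) (f.s x) +
      e.q (f.h x) (f.s x)) := by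
    rw [e.ddh_q hz, hq]
    field_simp
    ring
  obtain ⟨u0, u1, u2, u3⟩ := rest_u hu
  obtain ⟨w0, w1, w2, w3⟩ := hf.rest_w hx hu
  rw [hf.rest_boxg hx hu ((hf.contDiffAt_u hx α).of_le (by norm_num))]
  simp only [Fluid.eval, rhsWaveU, Lu, Qu, Fluid.C, modC, vortAt, Fluid.state, Fluid.grad,
    gDot_rest e hu, mul_assoc, sum_epsUp, sum_eta]
  simp only [Fin.sum_univ_four, lower_eq, S_apply, eta_zero_zero, eta_one_one, eta_two_two,
    eta_three_three, u0, u1, u2, u3, w0, w1, w2, w3, hf.rest_pd_w hx hu, hq, hqh, hf.pd_c hx,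
    hf.pd_comm_u hx 0 1, hf.pd_comm_u hx 0 2, hf.pd_comm_u hx 0 3,
    hf.pd_comm_u hx 2 1, hf.pd_comm_u hx 3 1, hf.pd_comm_u hx 3 2]
  fin_cases α
  all_goals
    simp [eta_zero_zero, eta_one_one, eta_two_two, eta_three_three, u0, u1, u2, u3, w0, w1, w2, w3]
    simp [hf.rest_pd_pd_zero_u hx hu _ (i := 1) (by decide),
      hf.rest_pd_pd_zero_u hx hu _ (i := 2) (by decide),
      hf.rest_pd_pd_zero_u hx hu _ (i := 3) (by decide), hf.rest_pd_u_zero hx hu]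
    -- mixed derivatives are brought into the form `∂_i ∂_0`, to which the eliminations apply
    simp only [hf.pd_comm_h hx 0 1, hf.pd_comm_h hx 0 2, hf.pd_comm_h hx 0 3, hf.pd_comm_s hx 0 1,
      hf.pd_comm_s hx 0 2, hf.pd_comm_s hx 0 3, hf.rest_pd_pd_zero_h hx hu,
      hf.rest_pd_pd_zero_s hx hu, hf.pd_comm_u hx 2 1, hf.pd_comm_u hx 3 1, hf.pd_comm_u hx 3 2,
      hf.rest_pd_pd_u_zero hx hu]
    simp only [hf.rest_pd_zero_s hx hu, hf.rest_pd_zero_h hx hu,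
      hf.rest_pd_zero_u hx hu (i := 1) (by decide), hf.rest_pd_zero_u hx hu (i := 2) (by decide),
      hf.rest_pd_zero_u hx hu (i := 3) (by decide)]
    field_simp
    ring

end Fluid.IsSolution

/-! ### Transport and divergence equations at a point of rest -/

namespace Fluid.IsSolution

variable {f : Fluid} {e : EquationOfState} {Ω : Set Spacetime} (hf : f.IsSolution e Ω)
  {x : Spacetime} (hx : x ∈ Ω)

include hf hx

/-- `vort(S) = 0` since `ε^{αβγδ}` is contracted with the symmetric `∂_γ ∂_δ s`. -/
theorem vort_S (α : Fin 4) : vort f.u f.SForm x α = 0 := by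
  have h : ∀ γ δ, pd γ (fun y => f.SForm y δ) x = pd γ (pd δ f.s) x := fun γ δ => rfl
  simp only [vort, vortAt, h, mul_assoc]
  rw [sum_epsUp (fun β γ δ => lower (f.u x) β * pd γ (pd δ f.s) x)]
  fin_cases α <;>
  · simp [hf.pd_comm_s hx 1 0, hf.pd_comm_s hx 2 0, hf.pd_comm_s hx 3 0, hf.pd_comm_s hx 2 1,
      hf.pd_comm_s hx 3 1, hf.pd_comm_s hx 3 2]
    ring

variable (hu : f.u x = restVelocity)

include hu

theorem rest_divW : (∑ α, pd α (fun y => f.w e y α) x) = f.eval e (rhsDivW e) x := by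
  obtain ⟨w0, w1, w2, w3⟩ := hf.rest_w hx hu
  simp only [Fluid.eval, rhsDivW, Fluid.state, Fluid.grad, Fin.sum_univ_four]
  simp only [hf.rest_pd_w hx hu, w0, w1, w2, w3, lower_eq, S_apply, eta_zero_zero, eta_one_one,
    eta_two_two, eta_three_three, hf.pd_comm_u hx 2 1, hf.pd_comm_u hx 3 1, hf.pd_comm_u hx 3 2]
  simp only [hf.rest_pd_zero_u hx hu (i := 1) (by decide),
    hf.rest_pd_zero_u hx hu (i := 2) (by decide), hf.rest_pd_zero_u hx hu (i := 3) (by decide)]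
  ring

theorem rest_transportS (α : Fin 4) :
    f.transport (fun y => f.S y α) x = f.eval e (rhsTransportS α) x := by
  obtain ⟨u0, u1, u2, u3⟩ := rest_u hu
  simp only [Fluid.transport, Fluid.eval, rhsTransportS, Fluid.state, Fluid.grad, sum_eta]
  simp only [Fin.sum_univ_four, hf.pd_S hx, u0, u1, u2, u3, lower_eq]
  rw [hf.pd_comm_s hx 0 α, hf.rest_pd_pd_zero_s hx hu]
  simp only [S_apply, hf.rest_pd_zero_s hx hu, eta_zero_zero, eta_one_one, eta_two_two,
    eta_three_three]
  ring

theorem rest_transportW (α : Fin 4) :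
    f.transport (fun y => f.w e y α) x = f.eval e (rhsTransportW e α) x := by
  have hH := (e.H_pos (f.h x)).ne'
  obtain ⟨u0, u1, u2, u3⟩ := rest_u hu
  obtain ⟨w0, w1, w2, w3⟩ := hf.rest_w hx hu
  obtain ⟨p0, p1, p2, p3⟩ := hf.rest_pd_w hx hu 0
  have hz := hf.mem_dom x hx
  simp only [Fluid.transport, Fluid.eval, rhsTransportW, Fluid.state, Fluid.grad, mul_assoc,
    sum_epsUp]
  simp only [Fin.sum_univ_four, u0, u1, u2, u3, w0, w1, w2, w3, lower_eq, S_apply]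
  have s1 := hf.rest_pd_zero_s hx hu
  have s2 := hf.rest_pd_zero_h hx hu
  have s3 := hf.rest_pd_zero_u hx hu (i := 1) (by decide)
  have s4 := hf.rest_pd_zero_u hx hu (i := 2) (by decide)
  have s5 := hf.rest_pd_zero_u hx hu (i := 3) (by decide)
  fin_cases α
  · simp [p0, w0, w1, w2, w3, s1, s2, s3, s4, s5, u0, hf.rest_pd_u_zero hx hu, eta_one_one,
      eta_two_two, eta_three_three]
    ring
  all_goals
    simp [u0, u1, u2, u3, p0, p1, p2, p3, w0, w1, w2, w3, hf.pd_comm_u hx 0 1, hf.pd_comm_u hx 0 2,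
      hf.pd_comm_u hx 0 3, hf.rest_pd_u_zero hx hu, eta_zero_zero, eta_one_one, eta_two_two,
      eta_three_three]
    simp [hf.rest_pd_pd_zero_u hx hu _ (i := 1) (by decide),
      hf.rest_pd_pd_zero_u hx hu _ (i := 2) (by decide),
      hf.rest_pd_pd_zero_u hx hu _ (i := 3) (by decide), hf.pd_comm_h hx 2 1,
      hf.pd_comm_h hx 3 1, hf.pd_comm_h hx 3 2, hf.pd_comm_s hx 2 1,
      hf.pd_comm_s hx 3 1, hf.pd_comm_s hx 3 2]
    simp only [s1, s2, s3, s4, s5, EquationOfState.q, e.ddh_q hz, e.dds_q hz]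
    field_simp
    ring

end Fluid.IsSolution

/-! ### The wave and transport equations in general position -/

namespace Fluid.IsSolution

variable {f : Fluid} {e : EquationOfState} {Ω : Set Spacetime} (hf : f.IsSolution e Ω)
  {x : Spacetime} (hx : x ∈ Ω)

include hf hx

theorem transport_S (α : Fin 4) :
    f.transport (fun y => f.S y α) x = f.eval e (rhsTransportS α) x := by
  refine congrFun (eq_of_restFrame (e := e)
    (A := fun f x α => f.transport (fun y => f.S y α) x)
    (B := fun f x α => f.eval e (rhsTransportS α) x) ?_ ?_ ?_ hf hx) α
  · intro f Ω hf M x₀ y hM hy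
    exact hf.isVec_transport hM (hf.diff_S hy.1) ((hf.transform hM).diff_S hy) hy
      fun z hz => hf.isVec_S hM hz.1
  · intro f Ω hf M x₀ y hM hy
    have h := (hf.isRelated hM hy).rhsTransportS hM (C' := (f.transform x₀ M).C e y)
      (C := f.C e (chart x₀ M y)) (f.D e (chart x₀ M y))
    rwa [← hf.D_transform hM hy] at h
  · exact fun hf _ hx hu => funext fun α => hf.rest_transportS hx hu α

theorem transport_w (α : Fin 4) :
    f.transport (fun y => f.w e y α) x = f.eval e (rhsTransportW e α) x := by
  refine congrFun (eq_of_restFrame (e := e)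
    (A := fun f x α => f.transport (fun y => f.w e y α) x)
    (B := fun f x α => f.eval e (rhsTransportW e α) x) ?_ ?_ ?_ hf hx) α
  · intro f Ω hf M x₀ y hM hy
    exact hf.isVec_transport hM (hf.diff_w hy.1) ((hf.transform hM).diff_w hy) hy
      fun z hz => hf.isVec_w hM hz.1
  · intro f Ω hf M x₀ y hM hy
    exact (hf.isRelated hM hy).rhsTransportW hM e (C' := (f.transform x₀ M).C e y)
      (C := f.C e (chart x₀ M y)) (f.D e (chart x₀ M y))
  · exact fun hf _ hx hu => funext fun α => hf.rest_transportW hx hu α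

theorem div_w : (∑ α, pd α (fun y => f.w e y α) x) = f.eval e (rhsDivW e) x := by
  refine eq_of_restFrame_scalar (e := e)
    (A := fun f x => ∑ α, pd α (fun y => f.w e y α) x)
    (B := fun f x => f.eval e (rhsDivW e) x) ?_ ?_ ?_ hf hx
  · intro f Ω hf M x₀ y hM hy
    exact hM.trace (hf.isRelated hM hy).grad_w
  · intro f Ω hf M x₀ y hM hy
    exact (hf.isRelated hM hy).rhsDivW hM e (C' := (f.transform x₀ M).C e y)
      (C := f.C e (chart x₀ M y)) (f.D e (chart x₀ M y))
  · exact fun hf _ hx hu => hf.rest_divW hx hu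

theorem wave_h : f.boxg e f.h x = f.eval e (rhsWaveH e) x := by
  refine eq_of_restFrame_scalar (e := e) (A := fun f x => f.boxg e f.h x)
    (B := fun f x => f.eval e (rhsWaveH e) x) ?_ ?_ ?_ hf hx
  · intro f Ω hf M x₀ y hM hy
    exact hf.boxg_transform hM hy (fun z hz => (hf.contDiffAt_h hz).of_le (by norm_num))
      fun z _ => rfl
  · intro f Ω hf M x₀ y hM hy
    have h := (hf.isRelated hM hy).rhsWaveH hM e (C' := (f.transform x₀ M).C e y)
      (C := f.C e (chart x₀ M y)) (f.D e (chart x₀ M y))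
    rw [← hf.D_transform hM hy] at h
    exact h.trans (by rw [hf.D_transform hM hy]; rfl)
  · exact fun hf _ hx hu => hf.rest_waveH hx hu

theorem wave_s : f.boxg e f.s x = f.eval e (rhsWaveS e) x := by
  refine eq_of_restFrame_scalar (e := e) (A := fun f x => f.boxg e f.s x)
    (B := fun f x => f.eval e (rhsWaveS e) x) ?_ ?_ ?_ hf hx
  · intro f Ω hf M x₀ y hM hy
    exact hf.boxg_transform hM hy (fun z hz => (hf.contDiffAt_s hz).of_le (by norm_num))
      fun z _ => rfl
  · intro f Ω hf M x₀ y hM hy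
    have h := (hf.isRelated hM hy).rhsWaveS hM e (C' := (f.transform x₀ M).C e y)
      (C := f.C e (chart x₀ M y)) (f.D e (chart x₀ M y))
    rw [← hf.D_transform hM hy] at h
    exact h.trans (by rw [hf.D_transform hM hy]; rfl)
  · exact fun hf _ hx hu => hf.rest_waveS hx hu

/-- The wave operator is linear over the constants. -/
theorem boxg_sum {ι : Type*} [Fintype ι] (a : ι → ℝ) {φ : ι → Spacetime → ℝ}
    (hφ : ∀ i, ∀ z ∈ Ω, ContDiffAt ℝ 2 (φ i) z) :
    f.boxg e (fun y => ∑ i, a i * φ i y) x = ∑ i, a i * f.boxg e (φ i) x := by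
  have h1 : ∀ {F : ι → Spacetime → ℝ} {z : Spacetime} (β : Fin 4),
      (∀ i, DifferentiableAt ℝ (F i) z) →
      pd β (fun y => ∑ i, a i * F i y) z = ∑ i, a i * pd β (F i) z := fun β hF => by
    rw [pd_sum fun i => (hF i).const_mul _]
    exact Finset.sum_congr rfl fun i _ => pd_const_mul _ (hF i) β
  have hd : ∀ z ∈ Ω, ∀ i, DifferentiableAt ℝ (φ i) z := fun z hz i =>
    (hφ i z hz).differentiableAt (by norm_num)
  have h2 : ∀ y ∈ Ω, ∀ α, ∑ β, f.gInv e y α β * pd β (fun y => ∑ i, a i * φ i y) y =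
      ∑ i, a i * ∑ β, f.gInv e y α β * pd β (φ i) y := fun y hy α => by
    simp only [h1 _ (hd y hy), Finset.mul_sum]
    rw [Finset.sum_comm]
    exact Finset.sum_congr rfl fun _ _ => Finset.sum_congr rfl fun _ _ => by ring
  have h3 : ∀ α, pd α (fun y => ∑ β, f.gInv e y α β * pd β (fun y => ∑ i, a i * φ i y) y) x =
      ∑ i, a i * pd α (fun y => ∑ β, f.gInv e y α β * pd β (φ i) y) x := fun α => by
    rw [pd_congr ((hf.eventually_mem hx).mono fun y hy => h2 y hy α)]
    exact h1 α fun i => (hf.contDiffAt_gInv_pd hx (hφ i x hx) α).differentiableAt (by norm_num)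
  rw [hf.boxg_eq_div hx (ContDiffAt.sum fun i _ => contDiffAt_const.mul (hφ i x hx))]
  simp only [h3, h2 x hx, fun i => hf.boxg_eq_div hx (hφ i x hx), mul_sub, Finset.sum_sub_distrib,
    Finset.mul_sum, Finset.sum_mul]
  congr 1
  · exact Finset.sum_comm
  · rw [Finset.sum_comm' (t' := Finset.univ) (s' := fun _ => Finset.univ) (by simp)]
    exact Finset.sum_congr rfl fun _ _ => Finset.sum_congr rfl fun _ _ =>
      Finset.sum_congr rfl fun _ _ => by ring

/-- Each component `u^α` is a scalar in the definition of `□_g u^α`; the four of them transform as a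
vector because the wave operator is linear. -/
theorem wave_u (α : Fin 4) : f.boxg e (fun y => f.u y α) x = f.eval e (rhsWaveU e α) x := by
  refine congrFun (eq_of_restFrame (e := e)
    (A := fun f x α => f.boxg e (fun y => f.u y α) x)
    (B := fun f x α => f.eval e (rhsWaveU e α) x) ?_ ?_ ?_ hf hx) α
  · intro f Ω hf M x₀ y hM hy α
    have hu : ∀ {z : Spacetime}, z ∈ Ω → ∀ i, ContDiffAt ℝ 2 (fun y => f.u y i) z := fun hz i =>
      (hf.contDiffAt_u hz i).of_le (by norm_num)
    have h := hf.boxg_transform hM hy (φ := fun z => f.u z α) (fun z hz => hu hz α)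
      (φ' := fun z => ∑ β, M α β * (f.transform x₀ M).u z β) fun z _ => (isVec_u hM α).symm
    rw [(hf.transform hM).boxg_sum hy (M α) fun i z hz =>
      ((hf.transform hM).contDiffAt_u hz i).of_le (by norm_num)] at h
    exact h.symm
  · intro f Ω hf M x₀ y hM hy
    have h := (hf.isRelated hM hy).rhsWaveU hM e (f.D e (chart x₀ M y)) (hf.isVec_C hM hy)
    rwa [← hf.D_transform hM hy] at h
  · exact fun hf _ hx hu => funext fun α => hf.rest_waveU hx hu α

end Fluid.IsSolution

/-! ### First derivatives of the modified variables -/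

theorem pd_sum_epsUp {F : Fin 4 → Fin 4 → Fin 4 → Spacetime → ℝ} {x : Spacetime}
    (hF : ∀ β γ δ, DifferentiableAt ℝ (F β γ δ) x) (κ α : Fin 4) :
    pd κ (fun y => ∑ β, ∑ γ, ∑ δ, epsUp α β γ δ * F β γ δ y) x =
      ∑ β, ∑ γ, ∑ δ, epsUp α β γ δ * pd κ (F β γ δ) x := by
  have h : ∀ β γ δ, DifferentiableAt ℝ (fun y => epsUp α β γ δ * F β γ δ y) x := fun β γ δ =>
    (hF β γ δ).const_mul _
  have h1 : ∀ β γ, DifferentiableAt ℝ (fun y => ∑ δ, epsUp α β γ δ * F β γ δ y) x := fun β γ =>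
    DifferentiableAt.fun_sum fun δ _ => h β γ δ
  rw [pd_sum fun β => DifferentiableAt.fun_sum fun γ _ => h1 β γ]
  refine Finset.sum_congr rfl fun β _ => ?_
  rw [pd_sum fun γ => h1 β γ]
  refine Finset.sum_congr rfl fun γ _ => ?_
  rw [pd_sum fun δ => h β γ δ]
  exact Finset.sum_congr rfl fun δ _ => pd_const_mul _ (hF β γ δ) κ

theorem differentiableAt_sum_epsUp {F : Fin 4 → Fin 4 → Fin 4 → Spacetime → ℝ} {x : Spacetime}
    (hF : ∀ β γ δ, DifferentiableAt ℝ (F β γ δ) x) (α : Fin 4) :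
    DifferentiableAt ℝ (fun y => ∑ β, ∑ γ, ∑ δ, epsUp α β γ δ * F β γ δ y) x :=
  DifferentiableAt.fun_sum fun β _ => DifferentiableAt.fun_sum fun γ _ =>
    DifferentiableAt.fun_sum fun δ _ => (hF β γ δ).const_mul _

namespace Fluid.IsSolution

variable {f : Fluid} {e : EquationOfState} {Ω : Set Spacetime} (hf : f.IsSolution e Ω)
  {x : Spacetime} (hx : x ∈ Ω)

/-- `𝒞^α` with the sums ordered so that the product rule and `sum_epsUp` apply. -/
theorem C_eq (y : Spacetime) (α : Fin 4) : f.C e y α =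
    -(∑ β, ∑ γ, ∑ δ, epsUp α β γ δ *
      (lower (f.u y) β * lower (fun ν => pd γ (fun z => f.w e z ν) y) δ)) +
    (e.c (f.h y) (f.s y) ^ 2)⁻¹ * (∑ β, ∑ γ, ∑ δ, epsUp α β γ δ *
      (lower (f.u y) β * (pd γ f.h y * lower (f.w e y) δ))) +
    (e.θ (f.h y) (f.s y) - ddh e.θ (f.h y) (f.s y)) *
      (f.S y α * (∑ l, pd l (fun z => f.u z l) y) + f.u y α * (∑ l, f.S y l * pd l f.h y) -
        eta α α * ∑ l, f.S y l * lower (fun ν => pd α (fun z => f.u z ν) y) l) := by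
  have h : ∑ k, f.S y k * ∑ l, eta α l * lower (fun ν => pd l (fun z => f.u z ν) y) k =
      eta α α * ∑ l, f.S y l * lower (fun ν => pd α (fun z => f.u z ν) y) l := by
    rw [Finset.mul_sum]
    refine Finset.sum_congr rfl fun k _ => ?_
    rw [sum_eta α fun l => lower (fun ν => pd l (fun z => f.u z ν) y) k]
    ring
  simp only [Fluid.C, modC, vortAt, Fluid.state, Fluid.grad, h, mul_assoc]
  ring

theorem D_eq (y : Spacetime) : f.D e y =
    (e.n (f.h y) (f.s y))⁻¹ * ((∑ l, pd l (fun z => f.S z l) y) +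
    (1 - (e.c (f.h y) (f.s y) ^ 2)⁻¹) * ∑ l, f.S y l * pd l f.h y) := by
  simp only [Fluid.D, modD, Fluid.state, Fluid.grad]
  ring

include hf hx

theorem diff_temp :
    DifferentiableAt ℝ (fun y => e.θ (f.h y) (f.s y) - ddh e.θ (f.h y) (f.s y)) x :=
  ((hf.contDiffAt_θ hx).differentiableAt (by norm_num)).fun_sub
    ((hf.contDiffAt_ddh_θ hx).differentiableAt (by norm_num))

theorem pd_temp (κ : Fin 4) :
    pd κ (fun y => e.θ (f.h y) (f.s y) - ddh e.θ (f.h y) (f.s y)) x =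
      (ddh e.θ (f.h x) (f.s x) - ddh (ddh e.θ) (f.h x) (f.s x)) * pd κ f.h x +
      (dds e.θ (f.h x) (f.s x) - dds (ddh e.θ) (f.h x) (f.s x)) * pd κ f.s x := by
  have hz := hf.mem_dom x hx
  rw [pd_sub ((hf.contDiffAt_θ hx).differentiableAt (by norm_num))
    ((hf.contDiffAt_ddh_θ hx).differentiableAt (by norm_num)),
    hf.pd_eos hx (e.contDiffAt_θ hz), hf.pd_eos hx (contDiffAt_ddh (e.contDiffAt_θ hz))]
  ring

theorem diff_inv_c_sq : DifferentiableAt ℝ (fun y => (e.c (f.h y) (f.s y) ^ 2)⁻¹) x :=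
  (hf.contDiffAt_inv_c_sq hx).differentiableAt (by norm_num)

theorem pd_inv_c_sq (κ : Fin 4) : pd κ (fun y => (e.c (f.h y) (f.s y) ^ 2)⁻¹) x =
    -(2 * (e.c (f.h x) (f.s x) ^ 3)⁻¹ * (ddh e.c (f.h x) (f.s x) * pd κ f.h x +
      dds e.c (f.h x) (f.s x) * pd κ f.s x)) := by
  have hc := hf.c_ne_zero hx
  rw [pd_inv (f := fun y => e.c (f.h y) (f.s y) ^ 2) ((hf.diff_c hx).pow 2) (pow_ne_zero 2 hc),
    hf.pd_c_sq hx]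
  field_simp

/-- The derivatives of `n` are eliminated by `EquationOfState.ddh_n` and the Maxwell relation. -/
theorem pd_inv_n (κ : Fin 4) : pd κ (fun y => (e.n (f.h y) (f.s y))⁻¹) x =
    (e.n (f.h x) (f.s x))⁻¹ * (-((e.c (f.h x) (f.s x) ^ 2)⁻¹ * pd κ f.h x) +
      (e.θ (f.h x) (f.s x) * (e.c (f.h x) (f.s x) ^ 2)⁻¹ + ddh e.θ (f.h x) (f.s x)) *
        (e.H (f.h x))⁻¹ * pd κ f.s x) := by
  have hz := hf.mem_dom x hx
  have hn := (e.n_pos hz).ne'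
  rw [pd_inv ((hf.contDiffAt_n hx).differentiableAt (by norm_num)) hn,
    hf.pd_eos hx (e.contDiffAt_n hz), e.ddh_n hz, e.dds_n hz]
  field_simp
  ring

/-- The product rule for `𝒞^α`, in the form `C_eq`. -/
theorem pd_C (κ α : Fin 4) : pd κ (fun y => f.C e y α) x =
    -(∑ β, ∑ γ, ∑ δ, epsUp α β γ δ *
      (lower (fun ν => pd κ (fun z => f.u z ν) x) β *
        lower (fun ν => pd γ (fun z => f.w e z ν) x) δ +
        lower (f.u x) β * lower (fun ν => pd κ (pd γ (fun z => f.w e z ν)) x) δ)) +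
    (-(2 * (e.c (f.h x) (f.s x) ^ 3)⁻¹ * (ddh e.c (f.h x) (f.s x) * pd κ f.h x +
      dds e.c (f.h x) (f.s x) * pd κ f.s x)) * (∑ β, ∑ γ, ∑ δ, epsUp α β γ δ *
      (lower (f.u x) β * (pd γ f.h x * lower (f.w e x) δ))) +
    (e.c (f.h x) (f.s x) ^ 2)⁻¹ * (∑ β, ∑ γ, ∑ δ, epsUp α β γ δ *
      (lower (fun ν => pd κ (fun z => f.u z ν) x) β * (pd γ f.h x * lower (f.w e x) δ) +
        lower (f.u x) β * (pd κ (pd γ f.h) x * lower (f.w e x) δ +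
          pd γ f.h x * lower (fun ν => pd κ (fun z => f.w e z ν) x) δ)))) +
    (((ddh e.θ (f.h x) (f.s x) - ddh (ddh e.θ) (f.h x) (f.s x)) * pd κ f.h x +
      (dds e.θ (f.h x) (f.s x) - dds (ddh e.θ) (f.h x) (f.s x)) * pd κ f.s x) *
      (f.S x α * (∑ l, pd l (fun z => f.u z l) x) + f.u x α * (∑ l, f.S x l * pd l f.h x) -
        eta α α * ∑ l, f.S x l * lower (fun ν => pd α (fun z => f.u z ν) x) l) +
    (e.θ (f.h x) (f.s x) - ddh e.θ (f.h x) (f.s x)) *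
      ((pd κ (fun z => f.S z α) x * (∑ l, pd l (fun z => f.u z l) x) +
        f.S x α * ∑ l, pd κ (pd l (fun z => f.u z l)) x) +
      (pd κ (fun z => f.u z α) x * (∑ l, f.S x l * pd l f.h x) +
        f.u x α * ∑ l, (pd κ (fun z => f.S z l) x * pd l f.h x +
          f.S x l * pd κ (pd l f.h) x)) -
        eta α α * ∑ l, (pd κ (fun z => f.S z l) x * lower (fun ν => pd α (fun z => f.u z ν) x) l +
          f.S x l * lower (fun ν => pd κ (pd α (fun z => f.u z ν)) x) l))) := by
  have h0 : ∀ γ δ, DifferentiableAt ℝ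
      (fun y => lower (fun ν => pd γ (fun z => f.w e z ν) y) δ) x := fun γ δ => by
    simp only [lower_eq]
    exact (hf.diff_pd_w hx γ δ).const_mul _
  have h1 : ∀ γ δ, DifferentiableAt ℝ
      (fun y => lower (fun ν => pd γ (fun z => f.u z ν) y) δ) x := fun γ δ => by
    simp only [lower_eq]
    exact (hf.diff_pd_u hx γ δ).const_mul _
  have h2 : ∀ δ, DifferentiableAt ℝ (fun y => lower (f.w e y) δ) x := fun δ => by
    simp only [lower_eq]
    exact (hf.diff_w hx δ).const_mul _
  have h3 := fun β γ δ => (hf.diff_lower_u hx β).fun_mul (h0 γ δ)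
  have h4 := fun γ δ => (hf.diff_pd_h hx γ).fun_mul (h2 δ)
  have h5 := fun β γ δ => (hf.diff_lower_u hx β).fun_mul (h4 γ δ)
  have h6 : DifferentiableAt ℝ (fun y => ∑ l, pd l (fun z => f.u z l) y) x :=
    DifferentiableAt.fun_sum fun l _ => hf.diff_pd_u hx l l
  have h7 : DifferentiableAt ℝ (fun y => ∑ l, f.S y l * pd l f.h y) x :=
    DifferentiableAt.fun_sum fun l _ => (hf.diff_S hx l).fun_mul (hf.diff_pd_h hx l)
  have h8 : DifferentiableAt ℝ
      (fun y => ∑ l, f.S y l * lower (fun ν => pd α (fun z => f.u z ν) y) l) x :=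
    DifferentiableAt.fun_sum fun l _ => (hf.diff_S hx l).fun_mul (h1 α l)
  have h9 := (hf.diff_S hx α).fun_mul h6
  have h10 := (hf.diff_u hx α).fun_mul h7
  have h11 := h8.const_mul (eta α α)
  have h12 := differentiableAt_sum_epsUp h3 α
  have h13 := differentiableAt_sum_epsUp h5 α
  rw [show (fun y => f.C e y α) = _ from funext fun y => C_eq y α,
    pd_add (h12.fun_neg.fun_add ((hf.diff_inv_c_sq hx).fun_mul h13))
      ((hf.diff_temp hx).fun_mul ((h9.fun_add h10).fun_sub h11)),
    pd_add h12.fun_neg ((hf.diff_inv_c_sq hx).fun_mul h13), pd_neg,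
    pd_mul (hf.diff_inv_c_sq hx) h13, pd_mul (hf.diff_temp hx) ((h9.fun_add h10).fun_sub h11),
    pd_sub (h9.fun_add h10) h11, pd_add h9 h10, pd_mul (hf.diff_S hx α) h6,
    pd_mul (hf.diff_u hx α) h7, pd_const_mul _ h8, pd_sum fun l => hf.diff_pd_u hx l l,
    pd_sum_mul (hf.diff_S hx) (hf.diff_pd_h hx), pd_sum_mul (hf.diff_S hx) (h1 α),
    pd_sum_epsUp h3, pd_sum_epsUp h5, hf.pd_inv_c_sq hx, hf.pd_temp hx]
  simp only [fun β γ δ => pd_mul (hf.diff_lower_u hx β) (h0 γ δ) κ,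
    fun β γ δ => pd_mul (hf.diff_lower_u hx β) (h4 γ δ) κ,
    fun γ δ => pd_mul (hf.diff_pd_h hx γ) (h2 δ) κ, pd_lower (hf.diff_u hx),
    pd_lower (hf.diff_w hx),
    fun γ => pd_lower (V := fun y ν => pd γ (fun z => f.u z ν) y) (hf.diff_pd_u hx γ),
    fun γ => pd_lower (V := fun y ν => pd γ (fun z => f.w e z ν) y) (hf.diff_pd_w hx γ)]

/-- The product rule for `𝒟`. -/
theorem pd_D (κ : Fin 4) : pd κ (f.D e) x =
    (e.n (f.h x) (f.s x))⁻¹ * (-((e.c (f.h x) (f.s x) ^ 2)⁻¹ * pd κ f.h x) +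
      (e.θ (f.h x) (f.s x) * (e.c (f.h x) (f.s x) ^ 2)⁻¹ + ddh e.θ (f.h x) (f.s x)) *
        (e.H (f.h x))⁻¹ * pd κ f.s x) * ((∑ l, pd l (fun z => f.S z l) x) +
    (1 - (e.c (f.h x) (f.s x) ^ 2)⁻¹) * ∑ l, f.S x l * pd l f.h x) +
    (e.n (f.h x) (f.s x))⁻¹ * ((∑ l, pd κ (pd l (fun z => f.S z l)) x) +
      (2 * (e.c (f.h x) (f.s x) ^ 3)⁻¹ * (ddh e.c (f.h x) (f.s x) * pd κ f.h x +
        dds e.c (f.h x) (f.s x) * pd κ f.s x) * (∑ l, f.S x l * pd l f.h x) +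
      (1 - (e.c (f.h x) (f.s x) ^ 2)⁻¹) * ∑ l, (pd κ (fun z => f.S z l) x * pd l f.h x +
        f.S x l * pd κ (pd l f.h) x))) := by
  have hn := (e.n_pos (hf.mem_dom x hx)).ne'
  have h1 : DifferentiableAt ℝ (fun y => ∑ l, pd l (fun z => f.S z l) y) x :=
    DifferentiableAt.fun_sum fun l _ => hf.diff_pd_S hx l l
  have h2 : DifferentiableAt ℝ (fun y => ∑ l, f.S y l * pd l f.h y) x :=
    DifferentiableAt.fun_sum fun l _ => (hf.diff_S hx l).fun_mul (hf.diff_pd_h hx l)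
  have h3 : DifferentiableAt ℝ (fun y => 1 - (e.c (f.h y) (f.s y) ^ 2)⁻¹) x :=
    (hf.diff_inv_c_sq hx).const_sub 1
  have h4 : DifferentiableAt ℝ (fun y => (e.n (f.h y) (f.s y))⁻¹) x :=
    ((hf.contDiffAt_n hx).differentiableAt (by norm_num)).fun_inv hn
  rw [show f.D e = _ from funext D_eq, pd_mul h4 (h1.fun_add (h3.fun_mul h2)),
    pd_add h1 (h3.fun_mul h2), pd_mul h3 h2, pd_sub (differentiableAt_const 1)
    (hf.diff_inv_c_sq hx), pd_const, pd_sum fun l => hf.diff_pd_S hx l l, pd_sum_mul (hf.diff_S hx) (hf.diff_pd_h hx),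
    hf.pd_inv_c_sq hx, hf.pd_inv_n hx]
  ring

theorem pd_pd_S (κ l α : Fin 4) : pd κ (pd l (fun y => f.S y α)) x =
    eta α α * pd κ (pd l (pd α f.s)) x := by
  rw [pd_congr ((hf.eventually_mem hx).mono fun y hy => hf.pd_S hy l α)]
  exact pd_const_mul _ (((contDiffAt_pd (m := 1) (contDiffAt_pd (m := 2) (hf.contDiffAt_s hx)
    (by norm_num) α) (by norm_num) l)).differentiableAt (by norm_num)) κ

theorem diff_pd_pd_s (κ l : Fin 4) : DifferentiableAt ℝ (fun y => pd κ (pd l f.s) y) x :=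
  (contDiffAt_pd (m := 1) (contDiffAt_pd (m := 2) (hf.contDiffAt_s hx)
    (by norm_num) l) (by norm_num) κ).differentiableAt (by norm_num)

/-- The entropy equation, differentiated twice. -/
theorem pd_pd_entropy (κ m : Fin 4) :
    ∑ l, ((pd κ (pd m (fun y => f.u y l)) x * pd l f.s x +
        pd m (fun y => f.u y l) x * pd κ (pd l f.s) x) +
      (pd κ (fun y => f.u y l) x * pd m (pd l f.s) x +
        f.u x l * pd κ (pd m (pd l f.s)) x)) = 0 := by
  have h := hf.pd_eq_zero hx (fun y hy => hf.pd_entropy hy m) κ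
  have h1 := fun l => (hf.diff_pd_u hx m l).fun_mul (hf.diff_pd_s hx l)
  have h2 := fun l => (hf.diff_u hx l).fun_mul (hf.diff_pd_pd_s hx m l)
  rw [pd_sum fun l => (h1 l).fun_add (h2 l)] at h
  refine (Finset.sum_congr rfl fun l _ => ?_).trans h
  rw [pd_add (h1 l) (h2 l), pd_mul (hf.diff_pd_u hx m l) (hf.diff_pd_s hx l),
    pd_mul (hf.diff_u hx l) (hf.diff_pd_pd_s hx m l)]

theorem pd_pd_pd_rotate (κ : Fin 4) : pd 0 (pd κ (pd κ f.s)) x = pd κ (pd κ (pd 0 f.s)) x := by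
  rw [pd_comm (contDiffAt_pd (m := 2) (hf.contDiffAt_s hx) (by norm_num) κ) 0 κ]
  exact pd_congr ((hf.eventually_mem hx).mono fun y hy => hf.pd_comm_s hy 0 κ) κ

/-- The transport equation of the vorticity, differentiated once. It holds at all points of `Ω`, and
not only where the fluid is at rest. -/
theorem pd_transport_w (κ α : Fin 4) :
    ∑ l, (pd κ (fun y => f.u y l) x * pd l (fun y => f.w e y α) x +
      f.u x l * pd κ (pd l (fun y => f.w e y α)) x) =
    -(pd κ (fun y => f.u y α) x * (∑ l, f.w e x l * pd l f.h x) +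
      f.u x α * ∑ l, (pd κ (fun y => f.w e y l) x * pd l f.h x +
        f.w e x l * pd κ (pd l f.h) x)) +
    (∑ l, (pd κ (fun y => f.w e y l) x * pd l (fun y => f.u y α) x +
      f.w e x l * pd κ (pd l (fun y => f.u y α)) x)) -
    (pd κ (fun y => f.w e y α) x * (∑ l, pd l (fun y => f.u y l) x) +
      f.w e x α * ∑ l, pd κ (pd l (fun y => f.u y l)) x) +
    (((ddh e.θ (f.h x) (f.s x) - ddh (ddh e.θ) (f.h x) (f.s x)) * pd κ f.h x +
      (dds e.θ (f.h x) (f.s x) - dds (ddh e.θ) (f.h x) (f.s x)) * pd κ f.s x) *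
      (∑ β, ∑ γ, ∑ δ, epsUp α β γ δ * (lower (f.u x) β * (pd γ f.h x * lower (f.S x) δ))) +
    (e.θ (f.h x) (f.s x) - ddh e.θ (f.h x) (f.s x)) * (∑ β, ∑ γ, ∑ δ, epsUp α β γ δ *
      (lower (fun ν => pd κ (fun y => f.u y ν) x) β * (pd γ f.h x * lower (f.S x) δ) +
        lower (f.u x) β * (pd κ (pd γ f.h) x * lower (f.S x) δ +
          pd γ f.h x * lower (fun ν => pd κ (fun y => f.S y ν) x) δ)))) +
    ((ddh e.q (f.h x) (f.s x) * pd κ f.h x + dds e.q (f.h x) (f.s x) * pd κ f.s x) *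
      (f.u x α * ∑ l, f.w e x l * lower (f.S x) l) +
    e.q (f.h x) (f.s x) * (pd κ (fun y => f.u y α) x * (∑ l, f.w e x l * lower (f.S x) l) +
      f.u x α * ∑ l, (pd κ (fun y => f.w e y l) x * lower (f.S x) l +
        f.w e x l * lower (fun ν => pd κ (fun y => f.S y ν) x) l))) := by
  have hS : ∀ δ, DifferentiableAt ℝ (fun y => lower (f.S y) δ) x := fun δ => by
    simp only [lower_eq]
    exact (hf.diff_S hx δ).const_mul _
  have h1 : DifferentiableAt ℝ (fun y => ∑ l, f.w e y l * pd l f.h y) x :=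
    DifferentiableAt.fun_sum fun l _ => (hf.diff_w hx l).fun_mul (hf.diff_pd_h hx l)
  have h2 : DifferentiableAt ℝ (fun y => ∑ l, f.w e y l * pd l (fun z => f.u z α) y) x :=
    DifferentiableAt.fun_sum fun l _ => (hf.diff_w hx l).fun_mul (hf.diff_pd_u hx l α)
  have h3 : DifferentiableAt ℝ (fun y => ∑ l, pd l (fun z => f.u z l) y) x :=
    DifferentiableAt.fun_sum fun l _ => hf.diff_pd_u hx l l
  have h4 := fun γ δ => (hf.diff_pd_h hx γ).fun_mul (hS δ)
  have h5 := fun β γ δ => (hf.diff_lower_u hx β).fun_mul (h4 γ δ)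
  have h6 : DifferentiableAt ℝ (fun y => ∑ l, f.w e y l * lower (f.S y) l) x :=
    DifferentiableAt.fun_sum fun l _ => (hf.diff_w hx l).fun_mul (hS l)
  have t1 := ((hf.diff_u hx α).fun_mul h1).fun_neg
  have t3 := (hf.diff_w hx α).fun_mul h3
  have t4 := (hf.diff_temp hx).fun_mul (differentiableAt_sum_epsUp h5 α)
  have t5 := (hf.diff_u hx α).fun_mul h6
  have t6 := (hf.diff_q hx).fun_mul t5
  have h : pd κ (fun y => ∑ l, f.u y l * pd l (fun z => f.w e z α) y) x =
      pd κ (fun y => -(f.u y α * ∑ l, f.w e y l * pd l f.h y) +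
        (∑ l, f.w e y l * pd l (fun z => f.u z α) y) -
        f.w e y α * (∑ l, pd l (fun z => f.u z l) y) +
        (e.θ (f.h y) (f.s y) - ddh e.θ (f.h y) (f.s y)) *
          (∑ β, ∑ γ, ∑ δ, epsUp α β γ δ * (lower (f.u y) β * (pd γ f.h y * lower (f.S y) δ))) +
        e.q (f.h y) (f.s y) * (f.u y α * ∑ l, f.w e y l * lower (f.S y) l)) x :=
    pd_congr ((hf.eventually_mem hx).mono fun y hy => by
      simpa only [Fluid.transport, Fluid.eval, rhsTransportW, Fluid.state, Fluid.grad, mul_assoc]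
        using hf.transport_w hy α) κ
  rw [pd_sum_mul (hf.diff_u hx) (fun l => hf.diff_pd_w hx l α)] at h
  rw [h, pd_add (((t1.fun_add h2).fun_sub t3).fun_add t4) t6,
    pd_add ((t1.fun_add h2).fun_sub t3) t4, pd_sub (t1.fun_add h2) t3, pd_add t1 h2, pd_neg,
    pd_mul (hf.diff_u hx α) h1, pd_mul (hf.diff_w hx α) h3,
    pd_mul (hf.diff_temp hx) (differentiableAt_sum_epsUp h5 α), pd_mul (hf.diff_q hx) t5,
    pd_mul (hf.diff_u hx α) h6, pd_sum fun l => hf.diff_pd_u hx l l,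
    pd_sum_mul (hf.diff_w hx) (hf.diff_pd_h hx), pd_sum_mul (hf.diff_w hx) hS,
    pd_sum_mul (hf.diff_w hx) (fun l => hf.diff_pd_u hx l α), pd_sum_epsUp h5, hf.pd_temp hx,
    hf.pd_eos hx (e.contDiffAt_q (hf.mem_dom x hx))]
  simp only [fun β γ δ => pd_mul (hf.diff_lower_u hx β) (h4 γ δ) κ,
    fun γ δ => pd_mul (hf.diff_pd_h hx γ) (hS δ) κ, pd_lower (hf.diff_u hx),
    pd_lower (hf.diff_S hx)]

end Fluid.IsSolution

/-! ### The transport equation for the modified divergence -/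

namespace Fluid.IsSolution

variable {f : Fluid} {e : EquationOfState} {Ω : Set Spacetime} (hf : f.IsSolution e Ω)
  {x : Spacetime} (hx : x ∈ Ω) (hu : f.u x = restVelocity)

include hf hx hu

/-- The third derivatives of `s` in `u^κ ∂_κ 𝒟` are of the form `∂_κ ∂_κ ∂_0 s`. -/
theorem rest_pd_pd_pd_zero_s (κ : Fin 4) : pd κ (pd κ (pd 0 f.s)) x =
    -(pd κ (pd κ (fun y => f.u y 1)) x * pd 1 f.s x +
      pd κ (pd κ (fun y => f.u y 2)) x * pd 2 f.s x +
      pd κ (pd κ (fun y => f.u y 3)) x * pd 3 f.s x) -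
    2 * (pd κ (fun y => f.u y 1) x * pd κ (pd 1 f.s) x +
      pd κ (fun y => f.u y 2) x * pd κ (pd 2 f.s) x +
      pd κ (fun y => f.u y 3) x * pd κ (pd 3 f.s) x) := by
  have h := hf.pd_pd_entropy hx κ κ
  obtain ⟨h0, h1, h2, h3⟩ := rest_u hu
  simp only [Fin.sum_univ_four, h0, h1, h2, h3, hf.rest_pd_u_zero hx hu,
    hf.rest_pd_zero_s hx hu] at h
  linarith

theorem rest_transportD : f.transport (f.D e) x = f.eval e (rhsTransportD e) x := by
  have hc := hf.c_ne_zero hx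
  have hz := hf.mem_dom x hx
  have hn := (e.n_pos hz).ne'
  have hH := (e.H_pos (f.h x)).ne'
  -- `θ` and `θ_{;h}` are eliminated in favour of `q` and `q_{;h}`
  have hq : e.θ (f.h x) (f.s x) = e.q (f.h x) (f.s x) * e.H (f.h x) := by
    rw [EquationOfState.q, div_mul_cancel₀ _ hH]
  have hqh : ddh e.θ (f.h x) (f.s x) = e.H (f.h x) * (ddh e.q (f.h x) (f.s x) +
      e.q (f.h x) (f.s x)) := by
    rw [e.ddh_q hz, hq]
    field_simp
    ring
  obtain ⟨u0, u1, u2, u3⟩ := rest_u hu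
  obtain ⟨w0, w1, w2, w3⟩ := hf.rest_w hx hu
  have s1 := hf.rest_pd_zero_s hx hu
  have s2 := hf.rest_pd_zero_h hx hu
  have s3 := hf.rest_pd_zero_u hx hu (i := 1) (by decide)
  have s4 := hf.rest_pd_zero_u hx hu (i := 2) (by decide)
  have s5 := hf.rest_pd_zero_u hx hu (i := 3) (by decide)
  have t1 := fun κ => hf.rest_pd_pd_zero_u hx hu κ (i := 1) (by decide)
  have t2 := fun κ => hf.rest_pd_pd_zero_u hx hu κ (i := 2) (by decide)
  have t3 := fun κ => hf.rest_pd_pd_zero_u hx hu κ (i := 3) (by decide)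
  simp only [Fluid.transport, hf.pd_D hx, Fin.sum_univ_four, u0, u1, u2, u3, zero_mul, add_zero,
    one_mul]
  simp only [Fluid.eval, rhsTransportD, QDS, QD, LD, C_eq, Fluid.state, Fluid.grad, mul_assoc,
    sum_epsUp]
  simp [Fin.sum_univ_four, lower_eq, u0, u1, u2, u3, w0, w1, w2, w3, hf.rest_pd_w hx hu,
    hf.rest_pd_u_zero hx hu, eta_zero_zero, eta_one_one, eta_two_two, eta_three_three,
    hf.pd_pd_S hx, hf.pd_S hx, hf.pd_pd_pd_rotate hx]
  simp only [S_apply, hf.rest_pd_pd_pd_zero_s hx hu,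
    hf.pd_comm_s hx 0 1, hf.pd_comm_s hx 0 2, hf.pd_comm_s hx 0 3, hf.pd_comm_s hx 2 1,
    hf.pd_comm_s hx 3 1, hf.pd_comm_s hx 3 2, hf.pd_comm_h hx 0 1, hf.pd_comm_h hx 0 2,
    hf.pd_comm_h hx 0 3, hf.pd_comm_u hx 0 1, hf.pd_comm_u hx 0 2, hf.pd_comm_u hx 0 3,
    hf.pd_comm_u hx 2 1, hf.pd_comm_u hx 3 1, hf.pd_comm_u hx 3 2]
  simp only [t1, t2, t3, hf.pd_comm_h hx 0 1, hf.pd_comm_h hx 0 2, hf.pd_comm_h hx 0 3,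
    hf.pd_comm_s hx 0 1, hf.pd_comm_s hx 0 2, hf.pd_comm_s hx 0 3]
  simp only [hf.rest_pd_pd_zero_h hx hu, hf.rest_pd_pd_zero_s hx hu, hf.rest_pd_pd_u_zero hx hu,
    hf.pd_comm_u hx 2 1, hf.pd_comm_u hx 3 1, hf.pd_comm_u hx 3 2]
  simp only [s1, s2, s3, s4, s5, hq, hqh, eta_zero_zero, eta_one_one, eta_two_two, eta_three_three]
  field_simp
  ring

end Fluid.IsSolution

/-! ### The transport equation for the modified vorticity of the vorticity -/

theorem sum_rest {u : Fin 4 → ℝ} (hu : u = restVelocity) (A B : Fin 4 → ℝ) :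
    ∑ l, (A l + u l * B l) = (∑ l, A l) + B 0 := by
  simp [hu, restVelocity, Fin.sum_univ_four]
  ring

namespace Fluid.IsSolution

variable {f : Fluid} {e : EquationOfState} {Ω : Set Spacetime} (hf : f.IsSolution e Ω)
  {x : Spacetime} (hx : x ∈ Ω) (hu : f.u x = restVelocity)

include hf hx hu

set_option maxHeartbeats 1600000 in
theorem rest_transportC (α : Fin 4) :
    f.transport (fun y => f.C e y α) x = f.eval e (rhsTransportC e α) x := by
  have hc := hf.c_ne_zero hx
  have hz := hf.mem_dom x hx
  have hn := (e.n_pos hz).ne'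
  have hH := (e.H_pos (f.h x)).ne'
  -- first derivatives of `θ` are eliminated in favour of `q`; `θ_{;h;h}` and `θ_{;h;s}` remain
  have hq : e.θ (f.h x) (f.s x) = e.q (f.h x) (f.s x) * e.H (f.h x) := by
    rw [EquationOfState.q, div_mul_cancel₀ _ hH]
  have hqh : ddh e.θ (f.h x) (f.s x) = e.H (f.h x) * (ddh e.q (f.h x) (f.s x) +
      e.q (f.h x) (f.s x)) := by
    rw [e.ddh_q hz, hq]
    field_simp
    ring
  have hqs : dds e.θ (f.h x) (f.s x) = e.H (f.h x) * dds e.q (f.h x) (f.s x) := by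
    rw [e.dds_q hz]
    field_simp
  obtain ⟨u0, u1, u2, u3⟩ := rest_u hu
  obtain ⟨w0, w1, w2, w3⟩ := hf.rest_w hx hu
  have s1 := hf.rest_pd_zero_s hx hu
  have s2 := hf.rest_pd_zero_h hx hu
  have s3 := hf.rest_pd_zero_u hx hu (i := 1) (by decide)
  have s4 := hf.rest_pd_zero_u hx hu (i := 2) (by decide)
  have s5 := hf.rest_pd_zero_u hx hu (i := 3) (by decide)
  have t1 := fun κ => hf.rest_pd_pd_zero_u hx hu κ (i := 1) (by decide)
  have t2 := fun κ => hf.rest_pd_pd_zero_u hx hu κ (i := 2) (by decide)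
  have t3 := fun κ => hf.rest_pd_pd_zero_u hx hu κ (i := 3) (by decide)
  -- the second derivatives `∂_κ ∂_0 ϖ^α`, from the differentiated transport equation
  have hw := fun κ α => eq_sub_of_add_eq' ((sum_rest hu _ _).symm.trans (hf.pd_transport_w hx κ α))
  rw [show f.transport (fun y => f.C e y α) x = pd 0 (fun y => f.C e y α) x by
    simp [Fluid.transport, Fin.sum_univ_four, u0, u1, u2, u3], hf.pd_C hx]
  simp only [Fluid.eval, rhsTransportC, QCS, QC, LC, D_eq, C_eq, Fluid.state, Fluid.grad,
    gDot_rest e hu, mul_assoc, sum_epsUp, sum_eta]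
  fin_cases α
  all_goals
    simp only [Fin.zero_eta, Fin.mk_one, Fin.reduceFinMk]
  -- in the time component the second derivatives of `ϖ` drop out, since `u` has no spatial part
  · simp [Fin.sum_univ_four, lower_eq, u0, u1, u2, u3, w0, w1, w2, w3, hf.rest_pd_w hx hu,
      hf.rest_pd_u_zero hx hu, eta_zero_zero, eta_one_one, eta_two_two, eta_three_three, hf.pd_S hx,
      eta_of_ne]
    simp only [S_apply, hf.pd_comm_s hx 0 1, hf.pd_comm_s hx 0 2, hf.pd_comm_s hx 0 3,
      hf.pd_comm_s hx 2 1, hf.pd_comm_s hx 3 1, hf.pd_comm_s hx 3 2, hf.pd_comm_h hx 0 1,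
      hf.pd_comm_h hx 0 2, hf.pd_comm_h hx 0 3, hf.pd_comm_u hx 0 1, hf.pd_comm_u hx 0 2,
      hf.pd_comm_u hx 0 3, hf.pd_comm_u hx 2 1, hf.pd_comm_u hx 3 1, hf.pd_comm_u hx 3 2]
    simp only [t1, t2, t3, hf.pd_comm_h hx 0 1, hf.pd_comm_h hx 0 2, hf.pd_comm_h hx 0 3,
      hf.pd_comm_s hx 0 1, hf.pd_comm_s hx 0 2, hf.pd_comm_s hx 0 3]
    simp only [hf.rest_pd_pd_zero_h hx hu, hf.rest_pd_pd_zero_s hx hu, hf.rest_pd_pd_u_zero hx hu,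
      hf.pd_comm_u hx 2 1, hf.pd_comm_u hx 3 1, hf.pd_comm_u hx 3 2,
      hf.pd_comm_h hx 2 1, hf.pd_comm_h hx 3 1, hf.pd_comm_h hx 3 2,
      hf.pd_comm_s hx 2 1, hf.pd_comm_s hx 3 1, hf.pd_comm_s hx 3 2]
    simp only [s1, s2, s3, s4, s5, hq, hqh, hqs, eta_zero_zero, eta_one_one, eta_two_two,
      eta_three_three]
    field_simp
    ring
  all_goals
    simp [Fin.sum_univ_four, lower_eq, u0, u1, u2, u3, w0, w1, w2, w3,
      hf.rest_pd_u_zero hx hu, eta_zero_zero, eta_one_one, eta_two_two, eta_three_three, hf.pd_S hx,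
      eta_of_ne]
    simp only [hf.pd_comm_w hx 0 1, hf.pd_comm_w hx 0 2, hf.pd_comm_w hx 0 3, hw, mul_assoc,
      sum_epsUp]
    simp [Fin.sum_univ_four, lower_eq, u0, u1, u2, u3, w0, w1, w2, w3, hf.rest_pd_w hx hu,
      hf.rest_pd_u_zero hx hu, eta_zero_zero, eta_one_one, eta_two_two, eta_three_three, hf.pd_S hx,
      eta_of_ne]
    simp only [S_apply, hf.pd_comm_s hx 0 1, hf.pd_comm_s hx 0 2, hf.pd_comm_s hx 0 3,
      hf.pd_comm_s hx 2 1, hf.pd_comm_s hx 3 1, hf.pd_comm_s hx 3 2, hf.pd_comm_h hx 0 1,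
      hf.pd_comm_h hx 0 2, hf.pd_comm_h hx 0 3, hf.pd_comm_u hx 0 1, hf.pd_comm_u hx 0 2,
      hf.pd_comm_u hx 0 3, hf.pd_comm_u hx 2 1, hf.pd_comm_u hx 3 1, hf.pd_comm_u hx 3 2]
    simp only [t1, t2, t3, hf.pd_comm_h hx 0 1, hf.pd_comm_h hx 0 2, hf.pd_comm_h hx 0 3,
      hf.pd_comm_s hx 0 1, hf.pd_comm_s hx 0 2, hf.pd_comm_s hx 0 3]
    simp only [hf.rest_pd_pd_zero_h hx hu, hf.rest_pd_pd_zero_s hx hu, hf.rest_pd_pd_u_zero hx hu,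
      hf.pd_comm_u hx 2 1, hf.pd_comm_u hx 3 1, hf.pd_comm_u hx 3 2,
      hf.pd_comm_h hx 2 1, hf.pd_comm_h hx 3 1, hf.pd_comm_h hx 3 2,
      hf.pd_comm_s hx 2 1, hf.pd_comm_s hx 3 1, hf.pd_comm_s hx 3 2]
    simp only [s1, s2, s3, s4, s5, hq, hqh, hqs, eta_zero_zero, eta_one_one, eta_two_two,
      eta_three_three]
    field_simp
    ring

end Fluid.IsSolution

/-! ### The transport equations for `𝒟` and `𝒞` in general position -/

namespace Fluid.IsSolution

variable {f : Fluid} {e : EquationOfState} {Ω : Set Spacetime} (hf : f.IsSolution e Ω)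
  {x : Spacetime} (hx : x ∈ Ω)

include hf hx

theorem transport_D : f.transport (f.D e) x = f.eval e (rhsTransportD e) x := by
  have hd : ∀ {f : Fluid} {Ω : Set Spacetime}, f.IsSolution e Ω → ∀ {x}, x ∈ Ω →
      DifferentiableAt ℝ (f.D e) x := fun hf _ hx =>
    (hf.contDiffAt_D hx).differentiableAt (by norm_num)
  refine eq_of_restFrame_scalar (e := e) (A := fun f x => f.transport (f.D e) x)
    (B := fun f x => f.eval e (rhsTransportD e) x) ?_ ?_ ?_ hf hx
  · intro f Ω hf M x₀ y hM hy
    exact hf.transport_transform hM (hd hf hy.1) hy fun z hz => hf.D_transform hM hz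
  · intro f Ω hf M x₀ y hM hy
    exact (hf.isRelated hM hy).rhsTransportD hM e (f.D e (chart x₀ M y)) (hf.isVec_C hM hy)
  · exact fun hf _ hx hu => hf.rest_transportD hx hu

theorem transport_C (α : Fin 4) :
    f.transport (fun y => f.C e y α) x = f.eval e (rhsTransportC e α) x := by
  have hd : ∀ {f : Fluid} {Ω : Set Spacetime}, f.IsSolution e Ω → ∀ {x}, x ∈ Ω →
      ∀ α, DifferentiableAt ℝ (fun y => f.C e y α) x := fun hf _ hx α =>
    (hf.contDiffAt_C hx α).differentiableAt (by norm_num)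
  refine congrFun (eq_of_restFrame (e := e)
    (A := fun f x α => f.transport (fun y => f.C e y α) x)
    (B := fun f x α => f.eval e (rhsTransportC e α) x) ?_ ?_ ?_ hf hx) α
  · intro f Ω hf M x₀ y hM hy
    exact hf.isVec_transport hM (hd hf hy.1) (hd (hf.transform hM) hy) hy
      fun z hz => hf.isVec_C hM hz
  · intro f Ω hf M x₀ y hM hy
    simp only [Fluid.eval, hf.D_transform hM hy]
    exact (hf.isRelated hM hy).rhsTransportC hM e (f.D e (chart x₀ M y)) (hf.isVec_C hM hy)
  · exact fun hf _ hx hu => funext fun α => hf.rest_transportC hx hu α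

end Fluid.IsSolution

end RelEuler

end

open RelEuler
theorem theorem3p1 (e : EquationOfState) :
    -- the terms `𝔔` are null forms and the terms `𝔏` are (at most) linear in the derivatives
    (Qh e ∈ nullForms e ∧ (∀ α, Qu e α ∈ nullForms e) ∧ QD e ∈ nullForms e ∧
      QDS e ∈ nullForms e ∧ (∀ α, QC e α ∈ nullForms e) ∧ (∀ α, QCS e α ∈ nullForms e) ∧
      Lh e ∈ atMostLinear ∧ (∀ α, Lu e α ∈ atMostLinear) ∧ Ls e ∈ atMostLinear ∧
      LD e ∈ linearForms ∧ (∀ α, LC e α ∈ atMostLinear)) ∧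
    -- the structure of the right-hand sides
    (HasNullStructure e (rhsWaveH e) ∧ (∀ α, HasNullStructure e (rhsWaveU e α)) ∧
      HasNullStructure e (rhsWaveS e) ∧ (∀ α, HasNullStructure e (rhsTransportS α)) ∧
      (∀ α, HasNullStructure e (rhsTransportW e α)) ∧ HasNullStructure e (rhsTransportD e) ∧
      HasNullStructure e (rhsDivW e) ∧ (∀ α, HasNullStructure e (rhsTransportC e α))) ∧
    -- the equations
    ∀ (f : Fluid) (Ω : Set Spacetime), f.IsSolution e Ω →
      (ContDiffOn ℝ 2 f.S Ω ∧ ContDiffOn ℝ 2 (f.w e) Ω ∧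
        ContDiffOn ℝ 1 (f.C e) Ω ∧ ContDiffOn ℝ 1 (f.D e) Ω) ∧
      ∀ x ∈ Ω,
        -- wave equations
        f.boxg e f.h x = f.eval e (rhsWaveH e) x ∧
        (∀ α, f.boxg e (fun y => f.u y α) x = f.eval e (rhsWaveU e α) x) ∧
        f.boxg e f.s x = f.eval e (rhsWaveS e) x ∧
        -- transport equations
        (∀ α, f.transport (fun y => f.S y α) x = f.eval e (rhsTransportS α) x) ∧
        (∀ α, f.transport (fun y => f.w e y α) x = f.eval e (rhsTransportW e α) x) ∧
        -- transport-div-curl system for the entropy gradient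
        f.transport (f.D e) x = f.eval e (rhsTransportD e) x ∧
        (∀ α, vort f.u f.SForm x α = 0) ∧
        -- transport-div-curl system for the vorticity
        (∑ α, pd α (fun y => f.w e y α) x) = f.eval e (rhsDivW e) x ∧
        (∀ α, f.transport (fun y => f.C e y α) x = f.eval e (rhsTransportC e α) x) := by
  refine ⟨⟨Qh_mem e, Qu_mem e, QD_mem e, QDS_mem e, QC_mem e, QCS_mem e, Lh_mem e, Lu_mem e,
    Ls_mem e, LD_mem e, LC_mem e⟩, ⟨hasNullStructure_rhsWaveH e, hasNullStructure_rhsWaveU e,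
    hasNullStructure_rhsWaveS e, hasNullStructure_rhsTransportS e,
    hasNullStructure_rhsTransportW e, hasNullStructure_rhsTransportD e,
    hasNullStructure_rhsDivW e, hasNullStructure_rhsTransportC e⟩, fun f Ω hf => ⟨⟨?_, ?_, ?_, ?_⟩,
    fun x hx => ⟨hf.wave_h hx, hf.wave_u hx, hf.wave_s hx, hf.transport_S hx, hf.transport_w hx,
      hf.transport_D hx, hf.vort_S hx, hf.div_w hx, hf.transport_C hx⟩⟩⟩
  · exact contDiffOn_pi.2 fun α x hx => (hf.contDiffAt_S hx α).contDiffWithinAt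
  · exact contDiffOn_pi.2 fun α x hx => (hf.contDiffAt_w hx α).contDiffWithinAt
  · exact contDiffOn_pi.2 fun α x hx => (hf.contDiffAt_C hx α).contDiffWithinAt
  · exact fun x hx => (hf.contDiffAt_D hx).contDiffWithinAt
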